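/- Let $A_1,A_2$ be C*-algebras (not necessarily unital, separable, or nuclear), let $\beta$ be a C*-norm on the algebraic tensor product $A_1\odot A_2$, and let $C:=A_1\otimes_\beta A_2$ be the completion of $A_1\odot A_2$ in $\beta$. For a C*-algebra $A$ let $K(A)$ denote its Pedersen ideal, that is, the smallest dense two-sided ideal of $A$, and let $K(A)_+$ be the set of its positive elements. Let $LTC(A)$ be the cone of lower semicontinuous densely finite traces on $A$, that is, of the lower semicontinuous maps $\tau\colon A_+\to[0,\infty]$ that are additive, positively homogeneous, satisfy $\tau(x^*x)=\tau(xx^*)$ for all $x\in A$, and for which $\{a\in A_+:\tau(a)<\infty\}$ is dense in $A_+$. Such traces are finite on $K(A)_+$, and $LTC(A)$ carries the weak topology $\sigma(LTC(A),K(A))$, that is, the topology of pointwise convergence on $K(A)_+$. Let $LTC(A_1)\odot LTC(A_2)$ be the cone of all finite sums $\sum_i\tau_1^{(i)}\otimes\tau_2^{(i)}$ with $\tau_1^{(i)}\in LTC(A_1)$ and $\tau_2^{(i)}\in LTC(A_2)$, regarded as functionals on $K(A_1)\odot K(A_2)$. Then every $f\in LTC(A_1)\odot LTC(A_2)$ extends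 to $C$ in a unique way: there is exactly one $\tau\in LTC(C)$ such that $\tau(a\otimes b)=f(a\otimes b)$ for all $a\in K(A_1)_+$ and $b\in K(A_2)_+$. Let $LTC(A_1)\otimes_\beta LTC(A_2)$ be the closure of $LTC(A_1)\odot LTC(A_2)$, regarded by means of this extension as a set of functionals $K(C)_+\to[0,\infty)$, in the topology of pointwise convergence on $K(C)_+$. Then every element $\varphi$ of $LTC(A_1)\otimes_\beta LTC(A_2)$ is the restriction to $K(C)_+$ of a unique trace $\mathcal T(\varphi)\in LTC(C)$, and the map $\mathcal T$ so defined is an additive and positively homogeneous homeomorphism from $LTC(A_1)\otimes_\beta LTC(A_2)$ onto $LTC(C)$. -/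

import Mathlib

open scoped NNReal ENNReal TensorProduct

noncomputable section

namespace TracialCone

section Traces

variable (A : Type*) [NonUnitalCStarAlgebra A] [PartialOrder A] [StarOrderedRing A]

/-- The positive cone `A₊` of a C*-algebra. -/
abbrev Pos : Type _ := {a : A // 0 ≤ a}

variable {A}

/-- The element `t a` of `A₊`, for a real number `t ≥ 0` and `a ∈ A₊`. -/
def Pos.scale (t : ℝ≥0) (a : Pos A) : Pos A := ⟨(t : ℝ) • (a : A), smul_nonneg t.2 a.2⟩

/-- The element `x* x` of `A₊`. -/
def Pos.starMul (x : A) : Pos A := ⟨star x * x, star_mul_self_nonneg x⟩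

/-- A trace on `A₊`, with values in `[0, ∞]`. The convention `0 * ∞ = 0` is in force, so that
`τ 0 = 0`. -/
structure IsTrace (τ : Pos A → ℝ≥0∞) : Prop where
  add : ∀ a b : Pos A, τ (a + b) = τ a + τ b
  scale : ∀ (t : ℝ≥0) (a : Pos A), τ (a.scale t) = t * τ a
  tracial : ∀ x : A, τ (Pos.starMul x) = τ (Pos.starMul (star x))

/-- A trace is densely finite if the positive elements of finite trace are dense in `A₊`. -/
def DenselyFinite (τ : Pos A → ℝ≥0∞) : Prop := Dense {a : Pos A | τ a < ∞}

theorem IsTrace.mono {τ : Pos A → ℝ≥0∞} (hτ : IsTrace τ) {a b : Pos A} (h : (a : A) ≤ b) :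
    τ a ≤ τ b := by
  have : b = a + ⟨(b : A) - a, sub_nonneg.2 h⟩ := Subtype.ext (by simp)
  rw [this, hτ.add]
  exact le_self_add

theorem IsTrace.zero {τ : Pos A → ℝ≥0∞} (hτ : IsTrace τ) : τ 0 = 0 := by
  have h : Pos.scale 0 (0 : Pos A) = 0 := Subtype.ext (by simp [Pos.scale])
  simpa [h] using hτ.scale 0 0

/-- `τ (z* y z) ≤ ‖y‖ τ (z* z)`. -/
theorem IsTrace.conj_le {τ : Pos A → ℝ≥0∞} (hτ : IsTrace τ) (y : Pos A) (z : A) (w : Pos A)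
    (hw : (w : A) = star z * y * z) : τ w ≤ ‖(y : A)‖₊ * τ (Pos.starMul z) := by
  rw [← hτ.scale]
  refine hτ.mono ?_
  rw [hw]
  exact CStarAlgebra.star_left_conjugate_le_norm_smul (IsSelfAdjoint.of_nonneg y.2)

theorem IsTrace.sq_lt_top {τ : Pos A → ℝ≥0∞} (hτ : IsTrace τ) {y : Pos A} (hy : τ y < ∞) :
    τ (Pos.starMul (y : A)) < ∞ := by
  have hs : IsSelfAdjoint (CFC.sqrt (y : A)) := IsSelfAdjoint.of_nonneg (CFC.sqrt_nonneg _)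
  have hy' : IsSelfAdjoint (y : A) := IsSelfAdjoint.of_nonneg y.2
  have hq : CFC.sqrt (y : A) * CFC.sqrt (y : A) = y := CFC.sqrt_mul_sqrt_self _ y.2
  have h1 : Pos.starMul (CFC.sqrt (y : A)) = y :=
    Subtype.ext (by simp [Pos.starMul, hs.star_eq, hq])
  refine (hτ.conj_le y (CFC.sqrt (y : A)) _ ?_).trans_lt ?_
  · simp only [Pos.starMul, hs.star_eq, hy'.star_eq]
    calc (y : A) * y
        = CFC.sqrt (y : A) * CFC.sqrt (y : A) * (CFC.sqrt (y : A) * CFC.sqrt (y : A)) := by rw [hq]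
      _ = CFC.sqrt (y : A) * (CFC.sqrt (y : A) * CFC.sqrt (y : A)) * CFC.sqrt (y : A) := by
        simp only [mul_assoc]
      _ = CFC.sqrt (y : A) * y * CFC.sqrt (y : A) := by rw [hq]
  · rw [h1]
    exact ENNReal.mul_lt_top ENNReal.coe_lt_top hy

/-- `τ (y z y) < ∞` whenever `τ y < ∞` or `τ z < ∞`. -/
theorem IsTrace.triple_lt_top {τ : Pos A → ℝ≥0∞} (hτ : IsTrace τ) {y z w : Pos A}
    (hw : (w : A) = y * z * y) (h : τ y < ∞ ∨ τ z < ∞) : τ w < ∞ := by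
  have hy' : IsSelfAdjoint (y : A) := IsSelfAdjoint.of_nonneg y.2
  rcases h with h | h
  · refine (hτ.conj_le z (y : A) w (by rw [hw, hy'.star_eq])).trans_lt ?_
    exact ENNReal.mul_lt_top ENNReal.coe_lt_top (hτ.sq_lt_top h)
  · have hs : IsSelfAdjoint (CFC.sqrt (z : A)) := IsSelfAdjoint.of_nonneg (CFC.sqrt_nonneg _)
    have hq : CFC.sqrt (z : A) * CFC.sqrt (z : A) = z := CFC.sqrt_mul_sqrt_self _ z.2
    have h1 : Pos.starMul (CFC.sqrt (z : A)) = z :=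
      Subtype.ext (by simp [Pos.starMul, hs.star_eq, hq])
    have h2 : w = Pos.starMul (CFC.sqrt (z : A) * y) := Subtype.ext (by
      simp only [Pos.starMul, star_mul, hs.star_eq, hy'.star_eq, hw]
      conv_lhs => rw [← hq]
      simp only [mul_assoc])
    rw [h2, hτ.tracial]
    refine (hτ.conj_le (Pos.starMul (y : A)) (CFC.sqrt (z : A)) _ ?_).trans_lt ?_
    · simp only [Pos.starMul, star_mul, hs.star_eq, hy'.star_eq, mul_assoc]
    · rw [h1]
      exact ENNReal.mul_lt_top ENNReal.coe_lt_top h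

theorem DenselyFinite.add {τ σ : Pos A → ℝ≥0∞} (hτ : IsTrace τ) (hσ : IsTrace σ)
    (dτ : DenselyFinite τ) (dσ : DenselyFinite σ) : DenselyFinite (τ + σ) := by
  let f : Pos A × Pos A → Pos A := fun p =>
    ⟨p.1 * p.2 * p.1, conjugate_nonneg_of_nonneg p.2.2 p.1.2⟩
  have hf : Continuous f := by
    refine Continuous.subtype_mk ?_ _
    fun_prop
  have hs : Function.Surjective f := by
    intro x
    refine ⟨(⟨(x : A) ^ ((3 : ℝ≥0)⁻¹), CFC.nnrpow_nonneg⟩,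
      ⟨(x : A) ^ ((3 : ℝ≥0)⁻¹), CFC.nnrpow_nonneg⟩), Subtype.ext ?_⟩
    change (x : A) ^ ((3 : ℝ≥0)⁻¹) * (x : A) ^ ((3 : ℝ≥0)⁻¹) * (x : A) ^ ((3 : ℝ≥0)⁻¹) = x
    rw [← CFC.nnrpow_three _ CFC.nnrpow_nonneg, CFC.nnrpow_inv_nnrpow _ (by norm_num) x.2]
  refine (hs.denseRange.dense_image hf (dτ.prod dσ)).mono ?_
  rintro _ ⟨p, hp, rfl⟩
  exact ENNReal.add_lt_top.2
    ⟨hτ.triple_lt_top rfl (Or.inl hp.1), hσ.triple_lt_top rfl (Or.inr hp.2)⟩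

variable (A)

/-- The lower semicontinuous densely finite traces, as a convex cone of functions on `A₊`. -/
def ltcCone : Submodule ℝ≥0 (Pos A → ℝ≥0∞) where
  carrier := {τ | IsTrace τ ∧ LowerSemicontinuous τ ∧ DenselyFinite τ}
  zero_mem' := by
    refine ⟨⟨by simp, by simp, by simp⟩, lowerSemicontinuous_const, ?_⟩
    simp [DenselyFinite]
  add_mem' := by
    rintro τ σ ⟨h1, h2, h3⟩ ⟨k1, k2, k3⟩
    refine ⟨⟨fun a b => ?_, fun t a => ?_, fun x => ?_⟩, h2.add k2, h3.add h1 k1 k3⟩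
    · simp only [Pi.add_apply, h1.add, k1.add]
      exact add_add_add_comm _ _ _ _
    · simp only [Pi.add_apply, h1.scale, k1.scale, mul_add]
    · simp only [Pi.add_apply, h1.tracial x, k1.tracial x]
  smul_mem' := by
    rintro c τ ⟨h1, h2, h3⟩
    have hc : ∀ a, (c • τ) a = c * τ a := fun a => rfl
    refine ⟨⟨fun a b => ?_, fun t a => ?_, fun x => ?_⟩, ?_, ?_⟩
    · simp only [hc, h1.add, mul_add]
    · simp only [hc, h1.scale, mul_left_comm]
    · simp only [hc, h1.tracial x]
    · have : (c • τ) = (fun y : ℝ≥0∞ => c * y) ∘ τ := rfl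
      rw [this]
      exact (ENNReal.continuous_const_mul ENNReal.coe_ne_top).comp_lowerSemicontinuous h2
        (fun a b h => by dsimp only; gcongr)
    · refine Dense.mono (fun a ha => ?_) h3
      exact ENNReal.mul_lt_top ENNReal.coe_lt_top ha

/-- `LTC(A)`: the cone of densely finite lower semicontinuous traces on `A`. -/
def LTC : Type _ := ltcCone A

namespace LTC

instance : AddCommMonoid (LTC A) := inferInstanceAs (AddCommMonoid (ltcCone A))

instance : Module ℝ≥0 (LTC A) := inferInstanceAs (Module ℝ≥0 (ltcCone A))

instance : CoeFun (LTC A) (fun _ => Pos A → ℝ≥0∞) := ⟨fun τ => Subtype.val τ⟩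

end LTC

/-- The Pedersen ideal `K(A)`: the smallest dense two-sided ideal of `A`, that is, the
intersection of all dense two-sided ideals of `A`. -/
def pedersenIdeal : Submodule ℂ A :=
  sInf {I : Submodule ℂ A | Dense (I : Set A) ∧ ∀ x ∈ I, ∀ a : A, a * x ∈ I ∧ x * a ∈ I}

/-- The positive part `K(A)₊` of the Pedersen ideal. -/
def PedPos : Type _ := {a : Pos A // (a : A) ∈ pedersenIdeal A}

variable {A}

/-- The elements `x` with `τ (x* x) < ∞` form a dense two-sided ideal. -/
theorem exists_sqIdeal {τ : Pos A → ℝ≥0∞} (hτ : IsTrace τ) (dτ : DenselyFinite τ) :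
    ∃ N : Submodule ℂ A, (∀ x, x ∈ N ↔ τ (Pos.starMul x) < ∞) ∧ Dense (N : Set A) ∧
      ∀ x ∈ N, ∀ a : A, a * x ∈ N ∧ x * a ∈ N := by
  let N : Submodule ℂ A :=
    { carrier := {x | τ (Pos.starMul x) < ∞}
      zero_mem' := by
        have : Pos.starMul (0 : A) = 0 := Subtype.ext (by simp [Pos.starMul])
        simp [this, hτ.zero]
      add_mem' := by
        intro x y hx hy
        have h : τ (Pos.starMul (x + y)) ≤
            τ ((Pos.starMul x + Pos.starMul x) + (Pos.starMul y + Pos.starMul y)) := by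
          refine hτ.mono ?_
          change star (x + y) * (x + y) ≤
            (star x * x + star x * x) + (star y * y + star y * y)
          have h0 := star_mul_self_nonneg (x - y)
          rw [← sub_nonneg]
          convert h0 using 1
          simp only [star_add, star_sub]
          noncomm_ring
        refine h.trans_lt ?_
        simp only [hτ.add]
        exact ENNReal.add_lt_top.2
          ⟨ENNReal.add_lt_top.2 ⟨hx, hx⟩, ENNReal.add_lt_top.2 ⟨hy, hy⟩⟩
      smul_mem' := by
        intro c x hx
        have h : Pos.starMul (c • x) = (Pos.starMul x).scale (‖c‖₊ ^ 2) := by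
          refine Subtype.ext ?_
          simp only [Pos.starMul, Pos.scale, star_smul, smul_mul_assoc, mul_smul_comm, smul_smul]
          rw [← Complex.coe_smul]
          congr 1
          simp [Complex.mul_conj']
        change τ (Pos.starMul (c • x)) < ∞
        rw [h, hτ.scale]
        exact ENNReal.mul_lt_top ENNReal.coe_lt_top hx }
  have hN : ∀ x, x ∈ N ↔ τ (Pos.starMul x) < ∞ := fun x => Iff.rfl
  have hstar : ∀ x ∈ N, star x ∈ N := fun x hx => by
    rw [hN] at hx ⊢
    rwa [← hτ.tracial]
  have hleft : ∀ x ∈ N, ∀ a : A, a * x ∈ N := fun x hx a => by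
    rw [hN] at hx ⊢
    refine (hτ.conj_le (Pos.starMul a) x _ ?_).trans_lt
      (ENNReal.mul_lt_top ENNReal.coe_lt_top hx)
    simp [Pos.starMul, mul_assoc]
  refine ⟨N, hN, ?_, fun x hx a => ⟨hleft x hx a, ?_⟩⟩
  · have hcl : N.topologicalClosure = ⊤ := by
      rw [eq_top_iff, ← CStarAlgebra.span_nonneg, Submodule.span_le]
      intro a ha
      have h1 : (⟨a, ha⟩ : Pos A) ∈ closure {a : Pos A | τ a < ∞} := dτ _
      have h2 := image_closure_subset_closure_image continuous_subtype_val
        (Set.mem_image_of_mem Subtype.val h1)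
      refine closure_mono ?_ h2
      rintro _ ⟨y, hy, rfl⟩
      exact hτ.sq_lt_top hy
    exact Submodule.dense_iff_topologicalClosure_eq_top.2 hcl
  · simpa using hstar _ (hleft _ (hstar x hx) (star a))

/-- Densely finite traces are finite on the positive part of the Pedersen ideal. -/
theorem IsTrace.lt_top_of_mem_pedersenIdeal {τ : Pos A → ℝ≥0∞} (hτ : IsTrace τ)
    (dτ : DenselyFinite τ) (x : PedPos A) : τ x.1 < ∞ := by
  obtain ⟨N, hN, hd, hi⟩ := exists_sqIdeal hτ dτ
  have hstar : ∀ x ∈ N, star x ∈ N := fun x hx => by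
    rw [hN] at hx ⊢
    rwa [← hτ.tracial]
  let J : Submodule ℂ A := Submodule.span ℂ {z | ∃ x ∈ N, ∃ y ∈ N, z = x * y}
  have hJd : Dense (J : Set A) := by
    have hcl : J.topologicalClosure = ⊤ := by
      rw [eq_top_iff, ← CStarAlgebra.span_nonneg, Submodule.span_le]
      intro a ha
      have h1 : (CFC.sqrt a, CFC.sqrt a) ∈ closure ((N : Set A) ×ˢ (N : Set A)) :=
        (hd.prod hd) _
      have h2 := image_closure_subset_closure_image
        (continuous_mul (M := A)) (Set.mem_image_of_mem _ h1)
      have h3 : CFC.sqrt a * CFC.sqrt a = a := CFC.sqrt_mul_sqrt_self a ha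
      simp only [h3] at h2
      refine closure_mono ?_ h2
      rintro _ ⟨p, hp, rfl⟩
      exact Submodule.subset_span ⟨p.1, hp.1, p.2, hp.2, rfl⟩
    exact Submodule.dense_iff_topologicalClosure_eq_top.2 hcl
  have hJi : ∀ x ∈ J, ∀ a : A, a * x ∈ J ∧ x * a ∈ J := by
    intro x hx a
    induction hx using Submodule.span_induction with
    | mem x h =>
      obtain ⟨u, hu, v, hv, rfl⟩ := h
      exact ⟨Submodule.subset_span ⟨a * u, (hi u hu a).1, v, hv, (mul_assoc _ _ _).symm⟩,
        Submodule.subset_span ⟨u, hu, v * a, (hi v hv a).2, mul_assoc _ _ _⟩⟩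
    | zero => simp
    | add x y _ _ h1 h2 =>
      rw [mul_add, add_mul]
      exact ⟨J.add_mem h1.1 h2.1, J.add_mem h1.2 h2.2⟩
    | smul c x _ h =>
      rw [mul_smul_comm, smul_mul_assoc]
      exact ⟨J.smul_mem c h.1, J.smul_mem c h.2⟩
  have hxJ : (x.1 : A) ∈ J := (Submodule.mem_sInf.1 x.2) J ⟨hJd, hJi⟩
  have key : ∀ z ∈ J, ∀ c : ℂ, ∃ p : Pos A, τ p < ∞ ∧ c • z + star (c • z) ≤ p := by
    intro z hz
    induction hz using Submodule.span_induction with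
    | mem z h =>
      obtain ⟨u, hu, v, hv, rfl⟩ := h
      intro c
      replace hu : c • u ∈ N := N.smul_mem c hu
      rw [← smul_mul_assoc]
      generalize c • u = u at hu
      refine ⟨Pos.starMul (star u) + Pos.starMul v, ?_, ?_⟩
      · rw [hτ.add]
        exact ENNReal.add_lt_top.2 ⟨(hN _).1 (hstar u hu), (hN _).1 hv⟩
      · change u * v + star (u * v) ≤ star (star u) * star u + star v * v
        have h0 := star_mul_self_nonneg (star u - v)
        rw [← sub_nonneg]
        convert h0 using 1
        simp only [star_mul, star_sub, star_star]
        noncomm_ring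
    | zero => exact fun c => ⟨0, by simp [hτ.zero], by simp⟩
    | add x y _ _ h1 h2 =>
      intro c
      obtain ⟨p, hp, hp'⟩ := h1 c
      obtain ⟨q, hq, hq'⟩ := h2 c
      refine ⟨p + q, by rw [hτ.add]; exact ENNReal.add_lt_top.2 ⟨hp, hq⟩, ?_⟩
      calc c • (x + y) + star (c • (x + y))
          = (c • x + star (c • x)) + (c • y + star (c • y)) := by
            rw [smul_add, star_add]; abel
        _ ≤ p + q := add_le_add hp' hq'
    | smul d x _ h =>
      intro c
      rw [smul_smul]
      exact h (c * d)
  obtain ⟨p, hp, hxp⟩ := key _ hxJ 1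
  rw [one_smul] at hxp
  refine (hτ.mono ?_).trans_lt hp
  have hs : star (x.1 : A) = x.1 := (IsSelfAdjoint.of_nonneg x.1.2).star_eq
  rw [hs] at hxp
  exact (le_add_of_nonneg_left x.1.2).trans hxp

namespace LTC

theorem lt_top (τ : LTC A) (x : PedPos A) : τ x.1 < ∞ :=
  τ.2.1.lt_top_of_mem_pedersenIdeal τ.2.2.2 x

variable (A)

/-- The restriction of a trace in `LTC(A)` to the positive part of the Pedersen ideal, where it is
finite. -/
def restrict : LTC A →ₗ[ℝ≥0] (PedPos A → ℝ≥0) where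
  toFun τ x := (τ x.1).toNNReal
  map_add' τ σ := by
    funext x
    exact ENNReal.toNNReal_add (τ.lt_top x).ne (σ.lt_top x).ne
  map_smul' c τ := by
    funext x
    exact ENNReal.toNNReal_mul.trans rfl

variable {A}

theorem coe_restrict (τ : LTC A) (x : PedPos A) : (restrict A τ x : ℝ≥0∞) = τ x.1 :=
  ENNReal.coe_toNNReal (τ.lt_top x).ne

/-- The weak topology `σ(LTC(A), K(A))`: the topology of pointwise convergence on the positive
part of the Pedersen ideal. -/
instance : TopologicalSpace (LTC A) := TopologicalSpace.induced (restrict A) inferInstance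

end LTC

end Traces

section Tensor

variable (A₁ A₂ : Type*)
  [NonUnitalCStarAlgebra A₁] [PartialOrder A₁] [StarOrderedRing A₁]
  [NonUnitalCStarAlgebra A₂] [PartialOrder A₂] [StarOrderedRing A₂]

/-- A C*-norm on the algebraic tensor product of two C*-algebras. -/
structure CStarNorm where
  toFun : A₁ ⊗[ℂ] A₂ → ℝ
  add_le : ∀ s t, toFun (s + t) ≤ toFun s + toFun t
  smul : ∀ (c : ℂ) (t), toFun (c • t) = ‖c‖ * toFun t
  eq_zero : ∀ t, toFun t = 0 → t = 0
  mul_le : ∀ s t, toFun (s * t) ≤ toFun s * toFun t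
  star_mul_self : ∀ t, toFun (star t * t) = toFun t ^ 2

variable {A₁ A₂}
variable {C : Type*} [NonUnitalCStarAlgebra C] [PartialOrder C] [StarOrderedRing C]

/-- The C*-algebra `C`, with the *-homomorphism `ι`, is the completion `A₁ ⊗_β A₂` of the
algebraic tensor product in the C*-norm `β`. -/
structure IsTensorCompletion (β : CStarNorm A₁ A₂) (ι : A₁ ⊗[ℂ] A₂ →⋆ₙₐ[ℂ] C) : Prop where
  norm_map : ∀ t, ‖ι t‖ = β.toFun t
  denseRange : DenseRange ι

/-- The elementary tensor `a ⊗ b` of positive elements, as a positive element of `C`. -/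
def Pos.tmul (ι : A₁ ⊗[ℂ] A₂ →⋆ₙₐ[ℂ] C) (a : Pos A₁) (b : Pos A₂) : Pos C :=
  ⟨ι ((a : A₁) ⊗ₜ[ℂ] (b : A₂)), by
    have h1 := CFC.sqrt_mul_sqrt_self (a : A₁) a.2
    have h2 := CFC.sqrt_mul_sqrt_self (b : A₂) b.2
    have s1 : star (CFC.sqrt (a : A₁)) = CFC.sqrt (a : A₁) :=
      (IsSelfAdjoint.of_nonneg (CFC.sqrt_nonneg _)).star_eq
    have s2 : star (CFC.sqrt (b : A₂)) = CFC.sqrt (b : A₂) :=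
      (IsSelfAdjoint.of_nonneg (CFC.sqrt_nonneg _)).star_eq
    have h : ι ((a : A₁) ⊗ₜ[ℂ] (b : A₂)) =
        star (ι (CFC.sqrt (a : A₁) ⊗ₜ[ℂ] CFC.sqrt (b : A₂))) *
          ι (CFC.sqrt (a : A₁) ⊗ₜ[ℂ] CFC.sqrt (b : A₂)) := by
      rw [← map_star, ← map_mul, TensorProduct.star_tmul,
        Algebra.TensorProduct.tmul_mul_tmul, s1, s2, h1, h2]
    rw [h]
    exact star_mul_self_nonneg _⟩

variable (A₁ A₂) in
/-- The algebraic tensor product `LTC(A₁) ⊙ LTC(A₂)`: the cone of finite sums of elementary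
tensors `τ₁ ⊗ τ₂`. Its elements are viewed as positive functionals on the algebraic tensor product
of the Pedersen ideals, and are recorded through their values at the elementary tensors `a ⊗ b` with
`a ∈ K(A₁)₊` and `b ∈ K(A₂)₊`. -/
def algTensor : Submodule ℝ≥0 (PedPos A₁ × PedPos A₂ → ℝ≥0∞) :=
  Submodule.span ℝ≥0 {f | ∃ (τ₁ : LTC A₁) (τ₂ : LTC A₂), ∀ a b, f (a, b) = τ₁ a.1 * τ₂ b.1}

/-- The values of a trace on `C` at the elementary tensors `a ⊗ b` with `a ∈ K(A₁)₊` and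
`b ∈ K(A₂)₊`. -/
def tensorValues (ι : A₁ ⊗[ℂ] A₂ →⋆ₙₐ[ℂ] C) :
    LTC C →ₗ[ℝ≥0] (PedPos A₁ × PedPos A₂ → ℝ≥0∞) where
  toFun τ p := τ (Pos.tmul ι p.1.1 p.2.1)
  map_add' _ _ := rfl
  map_smul' _ _ := rfl

/-- The tensor product of cones `LTC(A₁) ⊗_β LTC(A₂)`: the functionals on `K(C)₊`, where
`C = A₁ ⊗_β A₂`, in the closure of `LTC(A₁) ⊙ LTC(A₂)` for the topology of pointwise convergence on
`K(C)₊`. An element of `LTC(A₁) ⊙ LTC(A₂)` is here a functional on `K(C)₊` through its extension to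
a trace on `C`. -/
def tensorCone (ι : A₁ ⊗[ℂ] A₂ →⋆ₙₐ[ℂ] C) : Submodule ℝ≥0 (PedPos C → ℝ≥0) :=
  (((algTensor A₁ A₂).comap (tensorValues ι)).map (LTC.restrict C)).topologicalClosure

end Tensor

end TracialCone

end

noncomputable section

set_option linter.unusedSectionVars false

namespace TracialCone

open Filter Topology

/-! ### The Pedersen ideal: generators and an approximate unit -/

section Pedersen

variable {A : Type*} [NonUnitalCStarAlgebra A]

/-! Restriction and closedness. A trace in `LTC(A)` is recovered from its values on `K(A)₊`
(`LTC.apply_eq_iSup`), and the functions on `K(A)₊` that arise in this way are exactly those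
satisfying the identities collected in `Reg` (`LTC.reg_restrict`, `Reg.exists_ltc`). These
identities survive pointwise limits, so the restrictions form a closed set and every element of the
closed tensor cone comes from a trace on `C`. Both topologies are pointwise convergence on `K(C)₊`,
so there remain existence and uniqueness of product traces and density of their sums.

Products. For `e` in the unit ball of `K(A)₊`, the cut `x ↦ τ (√e x √e)` is a bounded positive
functional. A product of two positive functionals is bounded in every C*-norm
(`exists_prod_posFun`): Hahn-Banach gives this when the first factor is pure, and Krein-Milman
removes purity. Products of cuts increase with the cuts, and their supremum is the product trace
(`exists_prod_ltc`). For uniqueness, `K(C)` lies in the ideal generated by the tensors `a ⊗ b` with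
`a ∈ K(A₁)₊` and `b ∈ K(A₂)₊`; hence convergence at these tensors forces convergence on `K(C)₊`
(`IsTensorCompletion.tendsto_restrict`), and values there determine the trace.

Density. A trace `τ` on `C` is regarded as the map `Φ : a ↦ τ (a ⊗ ·)` from `K(A₁)₊` to `LTC(A₂)`.
The cone `LTC(A₂)` is a lattice, by a Riesz decomposition for traces
(`traceInf_add_le_of_mul_star`), and carries band projections. For finitely many `a` below some
`a'`, cutting by finitely many bands makes every `Q k (Φ a)` nearly proportional to `u k = Q k (Φ
a')` (`LTC.exists_partition`). So `Q k ∘ Φ` is nearly a product `lam k ⊗ u k`, and the sum of these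
products approximates `τ` (`exists_algTensor_approx`). -/

theorem mul_mem_pedersenIdeal {x : A} (hx : x ∈ pedersenIdeal A) (a : A) :
    a * x ∈ pedersenIdeal A :=
  Submodule.mem_sInf.2 fun I hI => (hI.2 x (Submodule.mem_sInf.1 hx I hI) a).1

theorem mem_pedersenIdeal_mul {x : A} (hx : x ∈ pedersenIdeal A) (a : A) :
    x * a ∈ pedersenIdeal A :=
  Submodule.mem_sInf.2 fun I hI => (hI.2 x (Submodule.mem_sInf.1 hx I hI) a).2

/-- An element with a left unit belongs to every dense two-sided ideal. -/
theorem mem_of_dense_of_mul_eq {I : Submodule ℂ A} (hI : Dense (I : Set A))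
    (hI' : ∀ x ∈ I, ∀ a : A, a * x ∈ I ∧ x * a ∈ I) {a y : A} (h : a * y = y) : y ∈ I := by
  obtain ⟨i, hi, hai⟩ := Metric.mem_closure_iff.1 (hI a) 1 one_pos
  rw [dist_eq_norm] at hai
  -- With `i ∈ I` and `‖a - i‖ < 1`, the element `1 - (a - i)` is invertible in the unitization and
  -- sends `y` to `i y`, because `a y = y`. Inverting it keeps `i y` inside `I`.
  let u : (Unitization ℂ A)ˣ := Units.oneSub ((a - i : A) : Unitization ℂ A)
    (by rwa [Unitization.norm_inr])
  have h1 : (u : Unitization ℂ A) * (y : Unitization ℂ A) = ((i * y : A) : Unitization ℂ A) := by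
    simp only [u, Units.val_oneSub, sub_mul, one_mul, ← Unitization.inr_mul, h,
      ← Unitization.inr_sub]
    simp
  have h2 : (y : Unitization ℂ A) = (↑u⁻¹ : Unitization ℂ A) * ((i * y : A) : Unitization ℂ A) := by
    rw [← h1, Units.inv_mul_cancel_left]
  have h3 : y = (↑u⁻¹ : Unitization ℂ A).fst • (i * y) + (↑u⁻¹ : Unitization ℂ A).snd * (i * y) := by
    have := congrArg (fun z : Unitization ℂ A => z.snd) h2
    simpa [Unitization.snd_mul] using this
  rw [h3]
  have hiy := (hI' i hi y).2
  exact I.add_mem (I.smul_mem _ hiy) (hI' _ hiy _).1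

theorem mem_pedersenIdeal_of_mul_eq {a y : A} (h : a * y = y) : y ∈ pedersenIdeal A :=
  Submodule.mem_sInf.2 fun _ hI => mem_of_dense_of_mul_eq hI.1 hI.2 h

variable [PartialOrder A] [StarOrderedRing A]

theorem Pos.star_eq (a : Pos A) : star (a : A) = a := (IsSelfAdjoint.of_nonneg a.2).star_eq

/-- The square root of a positive element. -/
def Pos.sqrt (a : Pos A) : Pos A := ⟨CFC.sqrt (a : A), CFC.sqrt_nonneg _⟩

theorem Pos.sqrt_mul_sqrt (a : Pos A) : (a.sqrt : A) * a.sqrt = a :=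
  CFC.sqrt_mul_sqrt_self (a : A) a.2

/-- The positive element `w* a w`. -/
def Pos.conj (a : Pos A) (w : A) : Pos A := ⟨star w * a * w, star_left_conjugate_nonneg a.2 w⟩

theorem Pos.coe_conj (a : Pos A) (w : A) : (a.conj w : A) = star w * a * w := rfl

theorem Pos.coe_scale (t : ℝ≥0) (a : Pos A) : (a.scale t : A) = (t : ℝ) • (a : A) := rfl

theorem Pos.coe_starMul (w : A) : (Pos.starMul w : A) = star w * w := rfl

/-- The element `(a - ε)₊`. -/
def Pos.cut (ε : ℝ) (a : Pos A) : Pos A :=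
  ⟨cfcₙ (fun t : ℝ => max (t - ε) 0) (a : A), cfcₙ_nonneg fun _ _ => le_max_right _ _⟩

theorem Pos.norm_cut_sub_le {ε : ℝ} (hε : 0 ≤ ε) (a : Pos A) : ‖(a.cut ε : A) - a‖ ≤ ε := by
  have h : (a.cut ε : A) - a = cfcₙ (fun t : ℝ => max (t - ε) 0 - t) (a : A) := by
    rw [cfcₙ_sub _ _ _ (by fun_prop) (by simpa using hε) (by fun_prop) rfl,
      cfcₙ_id' ℝ (a : A) (IsSelfAdjoint.of_nonneg a.2)]
    rfl
  rw [h]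
  refine norm_cfcₙ_le fun t ht => ?_
  have := quasispectrum_nonneg_of_nonneg (a : A) a.2 t ht
  rw [Real.norm_eq_abs, abs_le]
  constructor
  · linarith [le_max_left (t - ε) 0]
  · rcases max_cases (t - ε) 0 with h | h <;> linarith

/-- The function `min (t / ε) 1` equals one wherever `(t - ε)₊` does not vanish. This is what puts
the cuts into the Pedersen ideal. -/
theorem Pos.exists_mul_cut {ε : ℝ} (hε : 0 < ε) (a : Pos A) :
    ∃ u : A, u * (a.cut ε : A) = a.cut ε := by
  refine ⟨cfcₙ (fun t : ℝ => min (t / ε) 1) (a : A), ?_⟩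
  rw [Pos.cut, ← cfcₙ_mul _ _ _ (by fun_prop) (by simp) (by fun_prop) (by simpa using hε.le)]
  refine cfcₙ_congr fun t ht => ?_
  rcases le_or_gt t ε with h | h
  · simp [max_eq_right (sub_nonpos.2 h)]
  · have : min (t / ε) 1 = 1 := min_eq_right ((one_le_div hε).2 h.le)
    simp [this]

theorem Pos.norm_cut_le {ε : ℝ} (hε : 0 ≤ ε) (a : Pos A) : ‖(a.cut ε : A)‖ ≤ ‖(a : A)‖ := by
  refine norm_cfcₙ_le fun t ht => ?_
  have h0 := quasispectrum_nonneg_of_nonneg (a : A) a.2 t ht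
  have h1 : ‖t‖ ≤ ‖(a : A)‖ := by
    have := norm_apply_le_norm_cfcₙ (𝕜 := ℝ) (fun t => t) (a : A) ht (by fun_prop) rfl
      (IsSelfAdjoint.of_nonneg a.2)
    rwa [cfcₙ_id' ℝ (a : A) (IsSelfAdjoint.of_nonneg a.2)] at this
  rw [Real.norm_eq_abs, abs_of_nonneg h0] at h1
  rw [Real.norm_eq_abs, abs_of_nonneg (le_max_right _ _)]
  exact max_le (by linarith) (norm_nonneg _)

theorem Pos.cut_mem {ε : ℝ} (hε : 0 < ε) (a : Pos A) : (a.cut ε : A) ∈ pedersenIdeal A := by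
  obtain ⟨u, hu⟩ := a.exists_mul_cut hε
  exact mem_pedersenIdeal_of_mul_eq hu

variable (A) in
theorem dense_pedPos : Dense {a : Pos A | (a : A) ∈ pedersenIdeal A} := by
  intro a
  rw [Metric.mem_closure_iff]
  intro ε hε
  refine ⟨a.cut (ε / 2), a.cut_mem (by positivity), ?_⟩
  rw [Subtype.dist_eq, dist_comm, dist_eq_norm]
  exact (a.norm_cut_sub_le (by positivity)).trans_lt (by linarith)

/-- A closed subspace that contains the Pedersen-type positive elements is everything. -/
theorem eq_top_of_forall_pos {S : Submodule ℂ A} (hS : IsClosed (S : Set A))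
    (h : ∀ a : Pos A, (∃ u : A, u * (a : A) = a) → (a : A) ∈ S) : S = ⊤ := by
  rw [eq_top_iff, ← CStarAlgebra.span_nonneg, Submodule.span_le]
  intro a ha
  refine hS.closure_subset ?_
  rw [Metric.mem_closure_iff]
  intro ε hε
  refine ⟨Pos.cut (ε / 2) ⟨a, ha⟩, h _ (Pos.exists_mul_cut (by positivity) _), ?_⟩
  rw [dist_comm, dist_eq_norm]
  exact (Pos.norm_cut_sub_le (by positivity) ⟨a, ha⟩).trans_lt (by linarith)

/-- The linear span of the products `x f z` with `f` in a given set of positive elements. -/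
def idealSpan (S : Set (Pos A)) : Submodule ℂ A :=
  Submodule.span ℂ {y | ∃ (x : A) (f : Pos A) (z : A), f ∈ S ∧ y = x * f * z}

theorem mul_mem_idealSpan {S : Set (Pos A)} {y : A} (hy : y ∈ idealSpan S) (a : A) :
    a * y ∈ idealSpan S ∧ y * a ∈ idealSpan S := by
  induction hy using Submodule.span_induction with
  | mem y h =>
    obtain ⟨x, f, z, hf, rfl⟩ := h
    exact ⟨Submodule.subset_span ⟨a * x, f, z, hf, by simp only [mul_assoc]⟩,
      Submodule.subset_span ⟨x, f, z * a, hf, by simp only [mul_assoc]⟩⟩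
  | zero => simp
  | add x y _ _ h1 h2 =>
    rw [mul_add, add_mul]
    exact ⟨Submodule.add_mem _ h1.1 h2.1, Submodule.add_mem _ h1.2 h2.2⟩
  | smul c x _ h =>
    rw [mul_smul_comm, smul_mul_assoc]
    exact ⟨Submodule.smul_mem _ c h.1, Submodule.smul_mem _ c h.2⟩

/-- Along an approximate unit, `e f e → f`, and each `e f e` is one of the spanning products. -/
theorem mem_closure_idealSpan {S : Set (Pos A)} {f : Pos A} (hf : f ∈ S) :
    (f : A) ∈ (idealSpan S).topologicalClosure := by
  have hl := CStarAlgebra.increasingApproximateUnit A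
  have h1 : Tendsto (fun e : A => e * (f : A) * e) (CStarAlgebra.approximateUnit A) (𝓝 (f : A)) := by
    have h2 := hl.tendsto_mul_left (f : A)
    have h3 := hl.tendsto_mul_right (f : A)
    have h4 : Tendsto (fun e : A => e * ((f : A) * e - f) + e * f)
        (CStarAlgebra.approximateUnit A) (𝓝 (0 + f)) := by
      refine Tendsto.add ?_ h3
      refine squeeze_zero_norm' (a := fun e => ‖(f : A) * e - f‖) ?_ ?_
      · filter_upwards [hl.eventually_norm] with e he
        calc ‖e * ((f : A) * e - f)‖ ≤ ‖e‖ * ‖(f : A) * e - f‖ := norm_mul_le _ _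
          _ ≤ 1 * ‖(f : A) * e - f‖ := by gcongr
          _ = _ := one_mul _
      · have := (h2.sub_const (f : A)).norm
        simpa using this
    rw [zero_add] at h4
    refine h4.congr fun e => ?_
    rw [mul_sub]; simp [mul_assoc]
  exact mem_closure_of_tendsto h1
    (Eventually.of_forall fun _ => Submodule.subset_span ⟨_, f, _, hf, rfl⟩)

variable (A) in
/-- The positive elements with a unit. -/
def unitSet : Set (Pos A) := {f | ∃ u : A, u * (f : A) = f}

theorem unitSet_subset {f : Pos A} (hf : f ∈ unitSet A) : (f : A) ∈ pedersenIdeal A :=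
  mem_pedersenIdeal_of_mul_eq hf.choose_spec

theorem pedersenIdeal_le_idealSpan {S : Set (Pos A)}
    (hS : (idealSpan S).topologicalClosure = ⊤) : pedersenIdeal A ≤ idealSpan S :=
  sInf_le ⟨Submodule.dense_iff_topologicalClosure_eq_top.2 hS,
    fun _ hx a => mul_mem_idealSpan hx a⟩

variable (A) in
theorem pedersenIdeal_le_idealSpan_unitSet : pedersenIdeal A ≤ idealSpan (unitSet A) :=
  pedersenIdeal_le_idealSpan (eq_top_of_forall_pos (Submodule.isClosed_topologicalClosure _)
    fun _ ha => mem_closure_idealSpan (S := unitSet A) ha)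

/-- The cone of the finite sums of elements `w* f w` with `f` in a given set. -/
def conjCone (S : Set (Pos A)) : AddSubmonoid (Pos A) :=
  AddSubmonoid.closure {y | ∃ f ∈ S, ∃ w : A, y = f.conj w}

theorem scale_mem_conjCone {S : Set (Pos A)} (t : ℝ≥0) {y : Pos A} (hy : y ∈ conjCone S) :
    y.scale t ∈ conjCone S := by
  induction hy using AddSubmonoid.closure_induction with
  | mem y h =>
    obtain ⟨f, hf, w, rfl⟩ := h
    refine AddSubmonoid.subset_closure ⟨f, hf, (NNReal.sqrt t : ℝ) • w, Subtype.ext ?_⟩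
    simp only [Pos.coe_scale, Pos.coe_conj, star_smul, smul_mul_assoc, mul_smul_comm, smul_smul]
    rw [star_trivial (NNReal.sqrt t : ℝ), ← NNReal.coe_mul, NNReal.mul_self_sqrt]
  | zero =>
    convert (conjCone S).zero_mem
    exact Subtype.ext (by simp [Pos.coe_scale])
  | add x y _ _ h1 h2 =>
    convert (conjCone S).add_mem h1 h2
    exact Subtype.ext (by simp [Pos.coe_scale])

/-- A positive element of `idealSpan S` is a difference of elements of `conjCone S`. -/
theorem exists_add_eq_of_mem_idealSpan {S : Set (Pos A)} {k : Pos A}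
    (hk : (k : A) ∈ idealSpan S) : ∃ n ∈ conjCone S, ∃ p ∈ conjCone S, k + n = p := by
  -- Polarization: for `y = x f z`, the sum `y + y*` is `(x* + z)* f (x* + z)` minus `x f x* + z* f
  -- z`. The scalar `c` lets the induction pass through complex multiples.
  have key : ∀ y ∈ idealSpan S, ∀ c : ℂ, ∃ n ∈ conjCone S, ∃ p ∈ conjCone S,
      c • y + star (c • y) + (n : A) = p := by
    intro y hy
    induction hy using Submodule.span_induction with
    | mem y h =>
      obtain ⟨x, f, z, hf, rfl⟩ := h
      intro c
      refine ⟨(f.conj (star (c • x)) + f.conj z), (conjCone S).add_mem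
        (AddSubmonoid.subset_closure ⟨f, hf, _, rfl⟩) (AddSubmonoid.subset_closure ⟨f, hf, _, rfl⟩),
        f.conj (star (c • x) + z), AddSubmonoid.subset_closure ⟨f, hf, _, rfl⟩, ?_⟩
      rw [← smul_mul_assoc, ← smul_mul_assoc]
      generalize c • x = x
      simp only [Nonneg.coe_add, Pos.coe_conj, star_star, star_mul, star_add, f.star_eq]
      noncomm_ring
    | zero => exact fun c => ⟨0, zero_mem _, 0, zero_mem _, by simp⟩
    | add x y _ _ h1 h2 =>
      intro c
      obtain ⟨n, hn, p, hp, h⟩ := h1 c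
      obtain ⟨n', hn', p', hp', h'⟩ := h2 c
      refine ⟨n + n', add_mem hn hn', p + p', add_mem hp hp', ?_⟩
      simp only [Nonneg.coe_add, ← h, ← h', smul_add, star_add]
      abel
    | smul d x _ h =>
      intro c
      rw [smul_smul]
      exact h (c * d)
  obtain ⟨n, hn, p, hp, h⟩ := key _ hk 1
  refine ⟨n.scale 2⁻¹, scale_mem_conjCone _ hn, p.scale 2⁻¹, scale_mem_conjCone _ hp,
    Subtype.ext ?_⟩
  rw [one_smul, k.star_eq] at h
  simp only [Nonneg.coe_add, Pos.coe_scale, ← h, smul_add]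
  congr 1
  rw [← add_smul]
  norm_num

variable (A) in
/-- The positive elements of the Pedersen ideal of norm less than one. -/
abbrev PedBall : Type _ := {e : Pos A // (e : A) ∈ pedersenIdeal A ∧ ‖(e : A)‖ < 1}

instance : Nonempty (PedBall A) := ⟨⟨0, by simp⟩⟩

/-- The usual upper bound is `f (g a + g b)` with `g t = t / (1 - t)` and its inverse `f t = t / (1
+ t)`, the latter being operator monotone. It stays in the Pedersen ideal because `f x = x - x f x`
and `g x = x + x g x`. -/
instance : IsDirected (PedBall A) (· ≤ ·) := by
  refine ⟨?_⟩
  rintro ⟨⟨a, ha⟩, hak, han⟩ ⟨⟨b, hb⟩, hbk, hbn⟩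
  let f : ℝ≥0 → ℝ≥0 := fun x => 1 - (1 + x)⁻¹
  let g : ℝ≥0 → ℝ≥0 := fun x => x * (1 - x)⁻¹
  have hfc (x : A) : ContinuousOn f (quasispectrum ℝ≥0 x) := by
    fun_prop (disch := intro _ _; positivity)
  have hg1 (x : A) (hx : ‖x‖ < 1) (t) (ht : t ∈ quasispectrum ℝ≥0 x) : t < 1 :=
    lt_of_le_of_lt (CStarAlgebra.le_nnnorm_of_mem_quasispectrum ht) hx
  have hgc (x : A) (hx : ‖x‖ < 1) : ContinuousOn g (quasispectrum ℝ≥0 x) := by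
    have (t) (ht : t ∈ quasispectrum ℝ≥0 x) : 1 - t ≠ 0 := (tsub_pos_of_lt (hg1 x hx t ht)).ne'
    fun_prop
  have hfk (x : A) (h0 : 0 ≤ x) (hx : x ∈ pedersenIdeal A) : cfcₙ f x ∈ pedersenIdeal A := by
    have h : cfcₙ f x + x * cfcₙ f x = x := by
      nth_rewrite 2 [← cfcₙ_id' ℝ≥0 x]
      rw [← cfcₙ_mul _ _ x (by fun_prop) rfl (hfc x) (by simp [f]),
        ← cfcₙ_add _ _ x (hfc x) (by simp [f]) (by fun_prop) (by simp)]
      conv_rhs => rw [← cfcₙ_id' ℝ≥0 x]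
      refine cfcₙ_congr fun t _ => ?_
      have : 1 - (1 + t)⁻¹ = t * (1 + t)⁻¹ := by
        rw [eq_comm, ← mul_right_inj' (show (1 + t) ≠ 0 by positivity), mul_tsub, mul_left_comm,
          mul_inv_cancel₀ (by positivity)]
        simp
      simp only [f, this]
      field_simp
    have h' : cfcₙ f x = x - x * cfcₙ f x := eq_sub_of_add_eq h
    rw [h']
    exact Submodule.sub_mem _ hx (mem_pedersenIdeal_mul hx _)
  have hgk (x : A) (h0 : 0 ≤ x) (h1 : ‖x‖ < 1) (hx : x ∈ pedersenIdeal A) :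
      cfcₙ g x ∈ pedersenIdeal A := by
    have h : cfcₙ g x = x + x * cfcₙ g x := by
      nth_rewrite 2 3 [← cfcₙ_id' ℝ≥0 x]
      rw [← cfcₙ_mul _ _ x (by fun_prop) rfl (hgc x h1) (by simp [g]),
        ← cfcₙ_add _ _ x (by fun_prop) rfl (by have := hgc x h1; fun_prop) (by simp)]
      refine cfcₙ_congr fun t ht => ?_
      have h2 : 0 < 1 - t := tsub_pos_of_lt (hg1 x h1 t ht)
      have h3 : t + (1 - t) = 1 := add_tsub_cancel_of_le (hg1 x h1 t ht).le
      simp only [g]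
      generalize 1 - t = s at *
      field_simp
      rw [add_comm s t, h3, mul_one]
    rw [h]
    exact Submodule.add_mem _ hx (mem_pedersenIdeal_mul hx _)
  have key (a b : A) (ha : 0 ≤ a) (ha' : ‖a‖ < 1) : a ≤ cfcₙ f (cfcₙ g a + cfcₙ g b) := by
    calc
      a = cfcₙ (f ∘ g) a := by
        conv_lhs => rw [← cfcₙ_id ℝ≥0 a]
        exact cfcₙ_congr (Set.InvOn.one_sub_one_add_inv.1.eqOn.symm.mono (hg1 a ha'))
      _ = cfcₙ f (cfcₙ g a) := by
        rw [cfcₙ_comp f g a ?_ (by simp [f]) (hgc a ha') (by simp [g]) ha]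
        fun_prop (disch := intro _ _; positivity)
      _ ≤ cfcₙ f (cfcₙ g a + cfcₙ g b) := by
        have hab' : cfcₙ g a ≤ cfcₙ g a + cfcₙ g b := le_add_of_nonneg_right cfcₙ_nonneg_of_predicate
        exact CFC.monotoneOn_one_sub_one_add_inv cfcₙ_nonneg_of_predicate
          (cfcₙ_nonneg_of_predicate.trans hab') hab'
  refine ⟨⟨⟨cfcₙ f (cfcₙ g a + cfcₙ g b), by simp⟩, ?_,
    norm_cfcₙ_one_sub_one_add_inv_lt_one _⟩, key a b ha han, ?_⟩
  · exact hfk _ (add_nonneg cfcₙ_nonneg_of_predicate cfcₙ_nonneg_of_predicate)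
      (Submodule.add_mem _ (hgk a ha han hak) (hgk b hb hbn hbk))
  · change b ≤ cfcₙ f (cfcₙ g a + cfcₙ g b)
    rw [add_comm]
    exact key b a hb hbn

/-- The positive part of the unit ball of the Pedersen ideal is an increasing approximate unit. -/
theorem tendsto_pedBall_mul (x : A) :
    Tendsto (fun e : PedBall A => ((e.1 : Pos A) : A) * x) atTop (𝓝 x) := by
  rw [Metric.tendsto_nhds]
  intro ε hε
  have hl := CStarAlgebra.increasingApproximateUnit A
  obtain ⟨δ, hδ, hδε⟩ : ∃ δ > 0, δ < ε := exists_between hε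
  -- A contraction `e₀` that nearly fixes `x` is replaced by its cut `e₁`, which lies in `K(A)`. The
  -- two constants make the errors add up to `δ² / (‖x‖ + 1)`, so that `‖x* (1 - e₁) x‖ ≤ δ²`; this
  -- bounds `‖x - e x‖` by `δ` for every `e ≥ e₁`.
  have hη : 0 < δ ^ 2 / (2 * (‖x‖ + 1) ^ 2) := by positivity
  have hη' : 0 < δ ^ 2 / (2 * (‖x‖ + 1)) := by positivity
  obtain ⟨e₀, he₀, he₀', hx₀⟩ : ∃ e₀ : A, 0 ≤ e₀ ∧ ‖e₀‖ < 1 ∧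
      ‖x - e₀ * x‖ < δ ^ 2 / (2 * (‖x‖ + 1)) := by
    have h1 := (hl.tendsto_mul_right x).eventually (Metric.ball_mem_nhds x hη')
    obtain ⟨e, ⟨he, he'⟩, hs⟩ := (CStarAlgebra.hasBasis_approximateUnit A).eventually_iff.1 h1
    refine ⟨e, he, he', ?_⟩
    have := hs (x := e) ⟨le_refl e, by simpa using he'.le⟩
    simpa [dist_eq_norm, norm_sub_rev] using this
  let e₁ : PedBall A := ⟨Pos.cut (δ ^ 2 / (2 * (‖x‖ + 1) ^ 2)) ⟨e₀, he₀⟩, Pos.cut_mem hη _,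
    (Pos.norm_cut_le hη.le _).trans_lt he₀'⟩
  have hx₁ : ‖x - (e₁.1 : A) * x‖ ≤ δ ^ 2 / (‖x‖ + 1) := by
    have h2 : x - (e₁.1 : A) * x = (x - e₀ * x) - ((e₁.1 : A) - e₀) * x := by
      rw [sub_mul]; abel
    have h3 : ‖((e₁.1 : A) - e₀) * x‖ ≤ δ ^ 2 / (2 * (‖x‖ + 1) ^ 2) * (‖x‖ + 1) :=
      (norm_mul_le _ _).trans (mul_le_mul (Pos.norm_cut_sub_le hη.le ⟨e₀, he₀⟩) (by linarith)
        (norm_nonneg _) hη.le)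
    rw [h2]
    refine (norm_sub_le _ _).trans ((add_le_add hx₀.le h3).trans_eq ?_)
    field_simp
    ring
  filter_upwards [eventually_ge_atTop e₁] with e he
  rw [dist_comm, dist_eq_norm]
  refine (CStarAlgebra.norm_sub_mul_self_le_of_inr x e₁.1.2 he e.2.2.le hδ.le ?_).trans_lt hδε
  have h4 : star (x : Unitization ℂ A) * (1 - ((e₁.1 : A) : Unitization ℂ A)) * x =
      ((star x * (x - (e₁.1 : A) * x) : A) : Unitization ℂ A) := by
    simp only [Unitization.inr_mul, Unitization.inr_sub, Unitization.inr_star, mul_sub, sub_mul,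
      mul_one, mul_assoc]
  rw [h4, Unitization.norm_inr]
  refine (norm_mul_le _ _).trans ?_
  rw [norm_star]
  calc ‖x‖ * ‖x - (e₁.1 : A) * x‖ ≤ (‖x‖ + 1) * (δ ^ 2 / (‖x‖ + 1)) := by gcongr; linarith
    _ = δ ^ 2 := by field_simp

end Pedersen

/-! ### Additive functions on the positive cone and their linear extensions -/

section PosFun

open scoped ComplexOrder

variable {A : Type*} [NonUnitalCStarAlgebra A] [PartialOrder A] [StarOrderedRing A]

/-- An additive and positively homogeneous map `A₊ → [0, ∞)`. -/
structure IsPosFun (φ : Pos A → ℝ) : Prop where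
  nonneg : ∀ a, 0 ≤ φ a
  add : ∀ a b, φ (a + b) = φ a + φ b
  scale : ∀ (t : ℝ≥0) (a), φ (a.scale t) = t * φ a

namespace IsPosFun

variable {φ : Pos A → ℝ}

theorem mono (hφ : IsPosFun φ) {a b : Pos A} (h : (a : A) ≤ b) : φ a ≤ φ b := by
  have : b = a + ⟨(b : A) - a, sub_nonneg.2 h⟩ := Subtype.ext (by simp)
  rw [this, hφ.add]
  exact le_add_of_nonneg_right (hφ.nonneg _)

theorem zero (hφ : IsPosFun φ) : φ 0 = 0 := by
  have h : Pos.scale 0 (0 : Pos A) = 0 := Subtype.ext (by simp [Pos.scale])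
  simpa [h] using hφ.scale 0 0

/-- The value at `x` is `φ` of the positive part of `Re x` minus `φ` of its negative part;
additivity makes it the same for every decomposition of `Re x` as a difference of positive elements.
The vanishing on `i A₊` makes the complexification agree with `φ` on `A₊`. -/
theorem exists_real_linear (hφ : IsPosFun φ) : ∃ g : A →ₗ[ℝ] ℝ, (∀ a : Pos A, g a = φ a) ∧
    ∀ a : Pos A, g (Complex.I • (a : A)) = 0 := by
  let P (x : A) : Pos A := ⟨(realPart x : A)⁺, CFC.posPart_nonneg _⟩
  let N (x : A) : Pos A := ⟨(realPart x : A)⁻, CFC.negPart_nonneg _⟩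
  have hPN (x : A) : (P x : A) - N x = realPart x :=
    CFC.posPart_sub_negPart _ (realPart x).2
  have wd (x : A) (p q : Pos A) (h : (p : A) - q = realPart x) : φ (P x) - φ (N x) = φ p - φ q := by
    have : P x + q = p + N x := Subtype.ext (by
      have := (hPN x).trans h.symm
      simp only [Nonneg.coe_add]
      rw [sub_eq_sub_iff_add_eq_add] at this
      exact this)
    have := congrArg φ this
    rw [hφ.add, hφ.add] at this
    linarith
  refine ⟨⟨⟨fun x => φ (P x) - φ (N x), fun x y => ?_⟩, fun r x => ?_⟩, fun a => ?_, fun a => ?_⟩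
  · rw [wd (x + y) (P x + P y) (N x + N y) (by
      simp only [Nonneg.coe_add, map_add, AddSubgroup.coe_add, ← hPN]; abel), hφ.add, hφ.add]
    ring
  · simp only [RingHom.id_apply, smul_eq_mul]
    rcases le_total 0 r with hr | hr
    · lift r to ℝ≥0 using hr
      rw [wd _ ((P x).scale r) ((N x).scale r) (by
        rw [Pos.coe_scale, Pos.coe_scale, ← smul_sub, hPN, map_smul]; rfl), hφ.scale, hφ.scale]
      ring
    · obtain ⟨s, rfl⟩ : ∃ s : ℝ≥0, r = -s := ⟨(-r).toNNReal, by rw [Real.coe_toNNReal _ (by linarith), neg_neg]⟩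
      rw [wd _ ((N x).scale s) ((P x).scale s) (by
        rw [Pos.coe_scale, Pos.coe_scale, ← smul_sub, ← neg_sub, hPN, map_smul, neg_smul, smul_neg]
        rfl), hφ.scale, hφ.scale]
      ring
  · change φ (P a) - φ (N a) = φ a
    rw [wd a a 0 (by simp [(IsSelfAdjoint.of_nonneg a.2).coe_realPart]), hφ.zero, sub_zero]
  · change φ (P _) - φ (N _) = 0
    rw [wd _ 0 0 ?_, sub_self]
    simp [realPart_I_smul, (IsSelfAdjoint.of_nonneg a.2).imaginaryPart]

/-- An additive and positively homogeneous map on the positive cone extends to a positive linear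
functional. -/
theorem exists_positiveLinearMap (hφ : IsPosFun φ) :
    ∃ L : A →ₚ[ℂ] ℂ, ∀ a : Pos A, L a = (φ a : ℂ) := by
  obtain ⟨g, hg, hg'⟩ := hφ.exists_real_linear
  have hL (a : Pos A) : Module.Dual.extendRCLike (𝕜 := ℂ) g (a : A) = (φ a : ℂ) := by
    rw [Module.Dual.extendRCLike_apply, hg]
    simp only [RCLike.I_to_complex, hg']
    simp
  refine ⟨PositiveLinearMap.mk₀ (Module.Dual.extendRCLike (𝕜 := ℂ) g) fun a ha => ?_, hL⟩
  rw [hL ⟨a, ha⟩]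
  exact_mod_cast hφ.nonneg _

/-- The positive linear functional that extends a given additive and positively homogeneous map. -/
def ext (hφ : IsPosFun φ) : A →L[ℂ] ℂ :=
  { toLinearMap := hφ.exists_positiveLinearMap.choose.toLinearMap
    cont := map_continuous hφ.exists_positiveLinearMap.choose }

theorem ext_apply (hφ : IsPosFun φ) (a : Pos A) : hφ.ext a = (φ a : ℂ) :=
  hφ.exists_positiveLinearMap.choose_spec a

theorem eq_re (hφ : IsPosFun φ) (a : Pos A) : φ a = (hφ.ext a).re := by
  rw [hφ.ext_apply, Complex.ofReal_re]

theorem continuous (hφ : IsPosFun φ) : Continuous φ := by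
  have : φ = fun a : Pos A => (hφ.ext a).re := funext hφ.eq_re
  rw [this]
  fun_prop

theorem exists_bound (hφ : IsPosFun φ) : ∃ M : ℝ, 0 ≤ M ∧ ∀ a : Pos A, φ a ≤ M * ‖(a : A)‖ := by
  refine ⟨‖hφ.ext‖, norm_nonneg _, fun a => ?_⟩
  rw [hφ.eq_re]
  exact (Complex.re_le_norm _).trans (hφ.ext.le_opNorm _)

/-- The factor 4 counts the positive elements, each of norm at most `‖x‖`, into which `x`
decomposes. -/
theorem norm_ext_le (hφ : IsPosFun φ) {M : ℝ} (hM : ∀ a : Pos A, φ a ≤ M * ‖(a : A)‖)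
    (hM0 : 0 ≤ M) (x : A) : ‖hφ.ext x‖ ≤ 4 * M * ‖x‖ := by
  obtain ⟨y, hy0, hyn, hy⟩ := CStarAlgebra.exists_sum_four_nonneg x
  conv_lhs => rw [hy]
  simp only [map_sum, map_smul]
  refine (norm_sum_le _ _).trans ((Finset.sum_le_sum (g := fun _ => M * ‖x‖) fun i _ => ?_).trans ?_)
  · rw [norm_smul, norm_pow, Complex.norm_I, one_pow, one_mul, hφ.ext_apply ⟨y i, hy0 i⟩,
      Complex.norm_real, Real.norm_eq_abs, abs_of_nonneg (hφ.nonneg _)]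
    exact (hM _).trans (mul_le_mul_of_nonneg_left (hyn i) hM0)
  · simp [mul_assoc]

theorem smul (hφ : IsPosFun φ) {c : ℝ} (hc : 0 ≤ c) : IsPosFun (fun a => c * φ a) :=
  ⟨fun a => mul_nonneg hc (hφ.nonneg a), fun a b => by simp only [hφ.add, mul_add],
    fun t a => by simp only [hφ.scale]; ring⟩

theorem comp_conj (hφ : IsPosFun φ) (w : A) : IsPosFun (fun a => φ (a.conj w)) :=
  ⟨fun _ => hφ.nonneg _, fun a b => by
    rw [← hφ.add]
    congr 1
    exact Subtype.ext (by simp [Pos.coe_conj, mul_add, add_mul]),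
   fun t a => by
    rw [← hφ.scale]
    congr 1
    exact Subtype.ext (by simp only [Pos.coe_conj, Pos.coe_scale, mul_smul_comm, smul_mul_assoc])⟩

end IsPosFun

/-- Two linear maps on a C*-algebra that agree on the positive elements are equal. -/
theorem linearMap_ext_pos {E : Type*} [AddCommGroup E] [Module ℂ E] {f g : A →ₗ[ℂ] E}
    (h : ∀ a : Pos A, f a = g a) : f = g := by
  refine LinearMap.ext_on_range (v := fun a : Pos A => (a : A)) ?_ h
  rw [eq_top_iff, ← CStarAlgebra.span_nonneg]
  exact Submodule.span_mono fun a ha => ⟨⟨a, ha⟩, rfl⟩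

/-- Polarization: a form that is linear in one variable and conjugate linear in the other is
determined by its diagonal. -/
theorem eq_of_diag {E : Type*} [AddCommGroup E] [Module ℂ E] {S T : E → E → ℂ}
    (hS : ∀ x y z, S (x + y) z = S x z + S y z) (hS' : ∀ x y z, S x (y + z) = S x y + S x z)
    (hSI : ∀ x y, S (Complex.I • x) y = -Complex.I * S x y)
    (hSI' : ∀ x y, S x (Complex.I • y) = Complex.I * S x y)
    (hT : ∀ x y z, T (x + y) z = T x z + T y z) (hT' : ∀ x y z, T x (y + z) = T x y + T x z)
    (hTI : ∀ x y, T (Complex.I • x) y = -Complex.I * T x y)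
    (hTI' : ∀ x y, T x (Complex.I • y) = Complex.I * T x y)
    (h : ∀ x, S x x = T x x) (x y : E) : S x y = T x y := by
  -- The diagonal at `x + y` determines `S x y + S y x`, and the diagonal at `x + i y` determines `S
  -- x y - S y x`.
  have h1 := h (x + y)
  have h2 := h (x + Complex.I • y)
  simp only [hS, hS', hT, hT', hSI, hSI', hTI, hTI', h] at h1 h2
  have h3 : Complex.I * Complex.I = -1 := Complex.I_mul_I
  linear_combination (1 / 2 : ℂ) * h1 - (1 / 2 : ℂ) * Complex.I * h2 +
    (1 / 2 : ℂ) * (T y x - S y x - T x y + S x y) * h3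

end PosFun

/-! ### Traces as suprema of directed families of positive functionals -/

section Net

variable {A : Type*} [NonUnitalCStarAlgebra A] [PartialOrder A] [StarOrderedRing A]

theorem Pos.conj_le (a : Pos A) (w : A) (ha : ‖(a : A)‖ ≤ 1) :
    (a.conj w : A) ≤ Pos.starMul w := by
  refine (CStarAlgebra.star_left_conjugate_le_norm_smul (IsSelfAdjoint.of_nonneg a.2)).trans ?_
  calc ‖(a : A)‖ • (star w * w) ≤ (1 : ℝ) • (star w * w) :=
        smul_le_smul_of_nonneg_right ha (star_mul_self_nonneg w)
    _ = _ := one_smul _ _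

theorem Pos.starMul_sqrt (a : Pos A) : Pos.starMul (a.sqrt : A) = a :=
  Subtype.ext (by rw [Pos.coe_starMul, Pos.star_eq, Pos.sqrt_mul_sqrt])

theorem tendsto_conj {I : Type*} {l : Filter I} {e : I → Pos A} {x : A}
    (h : Tendsto (fun i => (e i : A) * x) l (𝓝 x)) :
    Tendsto (fun i => (e i).conj x) l (𝓝 (Pos.starMul x)) := by
  rw [tendsto_subtype_rng]
  simpa only [Pos.coe_conj, Pos.coe_starMul, mul_assoc] using h.const_mul (star x)

/-- A directed family of positive functionals with the symmetry of a trace, cut down by an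
approximate unit, has a densely finite lower semicontinuous trace as its supremum. -/
theorem exists_ltc_of_directed {I : Type*} [Preorder I] [IsDirected I (· ≤ ·)] [Nonempty I]
    (e : I → Pos A) (ω : I → Pos A → ℝ) (hω : ∀ i, IsPosFun (ω i))
    (hmono : ∀ i j, i ≤ j → ∀ x, ω i x ≤ ω j x) (hn : ∀ i, ‖(e i : A)‖ ≤ 1)
    (hsym : ∀ i j x, ω i ((e j).conj x) = ω j ((e i).conj (star x)))
    (happ : ∀ x : A, Tendsto (fun i => (e i : A) * x) atTop (𝓝 x)) :
    ∃ τ : LTC A, ∀ x, τ x = ⨆ i, ENNReal.ofReal (ω i x) := by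
  -- As `x* eⱼ x → x* x`, it suffices to bound `ωᵢ (x* eⱼ x) = ωⱼ (x eᵢ x*)`, and this is at most
  -- `ωⱼ (x x*)` since `‖eᵢ‖ ≤ 1`.
  have htr (x : A) (i : I) : ENNReal.ofReal (ω i (Pos.starMul x)) ≤
      ⨆ j, ENNReal.ofReal (ω j (Pos.starMul (star x))) := by
    have h1 : Tendsto (fun j => ENNReal.ofReal (ω i ((e j).conj x))) atTop
        (𝓝 (ENNReal.ofReal (ω i (Pos.starMul x)))) :=
      (ENNReal.continuous_ofReal.comp (hω i).continuous).tendsto _ |>.comp (tendsto_conj (happ x))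
    refine le_of_tendsto' h1 fun j => ?_
    rw [hsym]
    exact (ENNReal.ofReal_le_ofReal ((hω j).mono (Pos.conj_le _ _ (hn i)))).trans
      (le_iSup (fun j => ENNReal.ofReal (ω j (Pos.starMul (star x)))) j)
  refine ⟨⟨fun x => ⨆ i, ENNReal.ofReal (ω i x), ⟨?_, ?_, ?_⟩, ?_, ?_⟩, fun _ => rfl⟩
  · intro a b
    rw [ENNReal.iSup_add_iSup]
    · exact iSup_congr fun i => by
        rw [(hω i).add, ENNReal.ofReal_add ((hω i).nonneg _) ((hω i).nonneg _)]
    · intro i j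
      obtain ⟨k, hik, hjk⟩ := exists_ge_ge i j
      exact ⟨k, add_le_add (ENNReal.ofReal_le_ofReal (hmono i k hik _))
        (ENNReal.ofReal_le_ofReal (hmono j k hjk _))⟩
  · intro t a
    rw [ENNReal.mul_iSup]
    exact iSup_congr fun i => by
      rw [(hω i).scale, ENNReal.ofReal_mul (NNReal.coe_nonneg t), ENNReal.ofReal_coe_nnreal]
  · intro x
    refine le_antisymm (iSup_le fun i => htr x i) (iSup_le fun i => ?_)
    simpa using htr (star x) i
  · exact lowerSemicontinuous_iSup fun i =>
      (ENNReal.continuous_ofReal.comp (hω i).continuous).lowerSemicontinuous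
  · intro y
    -- The elements `√y eᵢ √y` approximate `y` and have finite trace: `ωⱼ (√y eᵢ √y) = ωᵢ (√y eⱼ √y)
    -- ≤ ωᵢ y` for all `j`.
    have h1 := tendsto_conj (happ (y.sqrt : A))
    rw [Pos.starMul_sqrt] at h1
    refine mem_closure_of_tendsto h1 (Eventually.of_forall fun i => ?_)
    refine lt_of_le_of_lt (iSup_le fun j => ?_)
      (ENNReal.ofReal_lt_top (r := ω i (Pos.starMul (star (y.sqrt : A)))))
    rw [hsym]
    exact ENNReal.ofReal_le_ofReal ((hω i).mono (Pos.conj_le _ _ (hn j)))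

end Net

/-! ### The identities that characterize traces on the Pedersen ideal -/

section Reg

variable {A : Type*} [NonUnitalCStarAlgebra A] [PartialOrder A] [StarOrderedRing A]

namespace PedPos

instance : Add (PedPos A) := ⟨fun a b => ⟨a.1 + b.1, Submodule.add_mem _ a.2 b.2⟩⟩

instance : SMul ℝ≥0 (PedPos A) := ⟨fun t a => ⟨a.1.scale t, by
  rw [Pos.coe_scale, ← Complex.coe_smul]
  exact Submodule.smul_mem _ _ a.2⟩⟩

/-- The element `w* a w` of `K(A)₊`. -/
def conj (a : PedPos A) (w : A) : PedPos A :=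
  ⟨a.1.conj w, mem_pedersenIdeal_mul (mul_mem_pedersenIdeal a.2 _) _⟩

theorem smul_val (t : ℝ≥0) (a : PedPos A) : (t • a).1 = a.1.scale t := rfl

theorem conj_val (a : PedPos A) (w : A) : (a.conj w).1 = a.1.conj w := rfl

@[ext]
theorem ext {a b : PedPos A} (h : (a.1 : A) = b.1) : a = b := Subtype.ext (Subtype.ext h)

theorem exists_add_of_le {a b : PedPos A} (h : (a.1 : A) ≤ b.1) : ∃ c : PedPos A, b = a + c :=
  ⟨⟨⟨(b.1 : A) - a.1, sub_nonneg.2 h⟩, Submodule.sub_mem _ b.2 a.2⟩, by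
    ext; exact (add_sub_cancel _ _).symm⟩

end PedPos

/-- A map on `K(A)₊` with the algebraic properties of the restriction of a trace on `A`. -/
structure Reg {M : Type*} [AddCommMonoid M] [Module ℝ≥0 M] (φ : PedPos A → M) : Prop where
  add : ∀ a b, φ (a + b) = φ a + φ b
  smul : ∀ (t : ℝ≥0) (a), φ (t • a) = t • φ a
  -- For a trace, `τ (z* e z) = τ (√e z z* √e)`, which is additive in `z z*`. The identity `symm` is
  -- `τ (w* w) = τ (w w*)` for `w = √f x √e`. In both, the map is only evaluated on `K(A)₊`.
  conj_add : ∀ (e : PedPos A) (x y z : A), z * star z = x * star x + y * star y →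
    φ (e.conj z) = φ (e.conj x) + φ (e.conj y)
  symm : ∀ (e f : PedPos A) (x y z : A), y * star y = star x * f.1 * x →
    z * star z = x * e.1 * star x → φ (e.conj y) = φ (f.conj z)

namespace Reg

variable {M N : Type*} [AddCommMonoid M] [Module ℝ≥0 M] [AddCommMonoid N] [Module ℝ≥0 N]

/-- General target modules are allowed so that the slice map `a ↦ τ (a ⊗ ·)`, with values in
`LTC(A₂)`, can be composed with band projections and evaluations. -/
theorem comp {φ : PedPos A → M} (hφ : Reg φ) (f : M →ₗ[ℝ≥0] N) : Reg (fun a => f (φ a)) :=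
  ⟨fun a b => by rw [hφ.add, map_add], fun t a => by rw [hφ.smul, map_smul],
    fun e x y z h => by rw [hφ.conj_add e x y z h, map_add],
    fun e f x y z h h' => by rw [hφ.symm e f x y z h h']⟩

theorem pi {ι : Type*} {φ : PedPos A → ι → M} (h : ∀ i, Reg (fun a => φ a i)) : Reg φ :=
  ⟨fun a b => funext fun i => (h i).add a b, fun t a => funext fun i => (h i).smul t a,
    fun e x y z hz => funext fun i => (h i).conj_add e x y z hz,
    fun e f x y z hy hz => funext fun i => (h i).symm e f x y z hy hz⟩

theorem of_injective {φ : PedPos A → M} (f : M →ₗ[ℝ≥0] N) (hf : Function.Injective f)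
    (h : Reg (fun a => f (φ a))) : Reg φ :=
  ⟨fun a b => hf (by rw [map_add]; exact h.add a b),
    fun t a => hf (by rw [map_smul]; exact h.smul t a),
    fun e x y z hz => hf (by rw [map_add]; exact h.conj_add e x y z hz),
    fun e f x y z hy hz => hf (h.symm e f x y z hy hz)⟩

theorem of_add_left [IsCancelAdd M] {φ ψ : PedPos A → M} (hφ : Reg φ)
    (h : Reg (fun a => φ a + ψ a)) : Reg ψ :=
  ⟨fun a b => by
    have := h.add a b
    rw [hφ.add, add_add_add_comm (φ a)] at this
    exact add_left_cancel this,
   fun t a => by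
    have := h.smul t a
    rw [hφ.smul, smul_add] at this
    exact add_left_cancel this,
   fun e x y z hz => by
    have := h.conj_add e x y z hz
    rw [hφ.conj_add e x y z hz, add_add_add_comm (φ _)] at this
    exact add_left_cancel this,
   fun e f x y z hy hz => by
    have := h.symm e f x y z hy hz
    rw [hφ.symm e f x y z hy hz] at this
    exact add_left_cancel this⟩

/-- All four conditions are equations between values at finitely many points, hence closed under
pointwise convergence. -/
theorem of_tendsto {I : Type*} {l : Filter I} [l.NeBot] {φ : I → PedPos A → ℝ≥0}
    {ψ : PedPos A → ℝ≥0} (hφ : ∀ i, Reg (φ i)) (h : ∀ a, Tendsto (fun i => φ i a) l (𝓝 (ψ a))) :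
    Reg ψ :=
  ⟨fun a b => tendsto_nhds_unique (h _)
      (((h a).add (h b)).congr fun i => ((hφ i).add a b).symm),
   fun t a => tendsto_nhds_unique (h _) (((h a).const_smul t).congr fun i => ((hφ i).smul t a).symm),
   fun e x y z hz => tendsto_nhds_unique (h _)
      (((h _).add (h _)).congr fun i => ((hφ i).conj_add e x y z hz).symm),
   fun e f x y z hy hz => tendsto_nhds_unique (h _)
      ((h _).congr fun i => ((hφ i).symm e f x y z hy hz).symm)⟩

end Reg

/-- A map that is a trace on the set where some trace, finite on `K(A)₊`, is finite, is regular. -/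
theorem reg_of_finite {τ μ : Pos A → ℝ≥0∞} (hτ : IsTrace τ) (hK : ∀ k : PedPos A, τ k.1 < ∞)
    (hadd : ∀ a b, τ a < ∞ → τ b < ∞ → μ (a + b) = μ a + μ b)
    (hscale : ∀ (t : ℝ≥0) a, τ a < ∞ → μ (a.scale t) = t * μ a)
    (htr : ∀ x, τ (Pos.starMul x) < ∞ → μ (Pos.starMul x) = μ (Pos.starMul (star x))) :
    Reg (fun k : PedPos A => μ k.1) := by
  -- Everything reduces to `w = √e x`, for which `w* w = x* e x` lies in `K(A)₊` while `w w* = √e x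
  -- x* √e` need not; it has finite trace because `τ` is a trace.
  have e0 (e : PedPos A) (x : A) : Pos.starMul ((e.1.sqrt : A) * x) = e.1.conj x :=
    Subtype.ext (by
      rw [Pos.coe_starMul, Pos.coe_conj, star_mul, Pos.star_eq, ← e.1.sqrt_mul_sqrt]
      simp only [mul_assoc])
  have e1 (e : PedPos A) (x : A) : Pos.starMul (star ((e.1.sqrt : A) * x)) =
      (Pos.starMul (star x)).conj (e.1.sqrt : A) :=
    Subtype.ext (by
      rw [Pos.coe_starMul, Pos.coe_conj, Pos.coe_starMul, star_star, star_mul, Pos.star_eq]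
      simp only [star_star, mul_assoc])
  have hfin (e : PedPos A) (x : A) : τ (e.1.conj x) < ∞ := hK (e.conj x)
  have h1 (e : PedPos A) (x : A) :
      μ (e.1.conj x) = μ ((Pos.starMul (star x)).conj (e.1.sqrt : A)) := by
    have := htr ((e.1.sqrt : A) * x) (by rw [e0]; exact hfin e x)
    rwa [e0, e1] at this
  have hfin' (e : PedPos A) (x : A) : τ ((Pos.starMul (star x)).conj (e.1.sqrt : A)) < ∞ := by
    rw [← e1, ← hτ.tracial, e0]
    exact hfin e x
  refine ⟨fun a b => hadd _ _ (hK a) (hK b), fun t a => hscale t _ (hK a), ?_, ?_⟩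
  · intro e x y z hz
    simp only [PedPos.conj_val, h1]
    rw [← hadd _ _ (hfin' _ _) (hfin' _ _)]
    congr 1
    refine Subtype.ext ?_
    simp only [Nonneg.coe_add, Pos.coe_conj, Pos.coe_starMul, star_star, hz, mul_add, add_mul]
  · intro e f x y z hy hz
    simp only [PedPos.conj_val, h1]
    have e2 : (Pos.starMul (star y)).conj (e.1.sqrt : A) =
        Pos.starMul ((f.1.sqrt : A) * x * e.1.sqrt) := Subtype.ext (by
      simp only [Pos.coe_conj, Pos.coe_starMul, star_star, hy, star_mul, Pos.star_eq]
      rw [← f.1.sqrt_mul_sqrt]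
      simp only [mul_assoc])
    have e3 : (Pos.starMul (star z)).conj (f.1.sqrt : A) =
        Pos.starMul (star ((f.1.sqrt : A) * x * e.1.sqrt)) := Subtype.ext (by
      simp only [Pos.coe_conj, Pos.coe_starMul, star_star, hz, star_mul, Pos.star_eq]
      rw [← e.1.sqrt_mul_sqrt]
      simp only [mul_assoc])
    rw [e2, e3]
    refine htr _ ?_
    rw [← e2]
    exact hfin' _ _

theorem IsTrace.reg {τ : Pos A → ℝ≥0∞} (hτ : IsTrace τ) :
    Reg (fun k : PedPos A => τ k.1) :=
  -- Comparison with the zero trace makes the finiteness conditions void.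
  reg_of_finite (τ := 0) ⟨by simp, by simp, by simp⟩ (by simp) (fun a b _ _ => hτ.add a b)
    (fun t a _ => hτ.scale t a) fun x _ => hτ.tracial x

theorem Reg.of_coe {φ : PedPos A → ℝ≥0} (h : Reg (fun a => (φ a : ℝ≥0∞))) : Reg φ :=
  ⟨fun a b => by have := h.add a b; exact_mod_cast this,
    fun t a => by
      have := h.smul t a
      rw [ENNReal.smul_def, smul_eq_mul] at this
      rw [smul_eq_mul]
      exact_mod_cast this,
    fun e x y z hz => by have := h.conj_add e x y z hz; exact_mod_cast this,
    fun e f x y z hy hz => by have := h.symm e f x y z hy hz; exact_mod_cast this⟩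

theorem LTC.reg_restrict (τ : LTC A) : Reg (LTC.restrict A τ) := by
  refine Reg.of_coe ?_
  simp only [LTC.coe_restrict]
  exact τ.2.1.reg

end Reg

/-! ### Extension from the Pedersen ideal to lower semicontinuous traces -/

section Extension

variable {A : Type*} [NonUnitalCStarAlgebra A] [PartialOrder A] [StarOrderedRing A]

/-- The element of `K(A)₊` given by an element of the unit ball. -/
def PedBall.toPed (e : PedBall A) : PedPos A := ⟨e.1, e.2.1⟩

namespace Reg

variable {φ : PedPos A → ℝ≥0}

theorem conj_congr (hφ : Reg φ) (e : PedPos A) {x y : A} (h : x * star x = y * star y) :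
    φ (e.conj x) = φ (e.conj y) := by
  have h0 : φ (e.conj 0) = 0 := by
    have := hφ.conj_add e 0 0 0 (by simp)
    simpa using this
  have := hφ.conj_add e y 0 x (by simpa using h)
  rwa [h0, add_zero] at this

/-- This plays the role of `x ↦ τ (√e x √e)` before a trace is available. The value depends only on
`√x (√x)* = x`, and `conj_add` is its additivity. -/
theorem isPosFun (hφ : Reg φ) (e : PedPos A) :
    IsPosFun (fun x : Pos A => (φ (e.conj (x.sqrt : A)) : ℝ)) := by
  have hs (x : Pos A) : (x.sqrt : A) * star (x.sqrt : A) = x := by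
    rw [Pos.star_eq, Pos.sqrt_mul_sqrt]
  refine ⟨fun _ => NNReal.coe_nonneg _, fun x y => ?_, fun t x => ?_⟩
  · rw [hφ.conj_add e (x.sqrt : A) (y.sqrt : A) _ (by rw [hs, hs, hs]; rfl), NNReal.coe_add]
  · have h1 : φ (e.conj ((x.scale t).sqrt : A)) =
        φ (e.conj ((NNReal.sqrt t : ℝ) • (x.sqrt : A))) := by
      refine hφ.conj_congr e ?_
      rw [hs, star_smul, smul_mul_smul_comm, hs, star_trivial, ← NNReal.coe_mul,
        NNReal.mul_self_sqrt]
      rfl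
    have h2 : e.conj ((NNReal.sqrt t : ℝ) • (x.sqrt : A)) = t • e.conj (x.sqrt : A) := by
      ext
      simp only [PedPos.conj_val, PedPos.smul_val, Pos.coe_conj, Pos.coe_scale, star_smul,
        smul_mul_assoc, mul_smul_comm, smul_smul]
      rw [star_trivial (NNReal.sqrt t : ℝ), ← NNReal.coe_mul, NNReal.mul_self_sqrt]
    rw [h1, h2, hφ.smul, smul_eq_mul, NNReal.coe_mul]

theorem mono (hφ : Reg φ) {a b : PedPos A} (h : (a.1 : A) ≤ b.1) : φ a ≤ φ b := by
  obtain ⟨c, rfl⟩ := PedPos.exists_add_of_le h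
  rw [hφ.add]
  exact le_self_add

theorem eq_zero (hφ : Reg φ) (z : PedPos A) (hz : (z.1 : A) = 0) : φ z = 0 := by
  have h : (0 : ℝ≥0) • z = z :=
    PedPos.ext (by rw [PedPos.smul_val, Pos.coe_scale, hz, smul_zero])
  rw [← h, hφ.smul, zero_smul]

theorem apply_conj_sqrt (hφ : Reg φ) (e f : PedPos A) (x : A) :
    φ (e.conj ((f.1.conj x).sqrt : A)) = φ (f.conj ((e.1.conj (star x)).sqrt : A)) := by
  refine hφ.symm e f x _ _ ?_ ?_
  · rw [Pos.star_eq, Pos.sqrt_mul_sqrt, Pos.coe_conj]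
  · rw [Pos.star_eq, Pos.sqrt_mul_sqrt, Pos.coe_conj, star_star]

/-- For `k = w* f w` with `f ∈ K(A)₊`, symmetry moves the approximate unit inside: `φ (√k e √k)`
becomes the functional attached to `f` at `w e w*`, and that functional is norm continuous. Sums and
differences of such `k` exhaust `K(A)₊`. -/
theorem tendsto_conj_sqrt (hφ : Reg φ) (k : PedPos A) :
    Tendsto (fun e : PedBall A => (φ (e.toPed.conj (k.1.sqrt : A)) : ℝ)) atTop (𝓝 (φ k)) := by
  have hP : ∀ p ∈ conjCone (unitSet A), ∃ hp : (p : A) ∈ pedersenIdeal A,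
      Tendsto (fun e : PedBall A => (φ (e.toPed.conj (p.sqrt : A)) : ℝ)) atTop (𝓝 (φ ⟨p, hp⟩)) := by
    intro p hp
    induction hp using AddSubmonoid.closure_induction with
    | mem p h =>
      obtain ⟨f, hf, w, rfl⟩ := h
      let f' : PedPos A := ⟨f, unitSet_subset hf⟩
      refine ⟨(f'.conj w).2, ?_⟩
      have h1 (e : PedBall A) : (φ (e.toPed.conj ((f.conj w).sqrt : A)) : ℝ) =
          φ (f'.conj ((e.1.conj (star w)).sqrt : A)) :=
        congrArg NNReal.toReal (hφ.apply_conj_sqrt e.toPed f' w)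
      have h2 : φ ⟨f.conj w, (f'.conj w).2⟩ =
          φ (f'.conj ((Pos.starMul (star w)).sqrt : A)) := by
        refine hφ.conj_congr f' (x := w) ?_
        rw [Pos.star_eq, Pos.sqrt_mul_sqrt, Pos.coe_starMul, star_star]
      simp only [h1]
      rw [h2]
      exact (hφ.isPosFun f').continuous.tendsto _ |>.comp (tendsto_conj (tendsto_pedBall_mul (star w)))
    | zero =>
      refine ⟨zero_mem _, ?_⟩
      have h0 : φ ⟨0, zero_mem _⟩ = 0 := hφ.eq_zero _ rfl
      have h1 (e : PedBall A) : (φ (e.toPed.conj ((0 : Pos A).sqrt : A)) : ℝ) = 0 :=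
        (hφ.isPosFun e.toPed).zero
      simp only [h1, h0]
      exact tendsto_const_nhds
    | add p q _ _ h1 h2 =>
      obtain ⟨hp, hp'⟩ := h1
      obtain ⟨hq, hq'⟩ := h2
      refine ⟨Submodule.add_mem _ hp hq, ?_⟩
      have h3 (e : PedBall A) := (hφ.isPosFun e.toPed).add p q
      have h4 : φ ⟨p + q, Submodule.add_mem _ hp hq⟩ = φ ⟨p, hp⟩ + φ ⟨q, hq⟩ := hφ.add ⟨p, hp⟩ ⟨q, hq⟩
      simp only [h3, h4, NNReal.coe_add]
      exact hp'.add hq'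
  obtain ⟨n, hn, p, hp, h⟩ := exists_add_eq_of_mem_idealSpan
    (pedersenIdeal_le_idealSpan_unitSet A k.2)
  obtain ⟨hn', hn⟩ := hP n hn
  obtain ⟨hp', hp⟩ := hP p hp
  subst h
  have h3 (e : PedBall A) : (φ (e.toPed.conj (k.1.sqrt : A)) : ℝ) =
      φ (e.toPed.conj ((k.1 + n).sqrt : A)) - φ (e.toPed.conj (n.sqrt : A)) := by
    have := (hφ.isPosFun e.toPed).add k.1 n
    linarith
  have h4 : φ ⟨k.1 + n, hp'⟩ = φ k + φ ⟨n, hn'⟩ := hφ.add k ⟨n, hn'⟩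
  have h5 : (φ k : ℝ) = φ ⟨k.1 + n, hp'⟩ - φ ⟨n, hn'⟩ := by
    rw [h4, NNReal.coe_add]; ring
  rw [h5]
  simp only [h3]
  exact hp.sub hn

/-- A regular map on `K(A)₊` is the restriction of a densely finite lower semicontinuous trace. -/
theorem exists_ltc (hφ : Reg φ) : ∃ τ : LTC A, LTC.restrict A τ = φ := by
  have hmono : ∀ e f : PedBall A, e ≤ f → ∀ x : Pos A,
      (φ (e.toPed.conj (x.sqrt : A)) : ℝ) ≤ φ (f.toPed.conj (x.sqrt : A)) := by
    intro e f hef x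
    exact_mod_cast hφ.mono (a := e.toPed.conj _) (b := f.toPed.conj _)
      (star_left_conjugate_le_conjugate (show (e.1 : A) ≤ f.1 from hef) _)
  obtain ⟨τ, hτ⟩ := exists_ltc_of_directed (fun e : PedBall A => e.1)
    (fun e x => (φ (e.toPed.conj (x.sqrt : A)) : ℝ)) (fun e => hφ.isPosFun e.toPed) hmono
    (fun e => e.2.2.le)
    (fun e f x => by exact_mod_cast hφ.apply_conj_sqrt e.toPed f.toPed x) tendsto_pedBall_mul
  refine ⟨τ, funext fun k => ?_⟩
  rw [← ENNReal.coe_inj, LTC.coe_restrict, hτ]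
  have h1 : Tendsto (fun e : PedBall A => ENNReal.ofReal (φ (e.toPed.conj (k.1.sqrt : A)) : ℝ)) atTop
      (𝓝 (⨆ e : PedBall A, ENNReal.ofReal (φ (e.toPed.conj (k.1.sqrt : A)) : ℝ))) :=
    tendsto_atTop_iSup fun e f hef => ENNReal.ofReal_le_ofReal (hmono e f hef _)
  have h2 := (ENNReal.continuous_ofReal.tendsto _).comp (hφ.tendsto_conj_sqrt k)
  rw [tendsto_nhds_unique h1 h2, ENNReal.ofReal_coe_nnreal]

end Reg

namespace LTC

/-- Lower semicontinuity along `√x e √x → x` gives one inequality, and `√x e √x ≤ x` the other.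
Since `√x e √x` lies in `K(A)₊`, a trace is determined by its restriction. -/
theorem apply_eq_iSup (τ : LTC A) (x : Pos A) :
    τ x = ⨆ e : PedBall A, τ (e.1.conj (x.sqrt : A)) := by
  refine le_antisymm ?_ (iSup_le fun e => ?_)
  · have h1 := tendsto_conj (tendsto_pedBall_mul (x.sqrt : A))
    rw [Pos.starMul_sqrt] at h1
    refine le_of_forall_lt fun c hc => ?_
    obtain ⟨e, he⟩ := (h1.eventually (τ.2.2.1 x c hc)).exists
    exact he.trans_le (le_iSup (fun e : PedBall A => τ (e.1.conj (x.sqrt : A))) e)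
  · refine τ.2.1.mono ((Pos.conj_le _ _ e.2.2.le).trans_eq ?_)
    rw [Pos.starMul_sqrt]

variable (A) in
theorem restrict_injective : Function.Injective (restrict A) := by
  intro σ τ h
  refine Subtype.ext (funext fun x => ?_)
  rw [apply_eq_iSup σ, apply_eq_iSup τ]
  refine iSup_congr fun e => ?_
  have := congrArg (fun t : ℝ≥0 => (t : ℝ≥0∞)) (congrFun h (e.toPed.conj (x.sqrt : A)))
  simp only [coe_restrict] at this
  exact this

variable (A) in
-- A pointwise limit of restrictions is `Reg`, hence again a restriction.
theorem isClosed_range_restrict : IsClosed (Set.range (restrict A)) := by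
  refine isClosed_of_closure_subset fun φ hφ => ?_
  obtain ⟨l, hl, hl'⟩ := mem_closure_iff_comap_neBot.1 hφ |> fun h => (⟨_, h, tendsto_comap⟩ :
    ∃ l : Filter (Set.range (restrict A)), l.NeBot ∧ Tendsto (fun x => x.1) l (𝓝 φ))
  rw [tendsto_pi_nhds] at hl'
  have : Reg φ := Reg.of_tendsto (l := l) (fun x => by
    obtain ⟨τ, hτ⟩ := x.2
    rw [← hτ]
    exact reg_restrict τ) hl'
  obtain ⟨τ, hτ⟩ := this.exists_ltc
  exact ⟨τ, hτ⟩

theorem ext_of_restrict {σ τ : LTC A} (h : ∀ k, restrict A σ k = restrict A τ k) : σ = τ :=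
  restrict_injective A (funext h)

end LTC

end Extension

/-! ### The lattice order on the cone of traces -/

section Lattice

variable {A : Type*} [NonUnitalCStarAlgebra A] [PartialOrder A] [StarOrderedRing A]

/-- Take `k = y² / (y² + ε²)` and `q` the square root of `y / (y² + ε²)`, so that `q²` replaces the
missing inverse of `y`. The last expression is `(1 - k) y (1 - k)`, given by the function `t ε⁴ /
(t² + ε²)² ≤ ε`. -/
theorem Pos.exists_regularization (y : Pos A) {ε : ℝ} (hε : 0 < ε) :
    ∃ k q : A, star k = k ∧ star q = q ∧ ‖k‖ ≤ 1 ∧ q * q * y = k ∧ y * (q * q) = k ∧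
      q * y * q = k ∧ ‖(y : A) - k * y - y * k + k * y * k‖ ≤ ε := by
  have hy : IsSelfAdjoint (y : A) := IsSelfAdjoint.of_nonneg y.2
  have hpos (t : ℝ) : 0 < t ^ 2 + ε ^ 2 := by positivity
  let fk : ℝ → ℝ := fun t => t ^ 2 / (t ^ 2 + ε ^ 2)
  let fq : ℝ → ℝ := fun t => √(t / (t ^ 2 + ε ^ 2))
  have ck : Continuous fk := by
    simp only [fk]; fun_prop (disch := intro t; exact (hpos t).ne')
  have cq : Continuous fq := by
    simp only [fq]; fun_prop (disch := intro t; exact (hpos t).ne')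
  have k0 : fk 0 = 0 := by simp [fk]
  have q0 : fq 0 = 0 := by simp [fq]
  have hqq (t : ℝ) (ht : 0 ≤ t) : fq t * fq t * t = fk t := by
    simp only [fq, fk]
    rw [Real.mul_self_sqrt (div_nonneg ht (hpos t).le)]
    ring
  have hid : cfcₙ (fun t : ℝ => t) (y : A) = y := cfcₙ_id' ℝ (y : A) hy
  have hspec (t : ℝ) (ht : t ∈ quasispectrum ℝ (y : A)) : 0 ≤ t :=
    quasispectrum_nonneg_of_nonneg (y : A) y.2 t ht
  refine ⟨cfcₙ fk (y : A), cfcₙ fq (y : A), (cfcₙ_predicate fk (y : A)).star_eq,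
    (cfcₙ_predicate fq (y : A)).star_eq, ?_, ?_, ?_, ?_, ?_⟩
  · refine norm_cfcₙ_le fun t _ => ?_
    rw [Real.norm_eq_abs, abs_of_nonneg (by positivity), div_le_one (hpos t)]
    nlinarith [sq_nonneg ε]
  · nth_rewrite 3 [← hid]
    rw [← cfcₙ_mul fq fq (y : A) cq.continuousOn q0 cq.continuousOn q0,
      ← cfcₙ_mul _ _ (y : A) (by fun_prop) (by simp [q0]) (by fun_prop) rfl]
    exact cfcₙ_congr fun t ht => hqq t (hspec t ht)
  · nth_rewrite 1 [← hid]
    rw [← cfcₙ_mul fq fq (y : A) cq.continuousOn q0 cq.continuousOn q0,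
      ← cfcₙ_mul _ _ (y : A) (by fun_prop) rfl (by fun_prop) (by simp [q0])]
    exact cfcₙ_congr fun t ht => by rw [← hqq t (hspec t ht)]; ring
  · nth_rewrite 2 [← hid]
    rw [← cfcₙ_mul fq _ (y : A) cq.continuousOn q0 (by fun_prop) rfl,
      ← cfcₙ_mul _ _ (y : A) (by fun_prop) (by simp) cq.continuousOn q0]
    exact cfcₙ_congr fun t ht => by rw [← hqq t (hspec t ht)]; ring
  · have h : (y : A) - cfcₙ fk (y : A) * y - y * cfcₙ fk (y : A) +
        cfcₙ fk (y : A) * y * cfcₙ fk (y : A) =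
        cfcₙ (fun t => t - fk t * t - t * fk t + fk t * t * fk t) (y : A) := by
      rw [cfcₙ_add _ _ (y : A) (by fun_prop) (by simp [k0]) (by fun_prop) (by simp [k0]),
        cfcₙ_sub _ _ (y : A) (by fun_prop) (by simp [k0]) (by fun_prop) (by simp [k0]),
        cfcₙ_sub _ _ (y : A) (by fun_prop) rfl (by fun_prop) (by simp [k0]),
        cfcₙ_mul (fun t => fk t * t) fk (y : A) (by fun_prop) (by simp) (by fun_prop) k0,
        cfcₙ_mul fk _ (y : A) (by fun_prop) k0 (by fun_prop) rfl,
        cfcₙ_mul (fun t => t) fk (y : A) (by fun_prop) rfl (by fun_prop) k0, hid]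
    rw [h]
    refine norm_cfcₙ_le fun t ht => ?_
    have ht0 := hspec t ht
    have h1 : t - fk t * t - t * fk t + fk t * t * fk t = t * ε ^ 4 / (t ^ 2 + ε ^ 2) ^ 2 := by
      have := (hpos t).ne'
      simp only [fk]
      field_simp
      ring
    rw [h1, Real.norm_eq_abs, abs_of_nonneg (by positivity), div_le_iff₀ (by positivity)]
    have h2 : t * ε ≤ t ^ 2 + ε ^ 2 := by nlinarith [sq_nonneg (t - ε)]
    have h3 : ε ^ 2 ≤ t ^ 2 + ε ^ 2 := by nlinarith [sq_nonneg t]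
    calc t * ε ^ 4 = ε * ((t * ε) * ε ^ 2) := by ring
      _ ≤ ε * ((t ^ 2 + ε ^ 2) * (t ^ 2 + ε ^ 2)) := by
        gcongr
      _ = ε * (t ^ 2 + ε ^ 2) ^ 2 := by ring

theorem Pos.starMul_sqrt_mul (s : Pos A) (x : A) : Pos.starMul ((s.sqrt : A) * x) = s.conj x :=
  Subtype.ext (by
    rw [Pos.coe_starMul, Pos.coe_conj, star_mul, Pos.star_eq, ← s.sqrt_mul_sqrt]
    simp only [mul_assoc])

theorem IsTrace.conj_eq {τ : Pos A → ℝ≥0∞} (hτ : IsTrace τ) (s : Pos A) (x : A) :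
    τ (s.conj x) = τ ((Pos.starMul (star x)).conj (s.sqrt : A)) := by
  rw [← Pos.starMul_sqrt_mul, hτ.tracial]
  congr 1
  refine Subtype.ext ?_
  rw [Pos.coe_starMul, Pos.coe_conj, Pos.coe_starMul, star_star, star_mul, Pos.star_eq]
  simp only [star_star, mul_assoc]

theorem IsTrace.conj_sqrt {τ : Pos A → ℝ≥0∞} (hτ : IsTrace τ) (s w : Pos A) :
    τ (s.conj (w.sqrt : A)) = τ (w.conj (s.sqrt : A)) := by
  rw [hτ.conj_eq, Pos.star_eq, Pos.starMul_sqrt]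

theorem IsTrace.conj_le_self {τ : Pos A → ℝ≥0∞} (hτ : IsTrace τ) (y : Pos A) {k : A}
    (hk : ‖k‖ ≤ 1) : τ (y.conj k) ≤ τ y := by
  rw [hτ.conj_eq]
  calc τ ((Pos.starMul (star k)).conj (y.sqrt : A)) ≤ τ (Pos.starMul (y.sqrt : A)) := by
        refine hτ.mono (Pos.conj_le _ _ ?_)
        rw [Pos.coe_starMul, star_star, CStarRing.norm_self_mul_star]
        exact mul_le_one₀ hk (norm_nonneg _) hk
    _ = τ y := by rw [Pos.starMul_sqrt]

/-- If `x* x = y₁ + y₂`, then the summand `y₁` is approximately of the form `x* s x` with a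
positive contraction `s`, as far as the values of traces are concerned. -/
theorem exists_contraction {σ ψ : Pos A → ℝ≥0∞} (hσ : IsTrace σ) (lψ : LowerSemicontinuous ψ)
    {x : A} {y₁ y₂ : Pos A} (h : Pos.starMul x = y₁ + y₂)
    (hf : ψ y₁ ≠ ∞) {ε : ℝ≥0∞} (hε : ε ≠ 0) :
    ∃ s : Pos A, ‖(s : A)‖ ≤ 1 ∧ σ (s.conj x) ≤ σ y₁ ∧ ψ y₁ ≤ ψ (s.conj x) + ε := by
  have h' : star x * x = y₁ + (y₂ : A) := congrArg Subtype.val h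
  have hy (n : ℕ) := (Pos.starMul x).exists_regularization (ε := 1 / ((n : ℝ) + 1)) (by positivity)
  choose k q hk hq hkn hqy hyq hqyq hlim using hy
  rw [Pos.coe_starMul] at hqy hyq hqyq hlim
  -- That is, `s = x q² y₁ q² x*`. Since `x* x q² = k`, one gets `x* s x = k y₁ k`; and `y₁ ≤ x* x`
  -- gives `s ≤ (x q² x*)²`, where `‖x q² x*‖ = ‖q x* x q‖ = ‖k‖ ≤ 1`.
  let s (n : ℕ) : Pos A := y₁.conj (q n * q n * star x)
  have hsx (n : ℕ) : (s n).conj x = y₁.conj (k n) := by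
    refine Subtype.ext ?_
    simp only [s, Pos.coe_conj, star_mul, star_star, hq, hk]
    calc star x * (x * (q n * q n) * ↑y₁ * (q n * q n * star x)) * x
        = (star x * x * (q n * q n)) * y₁ * (q n * q n * (star x * x)) := by simp only [mul_assoc]
      _ = _ := by rw [hyq, hqy]
  have hsn (n : ℕ) : ‖(s n : A)‖ ≤ 1 := by
    have h1 : (s n : A) ≤ (Pos.starMul x).conj (q n * q n * star x) := by
      refine star_left_conjugate_le_conjugate ?_ _
      rw [Pos.coe_starMul, h']
      exact le_add_of_nonneg_right y₂.2
    refine (CStarAlgebra.norm_le_norm_of_nonneg_of_le (s n).2 h1).trans ?_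
    have h2 : ((Pos.starMul x).conj (q n * q n * star x) : A) =
        star (star (q n * star x) * (q n * star x)) * (star (q n * star x) * (q n * star x)) := by
      simp only [Pos.coe_conj, Pos.coe_starMul, star_mul, star_star, hq, mul_assoc]
    have h3 : ‖star (q n * star x) * (q n * star x)‖ ≤ 1 := by
      rw [CStarRing.norm_star_mul_self, ← CStarRing.norm_self_mul_star]
      have : q n * star x * star (q n * star x) = k n := by
        rw [← hqyq n]
        simp only [star_mul, star_star, hq, mul_assoc]
      rw [this]
      exact hkn n
    rw [h2, CStarRing.norm_star_mul_self]
    exact mul_le_one₀ h3 (norm_nonneg _) h3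
  -- Here `(1 - k) y₁ (1 - k) ≤ (1 - k) x* x (1 - k)`, whose norm tends to zero, so `k √y₁ → √y₁`.
  have hconv : Tendsto (fun n => y₁.conj (k n)) atTop (𝓝 y₁) := by
    have h1 (n : ℕ) : ‖k n * (y₁.sqrt : A) - y₁.sqrt‖ ^ 2 ≤ 1 / ((n : ℝ) + 1) := by
      rw [sq, ← CStarRing.norm_self_mul_star]
      refine le_trans (CStarAlgebra.norm_le_norm_of_nonneg_of_le (mul_star_self_nonneg _) ?_) (hlim n)
      rw [← sub_nonneg]
      have h2 := mul_star_self_nonneg (k n * (y₂.sqrt : A) - y₂.sqrt)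
      have h3 := y₁.sqrt_mul_sqrt
      have h4 := y₂.sqrt_mul_sqrt
      have h5 (y : Pos A) : (k n * (y.sqrt : A) - y.sqrt) * star (k n * (y.sqrt : A) - y.sqrt) =
          y - k n * y - y * k n + k n * y * k n := by
        rw [← y.sqrt_mul_sqrt]
        simp only [star_sub, star_mul, Pos.star_eq, hk]
        noncomm_ring
      rw [h5] at h2 ⊢
      convert h2 using 1
      rw [h']
      noncomm_ring
    have h2 : Tendsto (fun n => k n * (y₁.sqrt : A)) atTop (𝓝 (y₁.sqrt : A)) := by
      rw [tendsto_iff_norm_sub_tendsto_zero]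
      have h3 : Tendsto (fun n : ℕ => √(1 / ((n : ℝ) + 1))) atTop (𝓝 0) := by
        have := (Real.continuous_sqrt.tendsto 0).comp (tendsto_one_div_add_atTop_nhds_zero_nat (𝕜 := ℝ))
        rwa [Real.sqrt_zero] at this
      exact squeeze_zero (fun n => norm_nonneg _) (fun n => Real.le_sqrt_of_sq_le (h1 n)) h3
    rw [tendsto_subtype_rng]
    have h3 := h2.mul h2.star
    rw [Pos.star_eq, Pos.sqrt_mul_sqrt] at h3
    refine h3.congr fun n => ?_
    have h4 := y₁.sqrt_mul_sqrt
    rw [Pos.coe_conj, star_mul, Pos.star_eq, hk, ← h4]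
    simp only [mul_assoc]
  obtain ⟨n, hn⟩ : ∃ n, ψ y₁ ≤ ψ (y₁.conj (k n)) + ε := by
    by_cases h0 : ψ y₁ = 0
    · exact ⟨0, by simp [h0]⟩
    · obtain ⟨n, hn⟩ := (hconv.eventually (lψ y₁ _ (ENNReal.sub_lt_self hf h0 hε))).exists
      exact ⟨n, tsub_le_iff_right.1 hn.le⟩
  refine ⟨s n, hsn n, ?_, ?_⟩
  · rw [hsx]
    exact hσ.conj_le_self y₁ (hkn n)
  · rwa [hsx]

/-- The infimum of two traces. -/
def traceInf (σ ψ : Pos A → ℝ≥0∞) (y : Pos A) : ℝ≥0∞ :=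
  ⨅ p : {p : Pos A × Pos A // p.1 + p.2 = y}, σ p.1.1 + ψ p.1.2

theorem traceInf_le {σ ψ : Pos A → ℝ≥0∞} {y y₁ y₂ : Pos A} (h : y₁ + y₂ = y) :
    traceInf σ ψ y ≤ σ y₁ + ψ y₂ :=
  iInf_le (fun p : {p : Pos A × Pos A // p.1 + p.2 = y} => σ p.1.1 + ψ p.1.2) ⟨(y₁, y₂), h⟩

theorem le_traceInf {σ ψ : Pos A → ℝ≥0∞} {y : Pos A} {c : ℝ≥0∞}
    (h : ∀ y₁ y₂ : Pos A, y₁ + y₂ = y → c ≤ σ y₁ + ψ y₂) : c ≤ traceInf σ ψ y :=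
  le_iInf fun p => h _ _ p.2

theorem traceInf_add_le (σ ψ : Pos A → ℝ≥0∞) (hσ : IsTrace σ) (hψ : IsTrace ψ) (a b : Pos A) :
    traceInf σ ψ (a + b) ≤ traceInf σ ψ a + traceInf σ ψ b := by
  refine ENNReal.le_iInf_add_iInf fun p q => ?_
  rw [add_add_add_comm, ← hσ.add, ← hψ.add]
  refine traceInf_le ?_
  rw [add_add_add_comm, p.2, q.2]

/-- Given `x* x = y₁ + y₂`, choose a contraction `s` with `x* s x` close to `y₁` on traces, and
split `w = √w s √w + v` and `w' = √w' s √w' + v'`. Every trace `τ` has total `τ (√s x x* √s) = τ (x*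
s x)` on the first pieces, so `σ` contributes at most `σ y₁`; cancelling the finite `ψ (x* s x)`
bounds `ψ v + ψ v'` by `ψ y₂ + ε`. The case `w' = 0` gives the trace property of the infimum, and `x
= √(a + b)` its superadditivity. -/
theorem traceInf_add_le_of_mul_star {σ ψ : Pos A → ℝ≥0∞} (hσ : IsTrace σ) (hψ : IsTrace ψ)
    (lψ : LowerSemicontinuous ψ) {x : A} {w w' : Pos A} (h : Pos.starMul (star x) = w + w')
    (hf : ψ (Pos.starMul x) < ∞) :
    traceInf σ ψ w + traceInf σ ψ w' ≤ traceInf σ ψ (Pos.starMul x) := by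
  refine le_traceInf fun y₁ y₂ hy => ENNReal.le_of_forall_pos_le_add fun ε hε _ => ?_
  have hf' : ψ y₁ + ψ y₂ < ∞ := by rwa [← hψ.add, hy]
  obtain ⟨s, hs, hσs, hψs⟩ := exists_contraction (σ := σ) (ψ := ψ) hσ lψ hy.symm
    (ne_top_of_le_ne_top hf'.ne le_self_add) (ε := ε) (by exact_mod_cast hε.ne')
  have hdec (w : Pos A) : ∃ v : Pos A, s.conj (w.sqrt : A) + v = w := by
    have h1 := Pos.conj_le s (w.sqrt : A) hs
    rw [Pos.starMul_sqrt] at h1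
    exact ⟨⟨(w : A) - s.conj (w.sqrt : A), sub_nonneg.2 h1⟩, Subtype.ext (by simp)⟩
  obtain ⟨v, hv⟩ := hdec w
  obtain ⟨v', hv'⟩ := hdec w'
  have hsum {τ : Pos A → ℝ≥0∞} (hτ : IsTrace τ) :
      τ (s.conj (w.sqrt : A)) + τ (s.conj (w'.sqrt : A)) = τ (s.conj x) := by
    rw [hτ.conj_sqrt s w, hτ.conj_sqrt s w', hτ.conj_eq s x, h, ← hτ.add]
    congr 1
    exact Subtype.ext (by simp [Pos.coe_conj, mul_add, add_mul])
  have hψv : ψ v + ψ v' ≤ ψ y₂ + ε := by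
    have h1 : ψ (s.conj x) + (ψ v + ψ v') ≤ ψ (s.conj x) + (ψ y₂ + ε) := by
      calc ψ (s.conj x) + (ψ v + ψ v') = ψ w + ψ w' := by
            rw [← hsum hψ, add_add_add_comm, ← hψ.add, ← hψ.add, hv, hv']
        _ = ψ y₁ + ψ y₂ := by rw [← hψ.add, ← h, ← hψ.tracial, ← hy, hψ.add]
        _ ≤ ψ (s.conj x) + ε + ψ y₂ := by gcongr
        _ = _ := by rw [add_assoc, add_comm (ε : ℝ≥0∞)]
    refine (ENNReal.add_le_add_iff_left ?_).1 h1
    refine ne_top_of_le_ne_top hf.ne (hψ.mono (Pos.conj_le s x hs))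
  calc traceInf σ ψ w + traceInf σ ψ w'
      ≤ (σ (s.conj (w.sqrt : A)) + ψ v) + (σ (s.conj (w'.sqrt : A)) + ψ v') :=
        add_le_add (traceInf_le hv) (traceInf_le hv')
    _ = σ (s.conj x) + (ψ v + ψ v') := by rw [add_add_add_comm, hsum hσ]
    _ ≤ σ y₁ + (ψ y₂ + ε) := add_le_add hσs hψv
    _ = _ := (add_assoc _ _ _).symm

theorem traceInf_zero (σ ψ : Pos A → ℝ≥0∞) (hσ : IsTrace σ) (hψ : IsTrace ψ) :
    traceInf σ ψ 0 = 0 := by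
  refine le_antisymm ((traceInf_le (add_zero (0 : Pos A))).trans_eq ?_) bot_le
  rw [hσ.zero, hψ.zero, add_zero]

theorem traceInf_scale_le {σ ψ : Pos A → ℝ≥0∞} (hσ : IsTrace σ) (hψ : IsTrace ψ) {t : ℝ≥0}
    (ht : t ≠ 0) (y : Pos A) : traceInf σ ψ (y.scale t) ≤ t * traceInf σ ψ y := by
  unfold traceInf
  rw [ENNReal.mul_iInf_of_ne (by exact_mod_cast ht) ENNReal.coe_ne_top]
  refine le_iInf ?_
  rintro ⟨p, rfl⟩
  rw [mul_add, ← hσ.scale, ← hψ.scale]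
  exact traceInf_le (Subtype.ext (by simp [Pos.coe_scale, smul_add]))

theorem traceInf_scale {σ ψ : Pos A → ℝ≥0∞} (hσ : IsTrace σ) (hψ : IsTrace ψ) (t : ℝ≥0)
    (y : Pos A) : traceInf σ ψ (y.scale t) = t * traceInf σ ψ y := by
  rcases eq_or_ne t 0 with rfl | ht
  · have : y.scale 0 = 0 := Subtype.ext (by simp [Pos.coe_scale])
    rw [this, traceInf_zero σ ψ hσ hψ]
    simp
  refine le_antisymm (traceInf_scale_le hσ hψ ht y) ?_
  have h := traceInf_scale_le hσ hψ (inv_ne_zero ht) (y.scale t)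
  have h' : (y.scale t).scale t⁻¹ = y := Subtype.ext (by
    simp only [Pos.coe_scale, smul_smul]
    rw [← NNReal.coe_mul, inv_mul_cancel₀ ht, NNReal.coe_one, one_smul])
  rw [h'] at h
  calc (t : ℝ≥0∞) * traceInf σ ψ y ≤ t * ((t⁻¹ : ℝ≥0) * traceInf σ ψ (y.scale t)) := by gcongr
    _ = _ := by
      rw [← mul_assoc, ← ENNReal.coe_mul, mul_inv_cancel₀ ht, ENNReal.coe_one, one_mul]

namespace LTC

instance : PartialOrder (LTC A) := PartialOrder.lift (restrict A) (restrict_injective A)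

theorem le_iff {σ τ : LTC A} : σ ≤ τ ↔ ∀ k, restrict A σ k ≤ restrict A τ k := Iff.rfl

theorem apply_le {σ τ : LTC A} (h : σ ≤ τ) (x : Pos A) :
    (σ : Pos A → ℝ≥0∞) x ≤ (τ : Pos A → ℝ≥0∞) x := by
  rw [apply_eq_iSup σ, apply_eq_iSup τ]
  refine iSup_mono fun e => ?_
  have := ENNReal.coe_le_coe.2 (h (e.toPed.conj (x.sqrt : A)))
  rw [coe_restrict, coe_restrict] at this
  exact this

/-- `traceInf` is additive and tracial where `ψ` is finite, which includes `K(A)₊`. Its restriction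
is therefore `Reg`, and the lattice infimum is the lower semicontinuous trace extending that
restriction. -/
theorem exists_restrict_eq_traceInf (σ ψ : LTC A) :
    ∃ μ : LTC A, ∀ k, (restrict A μ k : ℝ≥0∞) = traceInf σ ψ k.1 := by
  have hσ := σ.2.1
  have hψ := ψ.2.1
  have hle (x : A) (h : (ψ : Pos A → ℝ≥0∞) (Pos.starMul x) < ∞) :
      traceInf σ ψ (Pos.starMul (star x)) ≤ traceInf σ ψ (Pos.starMul x) := by
    have := traceInf_add_le_of_mul_star hσ hψ ψ.2.2.1 (x := x) (w := Pos.starMul (star x)) (w' := 0)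
      (add_zero _).symm h
    rwa [traceInf_zero _ _ hσ hψ, add_zero] at this
  have hreg : Reg (fun k : PedPos A => traceInf σ ψ k.1) := by
    refine reg_of_finite hψ ψ.lt_top ?_ (fun t a _ => traceInf_scale hσ hψ t a) ?_
    · intro a b ha hb
      refine le_antisymm (traceInf_add_le _ _ hσ hψ a b) ?_
      have h0 := Pos.starMul_sqrt (a + b)
      have := traceInf_add_le_of_mul_star hσ hψ ψ.2.2.1 (x := ((a + b).sqrt : A)) (w := a) (w' := b)
        (by rw [Pos.star_eq, h0]) (by rw [h0, hψ.add]; exact ENNReal.add_lt_top.2 ⟨ha, hb⟩)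
      rwa [h0] at this
    · intro x hx
      refine le_antisymm ?_ (hle x hx)
      have := hle (star x) (by rwa [← hψ.tracial])
      rwa [star_star] at this
  have hfin (k : PedPos A) : traceInf σ ψ k.1 ≠ ∞ :=
    ne_top_of_le_ne_top (ENNReal.add_lt_top.2 ⟨σ.lt_top k, by rw [hψ.zero]; simp⟩).ne
      (traceInf_le (add_zero k.1))
  have hreg' : Reg (fun k : PedPos A => (traceInf σ ψ k.1).toNNReal) := by
    refine Reg.of_coe ?_
    simp only [ENNReal.coe_toNNReal (hfin _)]
    exact hreg
  obtain ⟨μ, hμ⟩ := hreg'.exists_ltc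
  exact ⟨μ, fun k => by rw [hμ, ENNReal.coe_toNNReal (hfin k)]⟩

instance : SemilatticeInf (LTC A) where
  inf σ ψ := (exists_restrict_eq_traceInf σ ψ).choose
  inf_le_left σ ψ := le_iff.2 fun k => by
    rw [← ENNReal.coe_le_coe, (exists_restrict_eq_traceInf σ ψ).choose_spec k]
    refine (traceInf_le (add_zero k.1)).trans_eq ?_
    rw [ψ.2.1.zero, add_zero, coe_restrict]
  inf_le_right σ ψ := le_iff.2 fun k => by
    rw [← ENNReal.coe_le_coe, (exists_restrict_eq_traceInf σ ψ).choose_spec k]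
    refine (traceInf_le (zero_add k.1)).trans_eq ?_
    rw [σ.2.1.zero, zero_add, coe_restrict]
  le_inf χ σ ψ h1 h2 := le_iff.2 fun k => by
    rw [← ENNReal.coe_le_coe, (exists_restrict_eq_traceInf σ ψ).choose_spec k, coe_restrict]
    refine le_traceInf fun y₁ y₂ hy => ?_
    rw [← hy, χ.2.1.add]
    exact add_le_add (apply_le h1 y₁) (apply_le h2 y₂)

/-- The difference of the restrictions is `Reg` by cancellation, so it extends to a trace. -/
theorem exists_add_of_le {σ ψ : LTC A} (h : σ ≤ ψ) : ∃ χ, ψ = σ + χ := by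
  have h1 (k : PedPos A) : restrict A σ k + (restrict A ψ k - restrict A σ k) = restrict A ψ k :=
    add_tsub_cancel_of_le (h k)
  have : Reg (fun k => restrict A ψ k - restrict A σ k) := by
    refine Reg.of_add_left (reg_restrict σ) ?_
    simp only [h1]
    exact reg_restrict ψ
  obtain ⟨χ, hχ⟩ := this.exists_ltc
  refine ⟨χ, ext_of_restrict fun k => ?_⟩
  rw [map_add, Pi.add_apply, hχ, h1]

theorem le_add_right' (σ ψ : LTC A) : σ ≤ σ + ψ := le_iff.2 fun k => by
  rw [map_add]; exact le_self_add

instance : CanonicallyOrderedAdd (LTC A) where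
  exists_add_of_le := exists_add_of_le
  le_self_add := le_add_right'
  le_add_self σ ψ := by rw [add_comm]; exact le_add_right' σ ψ

instance : IsOrderedCancelAddMonoid (LTC A) where
  add_le_add_left σ ψ h χ := le_iff.2 fun k => by
    simp only [map_add, Pi.add_apply]
    exact add_le_add_left (h k) _
  le_of_add_le_add_left σ ψ χ h := le_iff.2 fun k => by
    have := h k
    simp only [map_add, Pi.add_apply] at this
    exact le_of_add_le_add_left this

end LTC

end Lattice

/-! ### Band projections and simultaneous comparison of traces -/

section Band

variable {A : Type*} [NonUnitalCStarAlgebra A] [PartialOrder A] [StarOrderedRing A]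

namespace LTC

theorem smul_le_smul {σ ψ : LTC A} (t : ℝ≥0) (h : σ ≤ ψ) : t • σ ≤ t • ψ := by
  obtain ⟨χ, rfl⟩ := exists_add_of_le h
  rw [smul_add]
  exact le_self_add

theorem map_le_map {B : Type*} [NonUnitalCStarAlgebra B] [PartialOrder B] [StarOrderedRing B]
    (f : LTC A →ₗ[ℝ≥0] LTC B) {σ ψ : LTC A} (h : σ ≤ ψ) : f σ ≤ f ψ := by
  obtain ⟨χ, rfl⟩ := exists_add_of_le h
  rw [map_add]
  exact le_self_add

theorem smul_le_smul_right {s t : ℝ≥0} (h : s ≤ t) (σ : LTC A) : s • σ ≤ t • σ := by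
  obtain ⟨r, rfl⟩ := le_iff_exists_add.1 h
  rw [add_smul]
  exact le_self_add

theorem add_inf (a b c : LTC A) : a + b ⊓ c = (a + b) ⊓ (a + c) := by
  refine le_antisymm (le_inf (add_le_add_right inf_le_left a) (add_le_add_right inf_le_right a)) ?_
  obtain ⟨w, hw⟩ := exists_add_of_le (σ := a) (ψ := (a + b) ⊓ (a + c))
    (le_inf le_self_add le_self_add)
  have h1 : a + w ≤ a + b := hw ▸ inf_le_left
  have h2 : a + w ≤ a + c := hw ▸ inf_le_right
  rw [hw]
  exact add_le_add_right (le_inf (le_of_add_le_add_left h1) (le_of_add_le_add_left h2)) a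

theorem add_inf_le (x y z : LTC A) : (x + y) ⊓ z ≤ x ⊓ z + y ⊓ z := by
  rw [add_inf, add_comm (x ⊓ z) y, add_comm (x ⊓ z) z, add_inf, add_inf]
  refine le_inf (le_inf ?_ ?_) (le_inf ?_ ?_)
  · rw [add_comm y x]; exact inf_le_left
  · exact inf_le_right.trans le_add_self
  · exact inf_le_right.trans le_self_add
  · exact inf_le_right.trans le_self_add

/-- The pointwise supremum on `K(A)₊` is a finite pointwise limit, hence `Reg`. -/
theorem exists_isLUB {u : ℕ → LTC A} (hu : Monotone u) {ψ : LTC A} (h : ∀ n, u n ≤ ψ) :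
    ∃ μ, IsLUB (Set.range u) μ := by
  have hb (k : PedPos A) : BddAbove (Set.range fun n => restrict A (u n) k) :=
    ⟨restrict A ψ k, by rintro _ ⟨n, rfl⟩; exact h n k⟩
  have ht (k : PedPos A) := tendsto_atTop_ciSup (fun m n hmn => hu hmn k) (hb k)
  obtain ⟨μ, hμ⟩ := (Reg.of_tendsto (fun n => reg_restrict (u n)) ht).exists_ltc
  refine ⟨μ, ?_, ?_⟩
  · rintro _ ⟨n, rfl⟩
    refine le_iff.2 fun k => ?_
    rw [hμ]
    exact le_ciSup (hb k) n
  · intro χ hχ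
    refine le_iff.2 fun k => ?_
    rw [hμ]
    exact ciSup_le fun n => hχ ⟨n, rfl⟩ k

theorem monotone_inf_nsmul (θ ψ : LTC A) : Monotone fun n : ℕ => ψ ⊓ n • θ := fun _ _ h =>
  inf_le_inf le_rfl (nsmul_le_nsmul_left zero_le h)

/-- The component of `ψ` in the band generated by `θ`. -/
def band (θ ψ : LTC A) : LTC A :=
  (exists_isLUB (monotone_inf_nsmul θ ψ) fun _ => inf_le_left).choose

theorem isLUB_band (θ ψ : LTC A) : IsLUB (Set.range fun n : ℕ => ψ ⊓ n • θ) (band θ ψ) :=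
  (exists_isLUB (monotone_inf_nsmul θ ψ) fun _ => inf_le_left).choose_spec

theorem inf_le_band (θ ψ : LTC A) (n : ℕ) : ψ ⊓ n • θ ≤ band θ ψ := (isLUB_band θ ψ).1 ⟨n, rfl⟩

theorem band_le {θ ψ χ : LTC A} (h : ∀ n : ℕ, ψ ⊓ n • θ ≤ χ) : band θ ψ ≤ χ :=
  (isLUB_band θ ψ).2 (by rintro _ ⟨n, rfl⟩; exact h n)

theorem band_le_self (θ ψ : LTC A) : band θ ψ ≤ ψ := band_le fun _ => inf_le_left

/-- Adding a fixed trace commutes with the supremum defining the band component; cancellation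
reduces this to `band_le`. -/
theorem band_add_le {θ ψ χ ρ : LTC A} (h : ∀ n : ℕ, ψ ⊓ n • θ + χ ≤ ρ) : band θ ψ + χ ≤ ρ := by
  obtain ⟨d, rfl⟩ := exists_add_of_le (σ := χ) (ψ := ρ) (le_trans le_add_self (h 0))
  rw [add_comm]
  refine add_le_add_right (band_le fun n => ?_) χ
  have := h n
  rw [add_comm] at this
  exact le_of_add_le_add_left this

theorem band_add (θ x y : LTC A) : band θ (x + y) = band θ x + band θ y := by
  refine le_antisymm (band_le fun n => (add_inf_le _ _ _).trans
    (add_le_add (inf_le_band θ x n) (inf_le_band θ y n))) (band_add_le fun n => ?_)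
  rw [add_comm]
  refine band_add_le fun m => ?_
  -- `x ⊓ m θ + y ⊓ n θ` lies below `(x + y) ⊓ (m + n) θ`.
  refine le_trans (le_inf ?_ ?_) (inf_le_band θ (x + y) (m + n))
  · rw [add_comm x y]
    exact add_le_add inf_le_left inf_le_left
  · rw [add_smul]
    exact add_le_add inf_le_right inf_le_right

theorem band_smul_le (θ ψ : LTC A) {t : ℝ≥0} (ht : t ≠ 0) : band θ (t • ψ) ≤ t • band θ ψ := by
  refine band_le fun n => ?_
  -- With `m ≥ n / t`, scaling `t ψ ⊓ n θ` by `t⁻¹` lands below `ψ ⊓ m θ`.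
  obtain ⟨m, hm⟩ := exists_nat_ge (t⁻¹ * n)
  have h1 : t⁻¹ • ((t • ψ) ⊓ n • θ) ≤ ψ ⊓ m • θ := by
    refine le_inf ?_ ?_
    · refine (smul_le_smul t⁻¹ inf_le_left).trans_eq ?_
      rw [smul_smul, inv_mul_cancel₀ ht, one_smul]
    · refine (smul_le_smul t⁻¹ inf_le_right).trans ?_
      rw [← Nat.cast_smul_eq_nsmul ℝ≥0 n, ← Nat.cast_smul_eq_nsmul ℝ≥0 m, smul_smul]
      exact smul_le_smul_right hm θ
  calc (t • ψ) ⊓ n • θ = t • t⁻¹ • ((t • ψ) ⊓ n • θ) := by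
        rw [smul_smul, mul_inv_cancel₀ ht, one_smul]
    _ ≤ t • band θ ψ := smul_le_smul t (h1.trans (inf_le_band θ ψ m))

theorem band_smul (θ ψ : LTC A) (t : ℝ≥0) : band θ (t • ψ) = t • band θ ψ := by
  rcases eq_or_ne t 0 with rfl | ht
  · rw [zero_smul, zero_smul]
    exact le_antisymm (band_le_self _ _) zero_le
  refine le_antisymm (band_smul_le θ ψ ht) ?_
  have h := band_smul_le θ (t • ψ) (inv_ne_zero ht)
  rw [smul_smul, inv_mul_cancel₀ ht, one_smul] at h
  calc t • band θ ψ ≤ t • t⁻¹ • band θ (t • ψ) := smul_le_smul t h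
    _ = _ := by rw [smul_smul, mul_inv_cancel₀ ht, one_smul]

/-- The projection onto the band generated by `θ`. -/
def bandProj (θ : LTC A) : LTC A →ₗ[ℝ≥0] LTC A where
  toFun := band θ
  map_add' := band_add θ
  map_smul' t ψ := band_smul θ ψ t

/-- The complement of the band projection. -/
def bandCompl (θ : LTC A) : LTC A →ₗ[ℝ≥0] LTC A where
  toFun ψ := (exists_add_of_le (band_le_self θ ψ)).choose
  map_add' x y := by
    have hx := (exists_add_of_le (band_le_self θ x)).choose_spec
    have hy := (exists_add_of_le (band_le_self θ y)).choose_spec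
    have hxy := (exists_add_of_le (band_le_self θ (x + y))).choose_spec
    refine add_left_cancel (a := band θ (x + y)) (hxy.symm.trans ?_)
    conv_lhs => rw [hx, hy]
    rw [band_add, add_add_add_comm]
  map_smul' t x := by
    have hx := (exists_add_of_le (band_le_self θ x)).choose_spec
    have hxy := (exists_add_of_le (band_le_self θ (t • x))).choose_spec
    refine add_left_cancel (a := band θ (t • x)) (hxy.symm.trans ?_)
    conv_lhs => rw [hx]
    rw [band_smul, smul_add, RingHom.id_apply]

theorem bandProj_add_bandCompl (θ ψ : LTC A) : bandProj θ ψ + bandCompl θ ψ = ψ :=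
  (exists_add_of_le (band_le_self θ ψ)).choose_spec.symm

/-- Any two traces can be compared after cutting by a pair of complementary projections. -/
theorem exists_cut (σ σ' : LTC A) : ∃ P P' : LTC A →ₗ[ℝ≥0] LTC A,
    (∀ ψ, P ψ + P' ψ = ψ) ∧ P σ' ≤ P σ ∧ P' σ ≤ P' σ' := by
  -- After removing `σ ⊓ σ'`, the remainders `θ` of `σ` and `θ'` of `σ'` are disjoint. The band
  -- projection of `θ` fixes `θ` and kills `θ'`, so on that band `σ'` is below `σ`, and on the
  -- complement the order is reversed.
  obtain ⟨θ, hθ⟩ := exists_add_of_le (inf_le_left : σ ⊓ σ' ≤ σ)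
  obtain ⟨θ', hθ'⟩ := exists_add_of_le (inf_le_right : σ ⊓ σ' ≤ σ')
  have hdis : θ' ⊓ θ = 0 := by
    have h1 : σ ⊓ σ' + θ' ⊓ θ ≤ σ ⊓ σ' := by
      refine le_inf ?_ ?_
      · conv_rhs => rw [hθ]
        exact add_le_add_right inf_le_right _
      · conv_rhs => rw [hθ']
        exact add_le_add_right inf_le_left _
    refine le_antisymm ?_ zero_le
    rw [← add_zero (σ ⊓ σ')] at h1
    refine le_of_add_le_add_left (a := σ ⊓ σ') ?_
    simpa using h1
  have hn (n : ℕ) : θ' ⊓ n • θ = 0 := by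
    induction n with
    | zero => rw [zero_smul]; exact le_antisymm inf_le_right zero_le
    | succ n ih =>
      refine le_antisymm ?_ zero_le
      rw [succ_nsmul, inf_comm]
      refine (add_inf_le _ _ _).trans ?_
      rw [inf_comm, ih, inf_comm, hdis, add_zero]
  have h1 : bandProj θ θ' = 0 := le_antisymm (band_le fun n => (hn n).le) zero_le
  have h2 : bandProj θ θ = θ := le_antisymm (band_le_self _ _) (by
    have := inf_le_band θ θ 1
    rwa [one_smul, inf_idem] at this)
  refine ⟨bandProj θ, bandCompl θ, bandProj_add_bandCompl θ, ?_, ?_⟩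
  · conv_lhs => rw [hθ', map_add, h1, add_zero]
    exact map_le_map _ inf_le_left
  · have h3 : bandCompl θ θ = 0 := by
      have := bandProj_add_bandCompl θ θ
      rw [h2] at this
      exact add_left_cancel (this.trans (add_zero θ).symm)
    conv_lhs => rw [hθ, map_add, h3, add_zero]
    exact map_le_map _ inf_le_right

/-- Finitely many pairs of traces can be compared simultaneously after cutting by a finite
partition. -/
theorem exists_partition (L : List (LTC A × LTC A)) :
    ∃ (n : ℕ) (Q : Fin n → LTC A →ₗ[ℝ≥0] LTC A), (∀ ψ, ∑ i, Q i ψ = ψ) ∧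
      ∀ i, ∀ p ∈ L, Q i p.1 ≤ Q i p.2 ∨ Q i p.2 ≤ Q i p.1 := by
  suffices h : ∃ (J : Type) (_ : Fintype J) (Q : J → LTC A →ₗ[ℝ≥0] LTC A),
      (∀ ψ, ∑ i, Q i ψ = ψ) ∧ ∀ i, ∀ p ∈ L, Q i p.1 ≤ Q i p.2 ∨ Q i p.2 ≤ Q i p.1 by
    obtain ⟨J, _, Q, hQ, hL⟩ := h
    refine ⟨Fintype.card J, fun i => Q ((Fintype.equivFin J).symm i), fun ψ => ?_,
      fun i => hL _⟩
    rw [(Fintype.equivFin J).symm.sum_comp fun j => Q j ψ, hQ]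
  induction L with
  | nil => exact ⟨Unit, inferInstance, fun _ => LinearMap.id, by simp, by simp⟩
  | cons p L ih =>
    obtain ⟨J, _, Q, hQ, hL⟩ := ih
    have hcut (j : J) := exists_cut (Q j p.1) (Q j p.2)
    choose P P' hP h1 h2 using hcut
    -- Each piece is cut in two by the comparison for the new pair. Earlier comparisons persist
    -- because the cuts are additive, hence monotone.
    refine ⟨J ⊕ J, inferInstance, Sum.elim (fun j => P j ∘ₗ Q j) (fun j => P' j ∘ₗ Q j),
      fun ψ => ?_, ?_⟩
    · rw [Fintype.sum_sum_type, ← Finset.sum_add_distrib]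
      simp [hP, hQ]
    · rintro (j | j) q hq
      · rcases List.mem_cons.1 hq with rfl | hq
        · exact Or.inr (h1 j)
        · exact (hL j q hq).imp (map_le_map (P j)) (map_le_map (P j))
      · rcases List.mem_cons.1 hq with rfl | hq
        · exact Or.inl (h2 j)
        · exact (hL j q hq).imp (map_le_map (P' j)) (map_le_map (P' j))

end LTC

end Band

/-! ### Elementary tensors in the completion -/

section TensorBasics

variable {A₁ A₂ C : Type*}
  [NonUnitalCStarAlgebra A₁] [PartialOrder A₁] [StarOrderedRing A₁]
  [NonUnitalCStarAlgebra A₂] [PartialOrder A₂] [StarOrderedRing A₂]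
  [NonUnitalCStarAlgebra C] [PartialOrder C] [StarOrderedRing C]
  (ι : A₁ ⊗[ℂ] A₂ →⋆ₙₐ[ℂ] C)

theorem map_tmul_mul (a a' : A₁) (b b' : A₂) :
    ι (a ⊗ₜ[ℂ] b) * ι (a' ⊗ₜ[ℂ] b') = ι ((a * a') ⊗ₜ[ℂ] (b * b')) := by
  rw [← map_mul, Algebra.TensorProduct.tmul_mul_tmul]

theorem star_map_tmul (a : A₁) (b : A₂) : star (ι (a ⊗ₜ[ℂ] b)) = ι (star a ⊗ₜ[ℂ] star b) := by
  rw [← map_star, TensorProduct.star_tmul]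

theorem map_real_smul_tmul (t : ℝ) (a : A₁) (b : A₂) :
    ι ((t • a) ⊗ₜ[ℂ] b) = t • ι (a ⊗ₜ[ℂ] b) := by
  rw [← Complex.coe_smul, ← Complex.coe_smul, ← TensorProduct.smul_tmul', map_smul]

theorem map_tmul_real_smul (t : ℝ) (a : A₁) (b : A₂) :
    ι (a ⊗ₜ[ℂ] (t • b)) = t • ι (a ⊗ₜ[ℂ] b) := by
  rw [← Complex.coe_smul, ← Complex.coe_smul, TensorProduct.tmul_smul, map_smul]

namespace Pos

theorem coe_tmul (a : Pos A₁) (b : Pos A₂) : (tmul ι a b : C) = ι ((a : A₁) ⊗ₜ[ℂ] (b : A₂)) := rfl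

theorem add_tmul (a a' : Pos A₁) (b : Pos A₂) : tmul ι (a + a') b = tmul ι a b + tmul ι a' b :=
  Subtype.ext (by simp [coe_tmul, TensorProduct.add_tmul])

theorem tmul_add (a : Pos A₁) (b b' : Pos A₂) : tmul ι a (b + b') = tmul ι a b + tmul ι a b' :=
  Subtype.ext (by simp [coe_tmul, TensorProduct.tmul_add])

theorem scale_tmul (t : ℝ≥0) (a : Pos A₁) (b : Pos A₂) :
    tmul ι (a.scale t) b = (tmul ι a b).scale t :=
  Subtype.ext (by simp only [coe_tmul, coe_scale, map_real_smul_tmul])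

theorem tmul_scale (t : ℝ≥0) (a : Pos A₁) (b : Pos A₂) :
    tmul ι a (b.scale t) = (tmul ι a b).scale t :=
  Subtype.ext (by simp only [coe_tmul, coe_scale, map_tmul_real_smul])

theorem conj_tmul (a : Pos A₁) (b : Pos A₂) (u : A₁) (v : A₂) :
    (tmul ι a b).conj (ι (u ⊗ₜ[ℂ] v)) = tmul ι (a.conj u) (b.conj v) :=
  Subtype.ext (by simp only [coe_conj, coe_tmul, star_map_tmul, map_tmul_mul])

theorem starMul_tmul (u : A₁) (v : A₂) :
    starMul (ι (u ⊗ₜ[ℂ] v)) = tmul ι (starMul u) (starMul v) :=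
  Subtype.ext (by simp only [coe_starMul, coe_tmul, star_map_tmul, map_tmul_mul])

theorem exists_eq_add {A : Type*} [NonUnitalCStarAlgebra A] [PartialOrder A] [StarOrderedRing A]
    {a b : Pos A} (h : a ≤ b) : ∃ c, b = a + c :=
  ⟨⟨(b : A) - a, sub_nonneg.2 h⟩, Subtype.ext (by simp)⟩

theorem tmul_le_tmul {a a' : Pos A₁} {b b' : Pos A₂} (ha : a ≤ a') (hb : b ≤ b') :
    tmul ι a b ≤ tmul ι a' b' := by
  obtain ⟨c, rfl⟩ := exists_eq_add ha
  obtain ⟨d, rfl⟩ := exists_eq_add hb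
  rw [tmul_add, add_tmul, add_assoc]
  exact le_add_of_nonneg_right (add_nonneg (tmul ι c b).2 (tmul ι (a + c) d).2)

end Pos

/-- Tensoring with a fixed positive element, as a positive linear map. -/
def tmulLeft (b : Pos A₂) : A₁ →ₚ[ℂ] C :=
  PositiveLinearMap.mk₀
    { toFun := fun a => ι (a ⊗ₜ[ℂ] (b : A₂))
      map_add' := fun a a' => by rw [TensorProduct.add_tmul, map_add]
      map_smul' := fun c a => by rw [← TensorProduct.smul_tmul', map_smul]; rfl }
    fun a ha => (Pos.tmul ι ⟨a, ha⟩ b).2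

theorem exists_norm_tmul_le (b : Pos A₂) :
    ∃ M : ℝ≥0, ∀ a : A₁, ‖ι (a ⊗ₜ[ℂ] (b : A₂))‖ ≤ M * ‖a‖ :=
  (tmulLeft ι b).exists_norm_apply_le

theorem Pos.starMul_le_self {A : Type*} [NonUnitalCStarAlgebra A] [PartialOrder A]
    [StarOrderedRing A] {a : Pos A} (ha : ‖(a : A)‖ ≤ 1) : starMul (a : A) ≤ a := by
  have h := Pos.conj_le a a.sqrt ha
  have h1 : (a.conj a.sqrt : A) = star (a : A) * a := by
    rw [Pos.coe_conj, Pos.star_eq, Pos.star_eq]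
    conv_rhs => rw [← a.sqrt_mul_sqrt]
    conv_lhs => enter [1, 2]; rw [← a.sqrt_mul_sqrt]
    simp only [mul_assoc]
  rw [h1, Pos.starMul_sqrt] at h
  exact h

theorem norm_starMul {A : Type*} [NonUnitalCStarAlgebra A] [PartialOrder A]
    [StarOrderedRing A] (x : A) : ‖(Pos.starMul x : A)‖ = ‖x‖ ^ 2 := by
  rw [Pos.coe_starMul, CStarRing.norm_star_mul_self, sq]

/-- For fixed `b` the map `a ↦ a ⊗ b` is positive, hence bounded by some `M`. Squaring repeatedly
and using the C*-identity gives `‖a ⊗ b‖ ^ (2 ^ n) ≤ M` for all `n`, which forces the norm to be at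
most one. The induction runs over all `b' ≤ b` because squaring a contraction makes it smaller, so
that the same `M` serves throughout. -/
theorem norm_tmul_le_one {a : Pos A₁} {b : Pos A₂} (ha : ‖(a : A₁)‖ ≤ 1) (hb : ‖(b : A₂)‖ ≤ 1) :
    ‖(Pos.tmul ι a b : C)‖ ≤ 1 := by
  obtain ⟨M, hM⟩ := exists_norm_tmul_le ι b
  have key : ∀ n : ℕ, ∀ (a : Pos A₁) (b' : Pos A₂), ‖(a : A₁)‖ ≤ 1 → ‖(b' : A₂)‖ ≤ 1 → b' ≤ b →
      ‖(Pos.tmul ι a b' : C)‖ ^ (2 ^ n) ≤ M := by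
    intro n
    induction n with
    | zero =>
      intro a b' ha hb' h
      rw [pow_zero, pow_one]
      refine (CStarAlgebra.norm_le_norm_of_nonneg_of_le (Pos.tmul ι a b').2
        (Pos.tmul_le_tmul ι le_rfl h)).trans ((hM a).trans ?_)
      exact mul_le_of_le_one_right M.2 ha
    | succ n ih =>
      intro a b' ha hb' h
      rw [pow_succ', pow_mul, ← norm_starMul]
      rw [Pos.coe_tmul, Pos.starMul_tmul]
      refine ih _ _ ?_ ?_ ((Pos.starMul_le_self hb').trans h)
      · rw [norm_starMul]; exact pow_le_one₀ (norm_nonneg _) ha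
      · rw [norm_starMul]; exact pow_le_one₀ (norm_nonneg _) hb'
  by_contra! hlt
  obtain ⟨n, hn⟩ := pow_unbounded_of_one_lt (M : ℝ) hlt
  have h1 := key n a b ha hb le_rfl
  exact absurd (hn.trans_le (pow_le_pow_right₀ hlt.le Nat.lt_two_pow_self.le)) (not_lt.2 h1)

theorem norm_pos_tmul_le (a : Pos A₁) (b : Pos A₂) :
    ‖(Pos.tmul ι a b : C)‖ ≤ ‖(a : A₁)‖ * ‖(b : A₂)‖ := by
  rcases eq_or_ne (a : A₁) 0 with ha | ha
  · simp [Pos.coe_tmul, ha]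
  rcases eq_or_ne (b : A₂) 0 with hb | hb
  · simp [Pos.coe_tmul, hb]
  have h := norm_tmul_le_one ι (a := a.scale ‖(a : A₁)‖₊⁻¹) (b := b.scale ‖(b : A₂)‖₊⁻¹)
    (by simp [Pos.coe_scale, norm_smul, ha]) (by simp [Pos.coe_scale, norm_smul, hb])
  rw [Pos.scale_tmul, Pos.tmul_scale, Pos.coe_scale, Pos.coe_scale, norm_smul, norm_smul] at h
  simp only [NNReal.coe_inv, coe_nnnorm, norm_inv, norm_norm] at h
  have ha' := norm_pos_iff.2 ha
  have hb' := norm_pos_iff.2 hb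
  rw [← mul_assoc, ← mul_inv, inv_mul_le_iff₀ (by positivity), mul_one] at h
  exact h

theorem norm_tmul_le (a : A₁) (b : A₂) : ‖ι (a ⊗ₜ[ℂ] b)‖ ≤ ‖a‖ * ‖b‖ := by
  rw [← sq_le_sq₀ (norm_nonneg _) (by positivity), ← norm_starMul, Pos.starMul_tmul, mul_pow,
    ← norm_starMul, ← norm_starMul]
  exact norm_pos_tmul_le ι _ _

variable {ι}

theorem IsTensorCompletion.tmul_ne_zero {β : CStarNorm A₁ A₂} (hι : IsTensorCompletion β ι) {a : A₁}
    {b : A₂} (ha : a ≠ 0) (hb : b ≠ 0) : ι (a ⊗ₜ[ℂ] b) ≠ 0 := by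
  intro h
  have h0 : a ⊗ₜ[ℂ] b = 0 := β.eq_zero _ (by rw [← hι.norm_map, h, norm_zero])
  obtain ⟨f, hf⟩ : ∃ f : Module.Dual ℂ A₁, f a ≠ 0 := by
    by_contra! hf
    exact ha ((Module.forall_dual_apply_eq_zero_iff ℂ a).1 hf)
  obtain ⟨g, hg⟩ : ∃ f : Module.Dual ℂ A₂, f b ≠ 0 := by
    by_contra! hf
    exact hb ((Module.forall_dual_apply_eq_zero_iff ℂ b).1 hf)
  have := congrArg (fun t => TensorProduct.lid ℂ ℂ (TensorProduct.map f g t)) h0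
  simp [hf, hg] at this

/-- A continuous linear map on the completion is determined by its values at the elementary tensors
of positive elements. -/
theorem IsTensorCompletion.clm_ext {β : CStarNorm A₁ A₂} (hι : IsTensorCompletion β ι)
    {f g : C →L[ℂ] ℂ}
    (h : ∀ (a : Pos A₁) (b : Pos A₂), f (Pos.tmul ι a b) = g (Pos.tmul ι a b)) : f = g := by
  have h2 (a : A₁) (b : A₂) : f (ι (a ⊗ₜ[ℂ] b)) = g (ι (a ⊗ₜ[ℂ] b)) := by
    let T : A₁ →ₗ[ℂ] A₂ →ₗ[ℂ] C :=
      (TensorProduct.mk ℂ A₁ A₂).compr₂ (ι : A₁ ⊗[ℂ] A₂ →ₗ[ℂ] C)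
    have e : T.compr₂ (f : C →ₗ[ℂ] ℂ) = T.compr₂ (g : C →ₗ[ℂ] ℂ) :=
      linearMap_ext_pos fun a => linearMap_ext_pos fun b => h a b
    exact congrArg (fun S => S a b) e
  refine ContinuousLinearMap.ext fun x => ?_
  refine hι.denseRange.induction_on (p := fun x => f x = g x) x
    (isClosed_eq f.continuous g.continuous) fun t => ?_
  induction t with
  | zero => simp
  | tmul a b => exact h2 a b
  | add x y hx hy => rw [map_add, map_add, map_add, hx, hy]

/-- Positive functionals on the completion are determined by their values at the elementary tensors
of positive elements. -/
theorem IsTensorCompletion.posFun_ext {β : CStarNorm A₁ A₂} (hι : IsTensorCompletion β ι)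
    {φ ψ : Pos C → ℝ} (hφ : IsPosFun φ) (hψ : IsPosFun ψ)
    (h : ∀ (a : Pos A₁) (b : Pos A₂), φ (Pos.tmul ι a b) = ψ (Pos.tmul ι a b)) : φ = ψ := by
  have e : hφ.ext = hψ.ext := hι.clm_ext fun a b => by rw [hφ.ext_apply, hψ.ext_apply, h]
  funext x
  rw [hφ.eq_re, hψ.eq_re, e]

variable (ι)

theorem IsPosFun.tmul_left {ω : Pos C → ℝ} (hω : IsPosFun ω) (b : Pos A₂) :
    IsPosFun (fun a : Pos A₁ => ω (Pos.tmul ι a b)) :=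
  ⟨fun _ => hω.nonneg _, fun a a' => by rw [Pos.add_tmul, hω.add],
    fun t a => by rw [Pos.scale_tmul, hω.scale]⟩

theorem IsPosFun.tmul_right {ω : Pos C → ℝ} (hω : IsPosFun ω) (a : Pos A₁) :
    IsPosFun (fun b : Pos A₂ => ω (Pos.tmul ι a b)) :=
  ⟨fun _ => hω.nonneg _, fun a a' => by rw [Pos.tmul_add, hω.add],
    fun t a => by rw [Pos.tmul_scale, hω.scale]⟩

end TensorBasics

/-! ### Quasi-states: compactness, Hahn-Banach and pure functionals -/

section QuasiState

variable {A : Type*} [NonUnitalCStarAlgebra A] [PartialOrder A] [StarOrderedRing A]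

theorem IsPosFun.add_fun {φ ψ : Pos A → ℝ} (hφ : IsPosFun φ) (hψ : IsPosFun ψ) :
    IsPosFun (fun a => φ a + ψ a) :=
  ⟨fun a => add_nonneg (hφ.nonneg a) (hψ.nonneg a),
    fun a b => by rw [hφ.add, hψ.add]; ring, fun t a => by rw [hφ.scale, hψ.scale]; ring⟩

theorem IsPosFun.zero_fun : IsPosFun (fun _ : Pos A => (0 : ℝ)) :=
  ⟨fun _ => le_rfl, fun _ _ => by simp, fun _ _ => by simp⟩

theorem isClosed_isPosFun : IsClosed {φ : Pos A → ℝ | IsPosFun φ} := by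
  have : {φ : Pos A → ℝ | IsPosFun φ} = (⋂ a, {φ : Pos A → ℝ | 0 ≤ φ a}) ∩
      ((⋂ a, ⋂ b, {φ : Pos A → ℝ | φ (a + b) = φ a + φ b}) ∩
        ⋂ t : ℝ≥0, ⋂ a, {φ : Pos A → ℝ | φ (a.scale t) = (t : ℝ) * φ a}) := by
    ext φ
    simp only [Set.mem_ofPred_eq, Set.mem_inter_iff, Set.mem_iInter]
    exact ⟨fun h => ⟨h.nonneg, h.add, h.scale⟩, fun h => ⟨h.1, h.2.1, h.2.2⟩⟩
  rw [this]
  refine (isClosed_iInter fun a => ?_).inter ((isClosed_iInter fun a => isClosed_iInter fun b => ?_).inter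
    (isClosed_iInter fun t => isClosed_iInter fun a => ?_))
  · exact isClosed_le continuous_const (continuous_apply a)
  · exact isClosed_eq (by fun_prop) (by fun_prop)
  · exact isClosed_eq (by fun_prop) (by fun_prop)

variable (A) in
/-- The positive functionals of norm at most one, as functions on the positive cone. -/
def quasiState : Set (Pos A → ℝ) := {φ | IsPosFun φ ∧ ∀ x : Pos A, φ x ≤ ‖(x : A)‖}

theorem isCompact_quasiState : IsCompact (quasiState A) := by
  refine (isCompact_univ_pi fun x : Pos A => isCompact_Icc (a := (0 : ℝ)) (b := ‖(x : A)‖)).of_isClosed_subset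
    ?_ fun φ hφ x _ => ⟨hφ.1.nonneg x, hφ.2 x⟩
  refine isClosed_isPosFun.inter ?_
  change IsClosed {φ : Pos A → ℝ | ∀ x : Pos A, φ x ≤ ‖(x : A)‖}
  rw [Set.ofPred_forall]
  exact isClosed_iInter fun x => isClosed_le (continuous_apply x) continuous_const

theorem convex_quasiState : Convex ℝ (quasiState A) := by
  intro φ hφ ψ hψ s t hs ht hst
  refine ⟨(hφ.1.smul hs).add_fun (hψ.1.smul ht), fun x => ?_⟩
  calc s * φ x + t * ψ x ≤ s * ‖(x : A)‖ + t * ‖(x : A)‖ :=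
        add_le_add (mul_le_mul_of_nonneg_left (hφ.2 x) hs) (mul_le_mul_of_nonneg_left (hψ.2 x) ht)
    _ = ‖(x : A)‖ := by rw [← add_mul, hst, one_mul]

theorem zero_mem_quasiState : (0 : Pos A → ℝ) ∈ quasiState A :=
  ⟨IsPosFun.zero_fun, fun _ => norm_nonneg _⟩

/-- The infimum of the norms of the positive elements above a given selfadjoint element. -/
def normAbove (a : selfAdjoint A) : ℝ := ⨅ p : {p : Pos A // (a : A) ≤ p}, ‖(p.1 : A)‖

instance (a : selfAdjoint A) : Nonempty {p : Pos A // (a : A) ≤ p} :=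
  ⟨⟨⟨(a : A)⁺, CFC.posPart_nonneg _⟩, CFC.le_posPart a.2⟩⟩

theorem normAbove_le {a : selfAdjoint A} {p : Pos A} (h : (a : A) ≤ p) : normAbove a ≤ ‖(p : A)‖ :=
  ciInf_le (f := fun p : {p : Pos A // (a : A) ≤ p} => ‖(p.1 : A)‖)
    ⟨0, by rintro _ ⟨p, rfl⟩; exact norm_nonneg _⟩ ⟨p, h⟩

theorem le_normAbove {a : selfAdjoint A} {c : ℝ} (h : ∀ p : Pos A, (a : A) ≤ p → c ≤ ‖(p : A)‖) :
    c ≤ normAbove a :=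
  le_ciInf fun p => h p.1 p.2

theorem normAbove_smul_le {c : ℝ} (hc : 0 < c) (a : selfAdjoint A) :
    normAbove (c • a) ≤ c * normAbove a := by
  rw [← div_le_iff₀' hc]
  refine le_normAbove fun p hp => ?_
  rw [div_le_iff₀' hc]
  lift c to ℝ≥0 using hc.le
  refine (normAbove_le (p := p.scale c) ?_).trans_eq ?_
  · exact smul_le_smul_of_nonneg_left hp hc.le
  · rw [Pos.coe_scale, norm_smul, Real.norm_of_nonneg hc.le]

theorem normAbove_smul {c : ℝ} (hc : 0 < c) (a : selfAdjoint A) :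
    normAbove (c • a) = c * normAbove a := by
  refine (normAbove_smul_le hc a).antisymm ?_
  have h := normAbove_smul_le (inv_pos.2 hc) (c • a)
  rwa [smul_smul, inv_mul_cancel₀ hc.ne', one_smul, le_inv_mul_iff₀ hc] at h

theorem normAbove_add (a b : selfAdjoint A) : normAbove (a + b) ≤ normAbove a + normAbove b := by
  rw [← sub_le_iff_le_add]
  refine le_normAbove fun p hp => ?_
  rw [sub_le_iff_le_add, ← sub_le_iff_le_add']
  refine le_normAbove fun q hq => ?_
  rw [sub_le_iff_le_add']
  exact (normAbove_le (p := p + q) (add_le_add hp hq)).trans (norm_add_le _ _)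

/-- The norm of a positive element is attained by a positive functional of norm at most one. -/
theorem exists_quasiState_eq_norm (x : Pos A) : ∃ ω ∈ quasiState A, ω x = ‖(x : A)‖ := by
  rcases eq_or_ne (x : A) 0 with hx | hx
  · exact ⟨0, zero_mem_quasiState, by simp [hx]⟩
  let s (p : Pos A) : selfAdjoint A := ⟨p, IsSelfAdjoint.of_nonneg p.2⟩
  have hsx : s x ≠ 0 := fun h => hx (congrArg Subtype.val h)
  -- Domination by the sublinear `normAbove` yields both properties of the extension: `normAbove
  -- (-p) ≤ 0` gives positivity, and `normAbove p ≤ ‖p‖` the norm bound.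
  obtain ⟨g, hg, hgN⟩ := exists_extension_of_le_sublinear
    (LinearPMap.mkSpanSingleton (K := ℝ) (s x) (‖(x : A)‖) hsx) normAbove
    (fun c hc a => normAbove_smul hc a) normAbove_add (by
      rintro ⟨y, hy⟩
      obtain ⟨t, rfl⟩ := Submodule.mem_span_singleton.1 hy
      change LinearPMap.mkSpanSingleton' _ _ _ _ ≤ _
      rw [LinearPMap.mkSpanSingleton'_apply]
      refine le_normAbove fun p hp => ?_
      rcases le_total t 0 with ht | ht
      · exact (mul_nonpos_of_nonpos_of_nonneg ht (norm_nonneg _)).trans (norm_nonneg _)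
      · have h0 : (0 : A) ≤ t • (x : A) := smul_nonneg ht x.2
        have := CStarAlgebra.norm_le_norm_of_nonneg_of_le h0 hp
        rwa [norm_smul, Real.norm_of_nonneg ht] at this)
  refine ⟨fun p => g (s p), ⟨⟨fun p => ?_, fun p q => ?_, fun t p => ?_⟩, fun p => ?_⟩, ?_⟩
  · have h := (hgN (-s p)).trans (normAbove_le (p := 0) (neg_nonpos.2 p.2))
    rw [map_neg] at h
    simpa using h
  · exact map_add g (s p) (s q)
  · exact map_smul g (t : ℝ) (s p)
  · exact (hgN _).trans (normAbove_le le_rfl)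
  · have h := hg ⟨s x, Submodule.mem_span_singleton_self _⟩
    rw [LinearPMap.mkSpanSingleton_apply] at h
    exact h

/-- A continuous linear functional on a product of lines depends on finitely many coordinates. -/
theorem exists_finset_eq_sum {X : Type*} (l : (X → ℝ) →L[ℝ] ℝ) :
    ∃ (F : Finset X) (c : X → ℝ), ∀ χ, l χ = ∑ i ∈ F, c i * χ i := by
  classical
  have h0 : {χ : X → ℝ | |l χ| < 1} ∈ 𝓝 (0 : X → ℝ) := by
    refine (isOpen_lt (by fun_prop) continuous_const).mem_nhds ?_
    simp
  rw [nhds_pi, Filter.mem_pi'] at h0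
  obtain ⟨F, t, ht, hF⟩ := h0
  have hv (χ : X → ℝ) (hχ : ∀ i ∈ F, χ i = 0) : l χ = 0 := by
    by_contra hne
    -- The rescaled function vanishes on `F`, so it lies in the basic neighbourhood, although `l`
    -- takes the value one there.
    have h1 : (l χ)⁻¹ • χ ∈ {χ : X → ℝ | |l χ| < 1} := hF fun i hi => by
      rw [Pi.smul_apply, hχ i hi, smul_zero]
      exact mem_of_mem_nhds (ht i)
    simp [hne] at h1
  refine ⟨F, fun i => l (Pi.single i 1), fun χ => ?_⟩
  have h := hv (χ - ∑ i ∈ F, χ i • Pi.single i (1 : ℝ)) fun j hj => by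
    simp [Finset.sum_apply, Pi.single_apply, hj]
  rw [map_sub, map_sum, sub_eq_zero] at h
  rw [h]
  exact Finset.sum_congr rfl fun i _ => by rw [map_smul, smul_eq_mul, mul_comm]

theorem IsPosFun.sum_scale {φ : Pos A → ℝ} (hφ : IsPosFun φ) (F : Finset (Pos A))
    (c : Pos A → ℝ≥0) : φ (∑ i ∈ F, i.scale (c i)) = ∑ i ∈ F, c i * φ i := by
  classical
  induction F using Finset.induction_on with
  | empty => simp [hφ.zero]
  | insert a s ha ih => rw [Finset.sum_insert ha, Finset.sum_insert ha, hφ.add, ih, hφ.scale]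

/-- A continuous linear functional on the functions on the positive cone acts on the positive
functionals as the evaluation at a difference of positive elements. -/
theorem exists_eval_sub (l : (Pos A → ℝ) →L[ℝ] ℝ) :
    ∃ p q : Pos A, ∀ χ, IsPosFun χ → l χ = χ p - χ q := by
  obtain ⟨F, c, h⟩ := exists_finset_eq_sum l
  refine ⟨∑ i ∈ F, i.scale (c i).toNNReal, ∑ i ∈ F, i.scale (-c i).toNNReal, fun χ hχ => ?_⟩
  rw [h, hχ.sum_scale, hχ.sum_scale, ← Finset.sum_sub_distrib]
  refine Finset.sum_congr rfl fun i _ => ?_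
  rw [← sub_mul, Real.coe_toNNReal', Real.coe_toNNReal', max_zero_sub_max_neg_zero_eq_self]

/-- If a functional of norm at most one exceeds `s` at `p - q`, then `p - q` is larger than `s` on
some nonzero hereditary subalgebra. -/
theorem exists_bump {φ : Pos A → ℝ} (hφ : φ ∈ quasiState A) {p q : Pos A} {s : ℝ} (hs : 0 ≤ s)
    (h : s < φ p - φ q) : ∃ u : Pos A, (u : A) ≠ 0 ∧ ∃ r : ℝ≥0, s < r ∧
      (Pos.starMul (u : A)).scale r + q.conj u ≤ p.conj u := by
  obtain ⟨r, hsr, hr⟩ := exists_between h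
  have hr0 : 0 ≤ r := hs.trans hsr.le
  let k : A := p - q
  have hk : IsSelfAdjoint k := (IsSelfAdjoint.of_nonneg p.2).sub (IsSelfAdjoint.of_nonneg q.2)
  let f : ℝ → ℝ := fun t => max (t - r) 0
  have hf : Continuous f := by fun_prop
  have hf0 : f 0 = 0 := by simp [f, hr0]
  -- Here `u = (k - r)₊` with `k = p - q`. If `u` were zero, then `p ≤ q + k⁺` with `‖k⁺‖ ≤ r`,
  -- contradicting `r < φ p - φ q`. On the support of `u` the spectrum of `k` exceeds `r`, so `u k u
  -- ≥ r u²`.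
  let u : Pos A := ⟨cfcₙ f k, cfcₙ_nonneg fun t _ => le_max_right _ _⟩
  refine ⟨u, fun hu => ?_, ⟨r, hr0⟩, hsr, ?_⟩
  · have hle : ∀ t ∈ quasispectrum ℝ k, t ≤ r := fun t ht => by
      have := norm_apply_le_norm_cfcₙ f k ht hf.continuousOn hf0 hk
      rw [show cfcₙ f k = 0 from hu, norm_zero, norm_le_zero_iff] at this
      have h2 : t - r ≤ f t := le_max_left _ _
      linarith
    let m : Pos A := ⟨k⁺, CFC.posPart_nonneg _⟩
    have hm : ‖(m : A)‖ ≤ r := by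
      change ‖k⁺‖ ≤ r
      rw [CFC.posPart_def]
      refine norm_cfcₙ_le fun t ht => ?_
      rw [Real.norm_of_nonneg (posPart_nonneg t)]
      exact sup_le (hle t ht) hr0
    have hpq : (p : A) ≤ (q + m : Pos A) := by
      rw [Nonneg.coe_add, ← sub_le_iff_le_add']
      exact CFC.le_posPart hk
    have h1 := hφ.1.mono hpq
    rw [hφ.1.add] at h1
    linarith [hφ.2 m]
  · change r • (star (u : A) * u) + star (u : A) * q * u ≤ star (u : A) * p * u
    rw [Pos.star_eq, ← le_sub_iff_add_le, ← sub_mul, ← mul_sub, ← sub_nonneg]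
    have e : cfcₙ (fun t => f t * t * f t - r * (f t * f t)) k =
        (u : A) * (p - q) * u - r • ((u : A) * u) := by
      rw [cfcₙ_sub (fun t => f t * t * f t) (fun t => r * (f t * f t)) k
          (hf0 := by simp [hf0]) (hg0 := by simp [hf0]),
        cfcₙ_mul (fun t => f t * t) f k (hf0 := by simp [hf0]), cfcₙ_mul f (fun t => t) k,
        cfcₙ_const_mul r (fun t => f t * f t) k, cfcₙ_mul f f k, cfcₙ_id' ℝ k]
    rw [← e]
    refine cfcₙ_nonneg fun t _ => ?_
    rcases le_total t r with ht | ht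
    · simp [f, max_eq_right (sub_nonpos.2 ht)]
    · have h1 : 0 ≤ t - r := sub_nonneg.2 ht
      have : f t * t * f t - r * (f t * f t) = (t - r) * (f t * f t) := by ring
      rw [this]
      exact mul_nonneg h1 (mul_self_nonneg _)

/-- Positive functionals below a pure one are multiples of it. -/
theorem exists_eq_mul_of_mem_extremePoints {φ χ : Pos A → ℝ}
    (hφ : φ ∈ (quasiState A).extremePoints ℝ) (hχ : IsPosFun χ) (hle : ∀ x, χ x ≤ φ x) :
    ∃ c, ∀ x, χ x = c * φ x := by
  obtain ⟨hφQ, hext⟩ := mem_extremePoints.1 hφ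
  have hχ' : IsPosFun (fun x => φ x - χ x) :=
    ⟨fun x => sub_nonneg.2 (hle x), fun x y => by rw [hφQ.1.add, hχ.add]; ring,
      fun t x => by rw [hφQ.1.scale, hχ.scale]; ring⟩
  let B := {x : Pos A // ‖(x : A)‖ < 1}
  have hB1 (x : B) : φ x.1 ≤ 1 := (hφQ.2 x.1).trans x.2.le
  let m : ℝ := ⨆ x : B, χ x.1
  have hbdd : BddAbove (Set.range fun x : B => χ x.1) :=
    ⟨1, by rintro _ ⟨x, rfl⟩; exact (hle _).trans (hB1 x)⟩
  have hchi (x : B) : χ x.1 ≤ m := le_ciSup hbdd x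
  have : Nonempty B := ⟨⟨0, by simp⟩⟩
  -- The supremum `m` plays the role of `‖χ‖`. The open unit ball of `A₊` is directed, so
  -- near-optimal elements for `χ` and for `φ - χ` have a common upper bound in it, and the two
  -- norms add up to at most one.
  have hchi' (y : B) : φ y.1 - χ y.1 ≤ 1 - m := by
    rw [le_sub_comm]
    refine ciSup_le fun x => ?_
    obtain ⟨z, hz, hxz, hyz⟩ := CStarAlgebra.directedOn_nonneg_ball (A := A) x.1.1
      ⟨x.1.2, by simpa using x.2⟩ y.1.1 ⟨y.1.2, by simpa using y.2⟩
    let z' : B := ⟨⟨z, hz.1⟩, by simpa using hz.2⟩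
    have h1 := hχ.mono (a := x.1) (b := z'.1) hxz
    have h2 := hχ'.mono (a := y.1) (b := z'.1) hyz
    linarith [hB1 z']
  have hscale {ρ : Pos A → ℝ} (hρ : IsPosFun ρ) {M : ℝ} (hM : ∀ x : B, ρ x.1 ≤ M) (x : Pos A) :
      ρ x ≤ M * ‖(x : A)‖ := by
    have hM0 : 0 ≤ M := (hρ.nonneg _).trans (hM (Classical.arbitrary B))
    have key : ∀ r : ℝ≥0, ‖(x : A)‖ < r → ρ x ≤ M * r := fun r hr => by
      have hr0 : (0 : ℝ) < r := (norm_nonneg _).trans_lt hr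
      have := hM ⟨x.scale r⁻¹, by
        rw [Pos.coe_scale, norm_smul, NNReal.coe_inv, norm_inv, Real.norm_of_nonneg hr0.le,
          inv_mul_lt_iff₀ hr0, mul_one]
        exact hr⟩
      rw [hρ.scale, NNReal.coe_inv, inv_mul_le_iff₀ hr0] at this
      linarith
    refine le_of_forall_pos_le_add fun ε hε => ?_
    have h1 : 0 < ε / (M + 1) := by positivity
    have := key ⟨‖(x : A)‖ + ε / (M + 1), by positivity⟩ (lt_add_of_pos_right _ h1)
    change ρ x ≤ M * (‖(x : A)‖ + ε / (M + 1)) at this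
    rw [mul_add] at this
    refine this.trans ?_
    have h3 : M * (ε / (M + 1)) ≤ ε := by
      rw [← mul_div_assoc, div_le_iff₀ (by positivity)]
      nlinarith
    linarith
  have hm0 : 0 ≤ m := (hχ.nonneg _).trans (hchi (Classical.arbitrary B))
  have hm1 : 0 ≤ 1 - m := (hχ'.nonneg _).trans (hchi' (Classical.arbitrary B))
  rcases hm0.eq_or_lt with h0 | h0
  · refine ⟨0, fun x => ?_⟩
    have := hscale hχ hchi x
    rw [← h0, zero_mul] at this
    rw [zero_mul]
    exact this.antisymm (hχ.nonneg x)
  rcases hm1.eq_or_lt with h1 | h1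
  · refine ⟨1, fun x => ?_⟩
    have := hscale hχ' hchi' x
    rw [← h1, zero_mul] at this
    linarith [hχ'.nonneg x]
  refine ⟨m, fun x => ?_⟩
  -- `φ` is the convex combination of `χ / m` and `(φ - χ) / (1 - m)`, so extremality identifies `χ
  -- / m` with `φ`.
  have h2 := hext (fun x => m⁻¹ * χ x) ⟨hχ.smul (inv_nonneg.2 hm0), fun x => by
      rw [inv_mul_le_iff₀ h0]; exact hscale hχ hchi x⟩
    (fun x => (1 - m)⁻¹ * (φ x - χ x)) ⟨hχ'.smul (inv_nonneg.2 hm1), fun x => by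
      rw [inv_mul_le_iff₀ h1]; exact hscale hχ' hchi' x⟩
    ⟨m, 1 - m, h0, h1, by ring, by
      funext x
      simp only [Pi.add_apply, Pi.smul_apply, smul_eq_mul]
      field_simp
      ring⟩
  have h3 := congrFun h2.1 x
  rw [← h3, mul_inv_cancel_left₀ h0.ne']

end QuasiState

/-! ### Products of positive functionals in an arbitrary C*-norm -/

section ProductFunctional

variable {A₁ A₂ C : Type*}
  [NonUnitalCStarAlgebra A₁] [PartialOrder A₁] [StarOrderedRing A₁]
  [NonUnitalCStarAlgebra A₂] [PartialOrder A₂] [StarOrderedRing A₂]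
  [NonUnitalCStarAlgebra C] [PartialOrder C] [StarOrderedRing C]
  {β : CStarNorm A₁ A₂} {ι : A₁ ⊗[ℂ] A₂ →⋆ₙₐ[ℂ] C}

theorem IsPosFun.conj_le {A : Type*} [NonUnitalCStarAlgebra A] [PartialOrder A] [StarOrderedRing A]
    {ω : Pos A → ℝ} (hω : IsPosFun ω) (x : Pos A) (w : A) :
    ω (x.conj w) ≤ ‖(x : A)‖ * ω (Pos.starMul w) := by
  have h : (x.conj w : A) ≤ (Pos.starMul w).scale ‖(x : A)‖₊ :=
    CStarAlgebra.star_left_conjugate_le_norm_smul (IsSelfAdjoint.of_nonneg x.2)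
  refine (hω.mono h).trans_eq ?_
  rw [hω.scale, coe_nnnorm]

/-- The pairs of a functional on `A₁` and a functional on `C` whose restriction to `A₁` it
dominates, and which is larger than the constant `r` at `p - q` in the second variable. -/
def marginalSet (ι : A₁ ⊗[ℂ] A₂ →⋆ₙₐ[ℂ] C) (r : ℝ) (p q : Pos A₂) :
    Set ((Pos A₁ → ℝ) × (Pos C → ℝ)) :=
  (quasiState A₁ ×ˢ quasiState C) ∩
    ((⋂ (a) (f : Pos A₂), {z | z.2 (Pos.tmul ι a f) ≤ ‖(f : A₂)‖ * z.1 a}) ∩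
      ⋂ a, {z | r * z.1 a + z.2 (Pos.tmul ι a q) ≤ z.2 (Pos.tmul ι a p)})

theorem isCompact_marginalSet (r : ℝ) (p q : Pos A₂) : IsCompact (marginalSet ι r p q) := by
  refine (isCompact_quasiState.prod isCompact_quasiState).inter_right (IsClosed.inter ?_ ?_)
  · exact isClosed_iInter fun a => isClosed_iInter fun f => isClosed_le (by fun_prop) (by fun_prop)
  · exact isClosed_iInter fun a => isClosed_le (by fun_prop) (by fun_prop)

theorem convex_marginalSet (r : ℝ) (p q : Pos A₂) : Convex ℝ (marginalSet ι r p q) := by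
  refine (convex_quasiState.prod convex_quasiState).inter (Convex.inter ?_ ?_)
  · refine convex_iInter fun a => convex_iInter fun f => ?_
    intro z hz w hw s t hs ht _
    have h1 := mul_le_mul_of_nonneg_left (Set.mem_ofPred.1 hz) hs
    have h2 := mul_le_mul_of_nonneg_left (Set.mem_ofPred.1 hw) ht
    change s * z.2 _ + t * w.2 _ ≤ _ * (s * z.1 a + t * w.1 a)
    linarith
  · refine convex_iInter fun a => ?_
    intro z hz w hw s t hs ht _
    have h1 := mul_le_mul_of_nonneg_left (Set.mem_ofPred.1 hz) hs
    have h2 := mul_le_mul_of_nonneg_left (Set.mem_ofPred.1 hw) ht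
    change r * (s * z.1 a + t * w.1 a) + (s * z.2 _ + t * w.2 _) ≤ s * z.2 _ + t * w.2 _
    linarith

theorem zero_mem_marginalSet (r : ℝ) (p q : Pos A₂) : 0 ∈ marginalSet ι r p q := by
  refine ⟨⟨zero_mem_quasiState, zero_mem_quasiState⟩, ?_, ?_⟩ <;> simp

/-- If `p - q` is larger than `r` somewhere in `A₂`, then every functional on `A₁` is the marginal
of a functional on `C` that is larger than `r` at `p - q`. -/
theorem exists_marginal (hι : IsTensorCompletion β ι) {φ : Pos A₁ → ℝ} (hφ : φ ∈ quasiState A₁)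
    {p q v : Pos A₂} (hv : (v : A₂) ≠ 0) {r : ℝ≥0}
    (h : (Pos.starMul (v : A₂)).scale r + q.conj v ≤ p.conj v) :
    ∃ ω ∈ quasiState C, (∀ a (f : Pos A₂), ω (Pos.tmul ι a f) ≤ ‖(f : A₂)‖ * φ a) ∧
      ∀ a, r * φ a + ω (Pos.tmul ι a q) ≤ ω (Pos.tmul ι a p) := by
  suffices hmem : φ ∈ Prod.fst '' marginalSet ι r p q by
    obtain ⟨⟨ρ, ω⟩, ⟨⟨-, hω⟩, h1, h2⟩, rfl⟩ := hmem
    simp only [Set.mem_iInter, Set.mem_ofPred_eq] at h1 h2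
    exact ⟨ω, hω, h1, h2⟩
  by_contra hnot
  obtain ⟨l, s, hl, hs⟩ := geometric_hahn_banach_closed_point
    ((convex_marginalSet r p q).linear_image (LinearMap.fst ℝ _ (Pos C → ℝ)))
    ((isCompact_marginalSet (ι := ι) (r : ℝ) p q).image continuous_fst).isClosed hnot
  obtain ⟨p', q', hl'⟩ := exists_eval_sub l
  have hs0 : 0 ≤ s := by
    have := hl _ ⟨0, zero_mem_marginalSet r p q, rfl⟩
    change l 0 < s at this
    rw [map_zero] at this
    exact this.le
  rw [hl' φ hφ.1] at hs
  obtain ⟨u, hu, r', hr', hu'⟩ := exists_bump hφ hs0 hs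
  -- If `φ` is separated from the attainable marginals by `p' - q'`, a bump `u` in `A₁` detects
  -- this. Compressing by `u ⊗ v` a functional that norms `(u ⊗ v)* (u ⊗ v)`, and dividing by that
  -- norm `N`, gives an attainable marginal `ρ` with `ρ p' - ρ q' ≥ r' > s`, a contradiction.
  obtain ⟨ω₀, hω₀, hN⟩ := exists_quasiState_eq_norm (Pos.starMul (ι ((u : A₁) ⊗ₜ[ℂ] (v : A₂))))
  set N : ℝ := ‖(Pos.starMul (ι ((u : A₁) ⊗ₜ[ℂ] (v : A₂))) : C)‖ with hNdef
  have hN0 : 0 < N := by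
    rw [hNdef, norm_starMul]
    exact pow_pos (norm_pos_iff.2 (hι.tmul_ne_zero hu hv)) 2
  have hNi : 0 ≤ N⁻¹ := (inv_pos.2 hN0).le
  rw [Pos.starMul_tmul] at hN
  have hL := hω₀.1.tmul_left ι (Pos.starMul (v : A₂))
  let ρ : Pos A₁ → ℝ := fun x => N⁻¹ * ω₀ (Pos.tmul ι (x.conj u) (Pos.starMul (v : A₂)))
  let ω : Pos C → ℝ := fun x => N⁻¹ * ω₀ (x.conj (ι ((u : A₁) ⊗ₜ[ℂ] (v : A₂))))
  have hρ : IsPosFun ρ := (hL.comp_conj (u : A₁)).smul hNi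
  have hω : IsPosFun ω := (hω₀.1.comp_conj _).smul hNi
  have hmem : (ρ, ω) ∈ marginalSet ι r p q := by
    refine ⟨⟨⟨hρ, fun x => ?_⟩, ⟨hω, fun x => ?_⟩⟩, ?_, ?_⟩
    · change N⁻¹ * _ ≤ _
      rw [inv_mul_le_iff₀ hN0]
      refine (hL.conj_le x (u : A₁)).trans_eq ?_
      rw [hN, mul_comm]
    · change N⁻¹ * _ ≤ _
      rw [inv_mul_le_iff₀ hN0]
      refine (hω₀.1.conj_le x _).trans_eq ?_
      rw [Pos.starMul_tmul, hN, mul_comm]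
    · simp only [Set.mem_iInter]
      intro a f
      change N⁻¹ * ω₀ ((Pos.tmul ι a f).conj _) ≤ ‖(f : A₂)‖ * (N⁻¹ * _)
      rw [Pos.conj_tmul, mul_left_comm]
      refine mul_le_mul_of_nonneg_left ?_ hNi
      exact (hω₀.1.tmul_right ι (a.conj u)).conj_le f (v : A₂)
    · simp only [Set.mem_iInter]
      intro a
      change r * (N⁻¹ * _) + N⁻¹ * ω₀ ((Pos.tmul ι a q).conj _) ≤
        N⁻¹ * ω₀ ((Pos.tmul ι a p).conj _)
      rw [Pos.conj_tmul, Pos.conj_tmul, mul_left_comm, ← mul_add]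
      refine mul_le_mul_of_nonneg_left ?_ hNi
      have hR := hω₀.1.tmul_right ι (a.conj u)
      have := hR.mono h
      rwa [hR.add, hR.scale] at this
  have h1 := hl _ ⟨_, hmem, rfl⟩
  change l ρ < s at h1
  rw [hl' ρ hρ] at h1
  have h2 := hL.mono hu'
  rw [hL.add, hL.scale] at h2
  have h3 : r' ≤ ρ p' - ρ q' := by
    have h4 := mul_le_mul_of_nonneg_left h2 hNi
    rw [hN, mul_add, mul_left_comm, inv_mul_cancel₀ hN0.ne', mul_one] at h4
    exact le_sub_iff_add_le.2 h4
  linarith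

/-- The triples of functionals on `A₁`, `A₂` and `C` of which the third is the product of the first
two. -/
def prodSet (ι : A₁ ⊗[ℂ] A₂ →⋆ₙₐ[ℂ] C) : Set (((Pos A₁ → ℝ) × (Pos A₂ → ℝ)) × (Pos C → ℝ)) :=
  ((quasiState A₁ ×ˢ quasiState A₂) ×ˢ quasiState C) ∩
    ⋂ (a) (b), {z | z.2 (Pos.tmul ι a b) = z.1.1 a * z.1.2 b}

theorem isCompact_prodSet : IsCompact (prodSet ι) :=
  ((isCompact_quasiState.prod isCompact_quasiState).prod isCompact_quasiState).inter_right
    (isClosed_iInter fun a => isClosed_iInter fun b => isClosed_eq (by fun_prop) (by fun_prop))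

theorem mem_prodSet_iff {φ : Pos A₁ → ℝ} {ψ : Pos A₂ → ℝ} {ω : Pos C → ℝ} :
    ((φ, ψ), ω) ∈ prodSet ι ↔ (φ ∈ quasiState A₁ ∧ ψ ∈ quasiState A₂) ∧ ω ∈ quasiState C ∧
      ∀ a b, ω (Pos.tmul ι a b) = φ a * ψ b := by
  simp [prodSet, and_assoc]

theorem isClosed_image_prodSet : IsClosed (Prod.fst '' prodSet ι) :=
  (isCompact_prodSet.image continuous_fst).isClosed

theorem convex_prodSet_left (ψ : Pos A₂ → ℝ) : Convex ℝ {φ | (φ, ψ) ∈ Prod.fst '' prodSet ι} := by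
  rintro φ ⟨⟨⟨_, _⟩, ω⟩, h, e⟩ φ' ⟨⟨⟨_, _⟩, ω'⟩, h', e'⟩ s t hs ht hst
  obtain ⟨rfl, rfl⟩ := Prod.mk.inj e
  obtain ⟨rfl, e2⟩ := Prod.mk.inj e'
  cases e2
  rw [mem_prodSet_iff] at h h'
  refine ⟨((_, _), s • ω + t • ω'), mem_prodSet_iff.2 ⟨⟨convex_quasiState h.1.1 h'.1.1 hs ht hst,
    h.1.2⟩, convex_quasiState h.2.1 h'.2.1 hs ht hst, fun a b => ?_⟩, rfl⟩
  simp only [Pi.add_apply, Pi.smul_apply, smul_eq_mul, h.2.2, h'.2.2]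
  ring

theorem convex_prodSet_right (φ : Pos A₁ → ℝ) :
    Convex ℝ {ψ | (φ, ψ) ∈ Prod.fst '' prodSet ι} := by
  rintro ψ ⟨⟨⟨_, _⟩, ω⟩, h, e⟩ ψ' ⟨⟨⟨_, _⟩, ω'⟩, h', e'⟩ s t hs ht hst
  obtain ⟨rfl, rfl⟩ := Prod.mk.inj e
  obtain ⟨e2, rfl⟩ := Prod.mk.inj e'
  cases e2
  rw [mem_prodSet_iff] at h h'
  refine ⟨((_, _), s • ω + t • ω'), mem_prodSet_iff.2 ⟨⟨h.1.1, convex_quasiState h.1.2 h'.1.2 hs ht hst⟩,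
    convex_quasiState h.2.1 h'.2.1 hs ht hst, fun a b => ?_⟩, rfl⟩
  simp only [Pi.add_apply, Pi.smul_apply, smul_eq_mul, h.2.2, h'.2.2]
  ring

/-- For fixed pure `φ`, the admissible `ψ` form a compact convex set. A separated `ψ` is detected by
a bump for some `p - q`; the functional `ω` from `exists_marginal` satisfies `ω (a ⊗ f) ≤ ‖f‖ φ a`,
so purity forces `ω (a ⊗ f) = φ a * ψ' f`. Then `ψ'` is admissible but too large at `p - q`. -/
theorem mem_prodSet_of_extreme (hι : IsTensorCompletion β ι) {φ : Pos A₁ → ℝ}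
    (hφ : φ ∈ (quasiState A₁).extremePoints ℝ) {ψ : Pos A₂ → ℝ} (hψ : ψ ∈ quasiState A₂) :
    (φ, ψ) ∈ Prod.fst '' prodSet ι := by
  have hφQ := hφ.1
  by_contra hnot
  have hzero : (φ, (0 : Pos A₂ → ℝ)) ∈ Prod.fst '' prodSet ι :=
    ⟨((φ, 0), 0), mem_prodSet_iff.2 ⟨⟨hφQ, zero_mem_quasiState⟩, zero_mem_quasiState, by simp⟩, rfl⟩
  obtain ⟨l, s, hl, hs⟩ := geometric_hahn_banach_closed_point (convex_prodSet_right φ)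
    ((isClosed_image_prodSet (ι := ι)).preimage (f := fun ψ => (φ, ψ)) (by fun_prop)) hnot
  obtain ⟨p, q, hl'⟩ := exists_eval_sub l
  have hs0 : 0 ≤ s := by
    have := hl 0 hzero
    rw [map_zero] at this
    exact this.le
  rw [hl' ψ hψ.1] at hs
  obtain ⟨v, hv, r, hr, hv'⟩ := exists_bump hψ hs0 hs
  obtain ⟨ω, hω, h1, h2⟩ := exists_marginal hι hφQ hv hv'
  obtain ⟨a₀, ha₀⟩ : ∃ a, φ a ≠ 0 := by
    by_contra! h0
    exact hnot ⟨((φ, ψ), 0), mem_prodSet_iff.2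
      ⟨⟨hφQ, hψ⟩, zero_mem_quasiState, fun a b => by simp [h0]⟩, rfl⟩
  have ha₀' : 0 < φ a₀ := (hφQ.1.nonneg a₀).lt_of_ne' ha₀
  let ψ' : Pos A₂ → ℝ := fun f => (φ a₀)⁻¹ * ω (Pos.tmul ι a₀ f)
  have hψ' : IsPosFun ψ' := (hω.1.tmul_right ι a₀).smul (inv_nonneg.2 ha₀'.le)
  have hmul (a : Pos A₁) (f : Pos A₂) : ω (Pos.tmul ι a f) = φ a * ψ' f := by
    rcases eq_or_ne ‖(f : A₂)‖ 0 with hf | hf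
    · have hz (a : Pos A₁) : ω (Pos.tmul ι a f) = 0 := by
        have := h1 a f
        rw [hf, zero_mul] at this
        exact this.antisymm (hω.1.nonneg _)
      simp [ψ', hz]
    · have hf' : 0 < ‖(f : A₂)‖ := (norm_nonneg _).lt_of_ne' hf
      obtain ⟨c, hc⟩ := exists_eq_mul_of_mem_extremePoints hφ
        ((hω.1.tmul_left ι f).smul (inv_nonneg.2 hf'.le))
        fun x => by rw [inv_mul_le_iff₀ hf']; exact h1 x f
      have hc' (x : Pos A₁) : ω (Pos.tmul ι x f) = ‖(f : A₂)‖ * c * φ x := by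
        have := hc x
        rw [inv_mul_eq_iff_eq_mul₀ hf] at this
        rw [this, mul_assoc]
      simp only [ψ', hc']
      field_simp
  have hψ'Q : ψ' ∈ quasiState A₂ := ⟨hψ', fun f => by
    change (φ a₀)⁻¹ * _ ≤ _
    rw [inv_mul_le_iff₀ ha₀', mul_comm]
    exact h1 a₀ f⟩
  have h3 := hl ψ' ⟨((φ, ψ'), ω), mem_prodSet_iff.2 ⟨⟨hφQ, hψ'Q⟩, hω, hmul⟩, rfl⟩
  rw [hl' ψ' hψ'] at h3
  have h4 := h2 a₀
  rw [hmul, hmul, mul_comm, ← mul_add, mul_le_mul_iff_right₀ ha₀'] at h4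
  linarith

/-- For fixed `ψ`, the admissible `φ` form a closed convex set containing the extreme quasi-states;
Krein-Milman does the rest. -/
theorem mem_prodSet (hι : IsTensorCompletion β ι) {φ : Pos A₁ → ℝ} (hφ : φ ∈ quasiState A₁)
    {ψ : Pos A₂ → ℝ} (hψ : ψ ∈ quasiState A₂) : (φ, ψ) ∈ Prod.fst '' prodSet ι := by
  have h1 := closure_convexHull_extremePoints (isCompact_quasiState (A := A₁)) convex_quasiState
  rw [← h1] at hφ
  exact closure_minimal (convexHull_min (fun φ hφ => mem_prodSet_of_extreme hι hφ hψ)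
    (convex_prodSet_left ψ))
    ((isClosed_image_prodSet (ι := ι)).preimage (f := fun φ => (φ, ψ)) (by fun_prop)) hφ

/-- The product of positive functionals on the factors is defined on the completion in any C*-norm. -/
theorem exists_prod_posFun (hι : IsTensorCompletion β ι) {φ : Pos A₁ → ℝ} (hφ : IsPosFun φ)
    {ψ : Pos A₂ → ℝ} (hψ : IsPosFun ψ) :
    ∃ ω : Pos C → ℝ, IsPosFun ω ∧ ∀ a b, ω (Pos.tmul ι a b) = φ a * ψ b := by
  obtain ⟨M, hM0, hM⟩ := hφ.exists_bound
  obtain ⟨N, hN0, hN⟩ := hψ.exists_bound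
  have hM1 : 0 < M + 1 := by linarith
  have hN1 : 0 < N + 1 := by linarith
  obtain ⟨⟨_, ω⟩, h, rfl⟩ := mem_prodSet hι
    (φ := fun a => (M + 1)⁻¹ * φ a) ⟨hφ.smul (inv_nonneg.2 hM1.le), fun x => by
      rw [inv_mul_le_iff₀ hM1]
      exact (hM x).trans (mul_le_mul_of_nonneg_right (by linarith) (norm_nonneg _))⟩
    (ψ := fun a => (N + 1)⁻¹ * ψ a) ⟨hψ.smul (inv_nonneg.2 hN1.le), fun x => by
      rw [inv_mul_le_iff₀ hN1]
      exact (hN x).trans (mul_le_mul_of_nonneg_right (by linarith) (norm_nonneg _))⟩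
  obtain ⟨-, hω, h2⟩ := mem_prodSet_iff.1 h
  refine ⟨fun x => ((M + 1) * (N + 1)) * ω x, hω.1.smul (by positivity), fun a b => ?_⟩
  change _ * ω _ = _
  rw [h2]
  field_simp

end ProductFunctional

/-! ### Bounded cuts of a trace -/

section CutFun

variable {A : Type*} [NonUnitalCStarAlgebra A] [PartialOrder A] [StarOrderedRing A]

/-- The positive functional `x ↦ τ (√e x √e)`, for `e` in the unit ball of `K(A)₊`. -/
def LTC.cutFun (τ : LTC A) (e : PedBall A) (x : Pos A) : ℝ :=
  LTC.restrict A τ (e.toPed.conj (x.sqrt : A))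

theorem LTC.isPosFun_cutFun (τ : LTC A) (e : PedBall A) : IsPosFun (τ.cutFun e) :=
  τ.reg_restrict.isPosFun _

theorem LTC.cutFun_mono (τ : LTC A) {e f : PedBall A} (h : e ≤ f) (x : Pos A) :
    τ.cutFun e x ≤ τ.cutFun f x :=
  NNReal.coe_le_coe.2 (τ.reg_restrict.mono (a := e.toPed.conj _) (b := f.toPed.conj _)
    (star_left_conjugate_le_conjugate (show (e.1 : A) ≤ f.1 from h) _))

theorem LTC.cutFun_conj (τ : LTC A) (e f : PedBall A) (x : A) :
    τ.cutFun e (f.1.conj x) = τ.cutFun f (e.1.conj (star x)) :=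
  congrArg NNReal.toReal (τ.reg_restrict.apply_conj_sqrt e.toPed f.toPed x)

theorem LTC.iSup_cutFun (τ : LTC A) (x : Pos A) : ⨆ e, ENNReal.ofReal (τ.cutFun e x) = τ x := by
  rw [τ.apply_eq_iSup]
  refine iSup_congr fun e => ?_
  rw [LTC.cutFun, ENNReal.ofReal_coe_nnreal, LTC.coe_restrict]
  rfl

theorem LTC.isPosFun_cutFun_sub (τ : LTC A) {e f : PedBall A} (h : e ≤ f) :
    IsPosFun (fun x => τ.cutFun f x - τ.cutFun e x) :=
  ⟨fun x => sub_nonneg.2 (τ.cutFun_mono h x),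
    fun x y => by rw [(τ.isPosFun_cutFun f).add, (τ.isPosFun_cutFun e).add]; ring,
    fun t x => by rw [(τ.isPosFun_cutFun f).scale, (τ.isPosFun_cutFun e).scale]; ring⟩

/-- The polarized form of `LTC.cutFun_conj`, needed because the symmetry in `C` is checked on sums
of elementary tensors, where mixed terms occur. -/
theorem LTC.ext_cutFun_mul (τ : LTC A) (e f : PedBall A) (x y : A) :
    (τ.isPosFun_cutFun e).ext (star x * (f.1 : A) * y) =
      (τ.isPosFun_cutFun f).ext (y * (e.1 : A) * star x) := by
  refine eq_of_diag (S := fun x y => (τ.isPosFun_cutFun e).ext (star x * (f.1 : A) * y))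
    (T := fun x y => (τ.isPosFun_cutFun f).ext (y * (e.1 : A) * star x))
    ?_ ?_ ?_ ?_ ?_ ?_ ?_ ?_ ?_ x y
  · intro x y z; simp only [star_add, add_mul, map_add]
  · intro x y z; simp only [mul_add, map_add]
  · intro x y; simp [smul_mul_assoc]
  · intro x y; simp [mul_smul_comm]
  · intro x y z; simp only [star_add, mul_add, map_add]
  · intro x y z; simp only [add_mul, map_add]
  · intro x y; simp [mul_smul_comm]
  · intro x y; simp [smul_mul_assoc]
  · intro x
    have h1 := (τ.isPosFun_cutFun e).ext_apply (f.1.conj x)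
    have h2 := (τ.isPosFun_cutFun f).ext_apply (e.1.conj (star x))
    rw [Pos.coe_conj] at h1 h2
    rw [star_star] at h2
    rw [h1, h2, LTC.cutFun_conj]

end CutFun

/-! ### Products of traces -/

section ProductTrace

variable {A₁ A₂ C : Type*}
  [NonUnitalCStarAlgebra A₁] [PartialOrder A₁] [StarOrderedRing A₁]
  [NonUnitalCStarAlgebra A₂] [PartialOrder A₂] [StarOrderedRing A₂]
  [NonUnitalCStarAlgebra C] [PartialOrder C] [StarOrderedRing C]
  {β : CStarNorm A₁ A₂} {ι : A₁ ⊗[ℂ] A₂ →⋆ₙₐ[ℂ] C}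

variable (ι) in
/-- The canonical bilinear map `A₁ × A₂ → C`. -/
def tmulCLM : A₁ →L[ℂ] A₂ →L[ℂ] C :=
  LinearMap.mkContinuous₂ ((TensorProduct.mk ℂ A₁ A₂).compr₂ (ι : A₁ ⊗[ℂ] A₂ →ₗ[ℂ] C)) 1
    fun a b => by rw [one_mul]; exact norm_tmul_le ι a b

variable (ι) in
theorem continuous_tmul : Continuous fun p : A₁ × A₂ => ι (p.1 ⊗ₜ[ℂ] p.2) :=
  (tmulCLM ι).continuous₂

/-- The convergence is clear on elementary tensors, and the bound `‖e ⊗ f‖ ≤ 1` carries it to the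
completion. -/
theorem tendsto_pedBall_tmul_mul (hι : IsTensorCompletion β ι) (x : C) :
    Tendsto (fun p : PedBall A₁ × PedBall A₂ => (Pos.tmul ι p.1.1 p.2.1 : C) * x) atTop (𝓝 x) := by
  have h1 (t : A₁ ⊗[ℂ] A₂) : Tendsto
      (fun p : PedBall A₁ × PedBall A₂ => (Pos.tmul ι p.1.1 p.2.1 : C) * ι t) atTop (𝓝 (ι t)) := by
    induction t with
    | zero => simpa using tendsto_const_nhds
    | add s t hs ht => simpa only [map_add, mul_add] using hs.add ht
    | tmul a b =>
      simp only [Pos.coe_tmul, map_tmul_mul]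
      rw [← prod_atTop_atTop_eq]
      exact ((continuous_tmul ι).tendsto (a, b)).comp
        (((tendsto_pedBall_mul a).comp tendsto_fst).prodMk_nhds
          ((tendsto_pedBall_mul b).comp tendsto_snd))
  rw [Metric.tendsto_nhds]
  intro ε hε
  obtain ⟨t, ht⟩ := hι.denseRange.exists_dist_lt x (show 0 < ε / 3 by positivity)
  filter_upwards [Metric.tendsto_nhds.1 (h1 t) (ε / 3) (by positivity)] with p hp
  have hn : ‖(Pos.tmul ι p.1.1 p.2.1 : C)‖ ≤ 1 := norm_tmul_le_one ι p.1.2.2.le p.2.2.2.le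
  rw [dist_eq_norm] at hp ht ⊢
  have e : (Pos.tmul ι p.1.1 p.2.1 : C) * x - x = (Pos.tmul ι p.1.1 p.2.1 : C) * (x - ι t) +
      ((Pos.tmul ι p.1.1 p.2.1 : C) * ι t - ι t) - (x - ι t) := by
    rw [mul_sub]; abel
  rw [e]
  have h2 : ‖(Pos.tmul ι p.1.1 p.2.1 : C) * (x - ι t)‖ ≤ ‖x - ι t‖ :=
    (norm_mul_le _ _).trans (mul_le_of_le_one_left (norm_nonneg _) hn)
  have h3 := norm_sub_le ((Pos.tmul ι p.1.1 p.2.1 : C) * (x - ι t) +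
      ((Pos.tmul ι p.1.1 p.2.1 : C) * ι t - ι t)) (x - ι t)
  have h4 := norm_add_le ((Pos.tmul ι p.1.1 p.2.1 : C) * (x - ι t))
    ((Pos.tmul ι p.1.1 p.2.1 : C) * ι t - ι t)
  linarith

theorem IsPosFun.ext_tmul {φ : Pos A₁ → ℝ} (hφ : IsPosFun φ) {ψ : Pos A₂ → ℝ} (hψ : IsPosFun ψ)
    {ω : Pos C → ℝ} (hω : IsPosFun ω) (h : ∀ a b, ω (Pos.tmul ι a b) = φ a * ψ b) (a : A₁) (b : A₂) :
    hω.ext (ι (a ⊗ₜ[ℂ] b)) = hφ.ext a * hψ.ext b := by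
  let T : A₁ →ₗ[ℂ] A₂ →ₗ[ℂ] ℂ := ((TensorProduct.mk ℂ A₁ A₂).compr₂
    (ι : A₁ ⊗[ℂ] A₂ →ₗ[ℂ] C)).compr₂ (hω.ext : C →ₗ[ℂ] ℂ)
  let S : A₁ →ₗ[ℂ] A₂ →ₗ[ℂ] ℂ :=
    (LinearMap.mul ℂ ℂ).compl₁₂ (hφ.ext : A₁ →ₗ[ℂ] ℂ) (hψ.ext : A₂ →ₗ[ℂ] ℂ)
  have e : T = S := linearMap_ext_pos fun a => linearMap_ext_pos fun b => by
    change hω.ext (Pos.tmul ι a b) = hφ.ext a * hψ.ext b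
    rw [hω.ext_apply, hφ.ext_apply, hψ.ext_apply, h, Complex.ofReal_mul]
  exact congrArg (fun S => S a b) e

/-- The product of densely finite lower semicontinuous traces on the factors extends to the
completion in any C*-norm. -/
theorem exists_prod_ltc (hι : IsTensorCompletion β ι) (τ₁ : LTC A₁) (τ₂ : LTC A₂) :
    ∃ τ : LTC C, ∀ a b, τ (Pos.tmul ι a b) = τ₁ a * τ₂ b := by
  choose ω hω hω' using fun p : PedBall A₁ × PedBall A₂ =>
    exists_prod_posFun hι (τ₁.isPosFun_cutFun p.1) (τ₂.isPosFun_cutFun p.2)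
  have hmono (p q : PedBall A₁ × PedBall A₂) (hpq : p ≤ q) (x : Pos C) : ω p x ≤ ω q x := by
    -- With cuts `φ` and `ψ` of the two traces, the increment is `(φ_q - φ_p) ⊗ ψ_q + φ_p ⊗ (ψ_q -
    -- ψ_p)`, a sum of two positive product functionals.
    obtain ⟨D, hD, hD'⟩ := exists_prod_posFun hι (τ₁.isPosFun_cutFun_sub hpq.1)
      (τ₂.isPosFun_cutFun q.2)
    obtain ⟨E, hE, hE'⟩ := exists_prod_posFun hι (τ₁.isPosFun_cutFun p.1)
      (τ₂.isPosFun_cutFun_sub hpq.2)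
    have e := hι.posFun_ext (hω q) ((hω p).add_fun (hD.add_fun hE)) fun a b => by
      rw [hω', hω', hD', hE']
      ring
    rw [e]
    have := hD.nonneg x
    have := hE.nonneg x
    simp only
    linarith
  have hpolar (p q : PedBall A₁ × PedBall A₂) (t s : A₁ ⊗[ℂ] A₂) :
      (hω p).ext (star (ι t) * (Pos.tmul ι q.1.1 q.2.1 : C) * ι s) =
        (hω q).ext (ι s * (Pos.tmul ι p.1.1 p.2.1 : C) * star (ι t)) := by
    induction t with
    | zero => simp
    | add t t' ht ht' => simp only [map_add, star_add, add_mul, mul_add, ht, ht']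
    | tmul a b =>
      induction s with
      | zero => simp
      | add s s' hs hs' => simp only [map_add, add_mul, mul_add, hs, hs']
      | tmul c d =>
        simp only [star_map_tmul, Pos.coe_tmul, map_tmul_mul]
        rw [(τ₁.isPosFun_cutFun p.1).ext_tmul (τ₂.isPosFun_cutFun p.2) (hω p) (hω' p),
          (τ₁.isPosFun_cutFun q.1).ext_tmul (τ₂.isPosFun_cutFun q.2) (hω q) (hω' q),
          LTC.ext_cutFun_mul, LTC.ext_cutFun_mul]
  have hsym (p q : PedBall A₁ × PedBall A₂) (x : C) : ω p ((Pos.tmul ι q.1.1 q.2.1).conj x) =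
      ω q ((Pos.tmul ι p.1.1 p.2.1).conj (star x)) := by
    rw [(hω p).eq_re, (hω q).eq_re, Pos.coe_conj, Pos.coe_conj, star_star]
    congr 1
    refine hι.denseRange.induction_on (p := fun x : C =>
      (hω p).ext (star x * (Pos.tmul ι q.1.1 q.2.1 : C) * x) =
        (hω q).ext (x * (Pos.tmul ι p.1.1 p.2.1 : C) * star x)) x
      (isClosed_eq (by fun_prop) (by fun_prop)) fun t => hpolar p q t t
  have : IsDirected (PedBall A₁ × PedBall A₂) (· ≤ ·) := ⟨fun p q => by
    obtain ⟨e, h1, h2⟩ := exists_ge_ge p.1 q.1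
    obtain ⟨f, h3, h4⟩ := exists_ge_ge p.2 q.2
    exact ⟨(e, f), ⟨h1, h3⟩, ⟨h2, h4⟩⟩⟩
  obtain ⟨τ, hτ⟩ := exists_ltc_of_directed (fun p : PedBall A₁ × PedBall A₂ =>
    Pos.tmul ι p.1.1 p.2.1) ω hω hmono (fun p => norm_tmul_le_one ι p.1.2.2.le p.2.2.2.le) hsym
    (tendsto_pedBall_tmul_mul hι)
  refine ⟨τ, fun a b => ?_⟩
  rw [hτ, ← τ₁.iSup_cutFun, ← τ₂.iSup_cutFun, ENNReal.iSup_mul, iSup_prod]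
  refine iSup_congr fun e => ?_
  rw [ENNReal.mul_iSup]
  refine iSup_congr fun f => ?_
  rw [hω', ENNReal.ofReal_mul ((τ₁.isPosFun_cutFun e).nonneg a)]

end ProductTrace

/-! ### The Pedersen ideal of the completion and convergence on it -/

section TensorPedersen

variable {A₁ A₂ C : Type*}
  [NonUnitalCStarAlgebra A₁] [PartialOrder A₁] [StarOrderedRing A₁]
  [NonUnitalCStarAlgebra A₂] [PartialOrder A₂] [StarOrderedRing A₂]
  [NonUnitalCStarAlgebra C] [PartialOrder C] [StarOrderedRing C]
  {β : CStarNorm A₁ A₂} (ι : A₁ ⊗[ℂ] A₂ →⋆ₙₐ[ℂ] C)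

/-- `K(A₁)` and `K(A₂)` are spanned by products around elements `f` and `f'` with left units `u` and
`u'`, and `u ⊗ u'` is a left unit for `f ⊗ f'`. -/
theorem tmul_mem_pedersenIdeal {a : A₁} (ha : a ∈ pedersenIdeal A₁) {b : A₂}
    (hb : b ∈ pedersenIdeal A₂) : ι (a ⊗ₜ[ℂ] b) ∈ pedersenIdeal C := by
  replace ha := pedersenIdeal_le_idealSpan_unitSet A₁ ha
  replace hb := pedersenIdeal_le_idealSpan_unitSet A₂ hb
  induction ha using Submodule.span_induction with
  | zero => simp
  | add x y _ _ hx hy => rw [TensorProduct.add_tmul, map_add]; exact Submodule.add_mem _ hx hy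
  | smul c x _ hx =>
    rw [← TensorProduct.smul_tmul', map_smul]; exact Submodule.smul_mem _ c hx
  | mem a h =>
    obtain ⟨x, f, z, ⟨u, hu⟩, rfl⟩ := h
    induction hb using Submodule.span_induction with
    | zero => simp
    | add x y _ _ hx hy => rw [TensorProduct.tmul_add, map_add]; exact Submodule.add_mem _ hx hy
    | smul c x _ hx => rw [TensorProduct.tmul_smul, map_smul]; exact Submodule.smul_mem _ c hx
    | mem b h =>
      obtain ⟨x', f', z', ⟨u', hu'⟩, rfl⟩ := h
      rw [← map_tmul_mul, ← map_tmul_mul]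
      refine mem_pedersenIdeal_mul (mul_mem_pedersenIdeal ?_ _) _
      refine mem_pedersenIdeal_of_mul_eq (a := ι (u ⊗ₜ[ℂ] u')) ?_
      rw [map_tmul_mul, hu, hu']

/-- The elementary tensor of positive elements of the Pedersen ideals. -/
def PedPos.tmul (a : PedPos A₁) (b : PedPos A₂) : PedPos C :=
  ⟨Pos.tmul ι a.1 b.1, tmul_mem_pedersenIdeal ι a.2 b.2⟩

theorem PedPos.conj_tmul (a : PedPos A₁) (b : PedPos A₂) (u : A₁) (v : A₂) :
    (PedPos.tmul ι a b).conj (ι (u ⊗ₜ[ℂ] v)) = PedPos.tmul ι (a.conj u) (b.conj v) :=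
  Subtype.ext (Pos.conj_tmul ι a.1 b.1 u v)

theorem continuous_pos_tmul : Continuous fun p : Pos A₁ × Pos A₂ => Pos.tmul ι p.1 p.2 :=
  ((continuous_tmul ι).comp (f := fun p : Pos A₁ × Pos A₂ => ((p.1 : A₁), (p.2 : A₂)))
    (by fun_prop)).subtype_mk _

variable {ι}

theorem IsTensorCompletion.eq_top (hι : IsTensorCompletion β ι) {S : Submodule ℂ C}
    (hS : IsClosed (S : Set C)) (h : ∀ (a : Pos A₁) (b : Pos A₂), (Pos.tmul ι a b : C) ∈ S) :
    S = ⊤ := by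
  let T : A₁ →ₗ[ℂ] A₂ →ₗ[ℂ] (C ⧸ S) := ((TensorProduct.mk ℂ A₁ A₂).compr₂
    (ι : A₁ ⊗[ℂ] A₂ →ₗ[ℂ] C)).compr₂ S.mkQ
  have e : T = 0 := linearMap_ext_pos fun a => linearMap_ext_pos fun b =>
    (Submodule.Quotient.mk_eq_zero S).2 (h a b)
  have h1 (t : A₁ ⊗[ℂ] A₂) : ι t ∈ S := by
    induction t with
    | zero => simp
    | add s t hs ht => rw [map_add]; exact S.add_mem hs ht
    | tmul a b => exact (Submodule.Quotient.mk_eq_zero S).1 (congrArg (fun S => S a b) e)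
  exact eq_top_iff.2 fun x _ => hι.denseRange.induction_on (p := fun x => x ∈ S) x hS h1

/-- The Pedersen ideal of the completion is contained in the ideal generated by the elementary
tensors from the Pedersen ideals of the factors. -/
theorem IsTensorCompletion.pedersenIdeal_le (hι : IsTensorCompletion β ι) :
    pedersenIdeal C ≤ idealSpan {e | ∃ (a : PedPos A₁) (b : PedPos A₂), e = Pos.tmul ι a.1 b.1} := by
  refine pedersenIdeal_le_idealSpan
    (hι.eq_top (Submodule.isClosed_topologicalClosure _) fun a b => ?_)
  refine ((dense_pedPos A₁).prod (dense_pedPos A₂)).induction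
    (P := fun p => (Pos.tmul ι p.1 p.2 : C) ∈ (idealSpan _).topologicalClosure) ?_ ?_ (a, b)
  · intro p hp
    exact mem_closure_idealSpan ⟨⟨p.1, hp.1⟩, ⟨p.2, hp.2⟩, rfl⟩
  · exact (Submodule.isClosed_topologicalClosure _).preimage
      (continuous_subtype_val.comp (continuous_pos_tmul ι))

/-- Uniformly bounded functionals that converge at the elementary tensors converge everywhere. -/
theorem IsTensorCompletion.tendsto_clm (hι : IsTensorCompletion β ι) {I : Type*} {l : Filter I}
    {L : I → C →L[ℂ] ℂ} {L₀ : C →L[ℂ] ℂ} {M : ℝ} (hM : ∀ᶠ i in l, ∀ x, ‖L i x‖ ≤ M * ‖x‖)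
    (hM₀ : ∀ x, ‖L₀ x‖ ≤ M * ‖x‖) (h : ∀ (a : Pos A₁) (b : Pos A₂),
      Tendsto (fun i => L i (Pos.tmul ι a b)) l (𝓝 (L₀ (Pos.tmul ι a b)))) (x : C) :
    Tendsto (fun i => L i x) l (𝓝 (L₀ x)) := by
  let V : Submodule ℂ C :=
    { carrier := {x | Tendsto (fun i => L i x) l (𝓝 (L₀ x))}
      zero_mem' := by simpa using tendsto_const_nhds
      add_mem' := fun {x y} hx hy => by
        have := Tendsto.add (Set.mem_ofPred.1 hx) (Set.mem_ofPred.1 hy)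
        simpa only [Set.mem_ofPred_eq, map_add] using this
      smul_mem' := fun c x hx => by
        have := Tendsto.const_smul (Set.mem_ofPred.1 hx) c
        simpa only [Set.mem_ofPred_eq, map_smul] using this }
  suffices hV : V = ⊤ from (hV ▸ Submodule.mem_top : x ∈ V)
  refine hι.eq_top (isClosed_of_closure_subset fun y hy => ?_) h
  change Tendsto (fun i => L i y) l (𝓝 (L₀ y))
  rw [Metric.tendsto_nhds]
  intro ε hε
  obtain ⟨z, hz, hyz⟩ := Metric.mem_closure_iff.1 hy (ε / (3 * (|M| + 1))) (by positivity)
  have hz' : Tendsto (fun i => L i z) l (𝓝 (L₀ z)) := hz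
  filter_upwards [hM, Metric.tendsto_nhds.1 hz' (ε / 3) (by positivity)] with i hi hi'
  have hb : M * ‖y - z‖ < ε / 3 := by
    rw [dist_eq_norm, lt_div_iff₀ (by positivity)] at hyz
    have : M * ‖y - z‖ ≤ |M| * ‖y - z‖ :=
      mul_le_mul_of_nonneg_right (le_abs_self M) (norm_nonneg _)
    nlinarith [norm_nonneg (y - z)]
  have h1 := hi (y - z)
  have h2 := hM₀ (y - z)
  rw [dist_eq_norm] at hi' ⊢
  have e : L i y - L₀ y = L i (y - z) + (L i z - L₀ z) - L₀ (y - z) := by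
    rw [map_sub, map_sub]; ring
  rw [e]
  have h3 := norm_sub_le (L i (y - z) + (L i z - L₀ z)) (L₀ (y - z))
  have h4 := norm_add_le (L i (y - z)) (L i z - L₀ z)
  linarith

theorem LTC.restrict_conj_sqrt_le {A : Type*} [NonUnitalCStarAlgebra A] [PartialOrder A]
    [StarOrderedRing A] (τ : LTC A) (e : PedPos A) (x : Pos A) :
    (LTC.restrict A τ (e.conj (x.sqrt : A)) : ℝ) ≤ LTC.restrict A τ e * ‖(x : A)‖ := by
  have h : LTC.restrict A τ (e.conj (x.sqrt : A)) ≤ ‖(x : A)‖₊ * LTC.restrict A τ e := by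
    rw [← ENNReal.coe_le_coe, ENNReal.coe_mul, LTC.coe_restrict, LTC.coe_restrict,
      PedPos.conj_val, τ.2.1.conj_sqrt]
    have := τ.2.1.conj_le x (e.1.sqrt : A) (x.conj (e.1.sqrt : A)) rfl
    rwa [Pos.starMul_sqrt] at this
  rw [mul_comm]
  exact_mod_cast h

/-- Convergence at the elementary tensors implies convergence on the Pedersen ideal. -/
theorem IsTensorCompletion.tendsto_restrict (hι : IsTensorCompletion β ι) {I : Type*} {l : Filter I}
    {τ : I → LTC C} {σ : LTC C} (h : ∀ (a : PedPos A₁) (b : PedPos A₂),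
      Tendsto (fun i => LTC.restrict C (τ i) (PedPos.tmul ι a b)) l
        (𝓝 (LTC.restrict C σ (PedPos.tmul ι a b)))) (k : PedPos C) :
    Tendsto (fun i => LTC.restrict C (τ i) k) l (𝓝 (LTC.restrict C σ k)) := by
  -- For fixed `a ⊗ b`, the functionals `x ↦ τᵢ (√x (a ⊗ b) √x)` are eventually bounded by a
  -- multiple of `σ (a ⊗ b) + 1`. At `x = c ⊗ d` the argument is again an elementary tensor, so they
  -- converge for every `x`.
  have h1 (a : PedPos A₁) (b : PedPos A₂) (x : Pos C) :
      Tendsto (fun i => (LTC.restrict C (τ i) ((PedPos.tmul ι a b).conj (x.sqrt : C)) : ℝ)) l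
        (𝓝 (LTC.restrict C σ ((PedPos.tmul ι a b).conj (x.sqrt : C)))) := by
    set e := PedPos.tmul ι a b with he
    set M : ℝ := LTC.restrict C σ e + 1
    have hM : ∀ᶠ i in l, (LTC.restrict C (τ i) e : ℝ) ≤ M := by
      have := (NNReal.tendsto_coe.2 (h a b)).eventually (gt_mem_nhds (lt_add_one _))
      exact this.mono fun i hi => hi.le
    have hM0 : 0 ≤ M := by positivity
    have key := hι.tendsto_clm (l := l) (L := fun i => ((τ i).reg_restrict.isPosFun e).ext)
      (L₀ := (σ.reg_restrict.isPosFun e).ext) (M := 4 * M) ?_ ?_ ?_ x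
    · have := (Complex.continuous_re.tendsto _).comp key
      simpa only [Function.comp_def, IsPosFun.ext_apply, Complex.ofReal_re] using this
    · filter_upwards [hM] with i hi
      refine IsPosFun.norm_ext_le _ (fun y => ((τ i).restrict_conj_sqrt_le e y).trans ?_) hM0
      exact mul_le_mul_of_nonneg_right hi (norm_nonneg _)
    · refine IsPosFun.norm_ext_le _ (fun y => (σ.restrict_conj_sqrt_le e y).trans ?_) hM0
      exact mul_le_mul_of_nonneg_right (lt_add_one _).le (norm_nonneg _)
    · intro c d
      simp only [IsPosFun.ext_apply]
      have hs (ρ : LTC C) : LTC.restrict C ρ (e.conj ((Pos.tmul ι c d).sqrt : C)) =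
          LTC.restrict C ρ (PedPos.tmul ι (a.conj (c.sqrt : A₁)) (b.conj (d.sqrt : A₂))) := by
        rw [← PedPos.conj_tmul]
        refine ρ.reg_restrict.conj_congr e ?_
        rw [Pos.star_eq, Pos.sqrt_mul_sqrt, star_map_tmul, map_tmul_mul, Pos.star_eq, Pos.star_eq,
          Pos.sqrt_mul_sqrt, Pos.sqrt_mul_sqrt, Pos.coe_tmul]
      simp only [hs]
      exact (Complex.continuous_ofReal.tendsto _).comp (NNReal.tendsto_coe.2 (h _ _))
  have hP : ∀ p ∈ conjCone {e | ∃ (a : PedPos A₁) (b : PedPos A₂), e = Pos.tmul ι a.1 b.1},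
      ∃ hp : (p : C) ∈ pedersenIdeal C, Tendsto (fun i => (LTC.restrict C (τ i) ⟨p, hp⟩ : ℝ)) l
        (𝓝 (LTC.restrict C σ ⟨p, hp⟩)) := by
    intro p hp
    induction hp using AddSubmonoid.closure_induction with
    | zero =>
      refine ⟨Submodule.zero_mem _, ?_⟩
      have (ρ : LTC C) : LTC.restrict C ρ ⟨0, Submodule.zero_mem _⟩ = 0 :=
        ρ.reg_restrict.eq_zero _ rfl
      simpa only [this] using tendsto_const_nhds
    | add x y _ _ hx hy =>
      obtain ⟨hx, hx'⟩ := hx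
      obtain ⟨hy, hy'⟩ := hy
      refine ⟨Submodule.add_mem _ hx hy, ?_⟩
      have (ρ : LTC C) : (LTC.restrict C ρ ⟨x + y, Submodule.add_mem _ hx hy⟩ : ℝ) =
          LTC.restrict C ρ ⟨x, hx⟩ + LTC.restrict C ρ ⟨y, hy⟩ :=
        congrArg NNReal.toReal (ρ.reg_restrict.add ⟨x, hx⟩ ⟨y, hy⟩)
      simpa only [this] using hx'.add hy'
    | mem p hp =>
      obtain ⟨_, ⟨a, b, rfl⟩, w, rfl⟩ := hp
      refine ⟨((PedPos.tmul ι a b).conj w).2, ?_⟩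
      have (ρ : LTC C) : LTC.restrict C ρ ((PedPos.tmul ι a b).conj w) =
          LTC.restrict C ρ ((PedPos.tmul ι a b).conj ((Pos.starMul (star w)).sqrt : C)) := by
        refine ρ.reg_restrict.conj_congr _ ?_
        rw [Pos.star_eq, Pos.sqrt_mul_sqrt, Pos.coe_starMul, star_star]
      change Tendsto (fun i => (LTC.restrict C (τ i) ((PedPos.tmul ι a b).conj w) : ℝ)) l
        (𝓝 (LTC.restrict C σ ((PedPos.tmul ι a b).conj w)))
      simp only [this]
      exact h1 a b _
  -- A general `k ∈ K(C)₊` is a difference of sums of elements `w* (a ⊗ b) w`, whose values depend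
  -- only on `w w*`.
  obtain ⟨n, hn, p, hp, hk⟩ := exists_add_eq_of_mem_idealSpan (hι.pedersenIdeal_le k.2)
  obtain ⟨hn, hn'⟩ := hP n hn
  obtain ⟨hp, hp'⟩ := hP p hp
  have hsub (ρ : LTC C) : (LTC.restrict C ρ k : ℝ) =
      LTC.restrict C ρ ⟨p, hp⟩ - LTC.restrict C ρ ⟨n, hn⟩ := by
    have h2 : (⟨p, hp⟩ : PedPos C) = k + ⟨n, hn⟩ := Subtype.ext hk.symm
    have h3 := congrArg NNReal.toReal (ρ.reg_restrict.add k ⟨n, hn⟩)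
    rw [NNReal.coe_add] at h3
    rw [h2]
    exact eq_sub_of_add_eq h3.symm
  rw [← NNReal.tendsto_coe]
  simpa only [hsub] using hp'.sub hn'

/-- A densely finite lower semicontinuous trace on the completion is determined by its values at
the elementary tensors. -/
theorem IsTensorCompletion.ltc_ext (hι : IsTensorCompletion β ι) {σ τ : LTC C}
    (h : ∀ (a : PedPos A₁) (b : PedPos A₂),
      LTC.restrict C σ (PedPos.tmul ι a b) = LTC.restrict C τ (PedPos.tmul ι a b)) : σ = τ := by
  refine LTC.ext_of_restrict fun k => ?_
  -- Uniqueness is uniqueness of limits for a constant family.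
  have := hι.tendsto_restrict (l := pure ()) (τ := fun _ => σ) (σ := τ) (fun a b => by
    rw [← h]; exact tendsto_const_nhds) k
  exact tendsto_nhds_unique tendsto_const_nhds this

end TensorPedersen

/-! ### Slices of a trace on the completion -/

section Slices

variable {A₁ A₂ C : Type*}
  [NonUnitalCStarAlgebra A₁] [PartialOrder A₁] [StarOrderedRing A₁]
  [NonUnitalCStarAlgebra A₂] [PartialOrder A₂] [StarOrderedRing A₂]
  [NonUnitalCStarAlgebra C] [PartialOrder C] [StarOrderedRing C]
  {β : CStarNorm A₁ A₂} (ι : A₁ ⊗[ℂ] A₂ →⋆ₙₐ[ℂ] C)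

/-- Writing `a = √a √a` makes `a ⊗ x* x` equal to `(√a ⊗ x)* (√a ⊗ x)`, to which the trace property
applies. -/
theorem IsTrace.tmul_right {τ : Pos C → ℝ≥0∞} (hτ : IsTrace τ) (a : Pos A₁) :
    IsTrace (fun b : Pos A₂ => τ (Pos.tmul ι a b)) :=
  ⟨fun b c => by rw [Pos.tmul_add, hτ.add], fun t b => by rw [Pos.tmul_scale, hτ.scale],
    fun x => by
      conv_lhs => rw [← Pos.starMul_sqrt a]
      conv_rhs => rw [← Pos.starMul_sqrt a]
      rw [← Pos.starMul_tmul, hτ.tracial, star_map_tmul, Pos.starMul_tmul, Pos.star_eq]⟩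

theorem IsTrace.tmul_left {τ : Pos C → ℝ≥0∞} (hτ : IsTrace τ) (b : Pos A₂) :
    IsTrace (fun a : Pos A₁ => τ (Pos.tmul ι a b)) :=
  ⟨fun b c => by rw [Pos.add_tmul, hτ.add], fun t b => by rw [Pos.scale_tmul, hτ.scale],
    fun x => by
      conv_lhs => rw [← Pos.starMul_sqrt b]
      conv_rhs => rw [← Pos.starMul_sqrt b]
      rw [← Pos.starMul_tmul, hτ.tracial, star_map_tmul, Pos.starMul_tmul, Pos.star_eq]⟩

/-- The trace `b ↦ τ (a ⊗ b)` on the second factor. -/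
def LTC.slice (τ : LTC C) (a : PedPos A₁) : LTC A₂ :=
  ⟨fun b => τ (Pos.tmul ι a.1 b), τ.2.1.tmul_right ι a.1,
    τ.2.2.1.comp ((continuous_pos_tmul ι).comp (f := fun b => (a.1, b)) (by fun_prop)),
    (dense_pedPos A₂).mono fun b hb => τ.lt_top (PedPos.tmul ι a ⟨b, hb⟩)⟩

theorem LTC.restrict_slice (τ : LTC C) (a : PedPos A₁) (b : PedPos A₂) :
    LTC.restrict A₂ (τ.slice ι a) b = LTC.restrict C τ (PedPos.tmul ι a b) := rfl

/-- At each `b ∈ K(A₂)₊` this is a trace in `a`; the trace on `C` thus becomes an `LTC(A₂)`-valued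
one. -/
theorem LTC.reg_slice (τ : LTC C) : Reg (τ.slice ι : PedPos A₁ → LTC A₂) := by
  refine Reg.of_injective (LTC.restrict A₂) (LTC.restrict_injective A₂) (Reg.pi fun b => ?_)
  refine Reg.of_coe ?_
  simp only [LTC.restrict_slice, LTC.coe_restrict]
  exact (τ.2.1.tmul_left ι b.1).reg

end Slices

/-! ### Density of sums of product traces -/

section Approximation

variable {A₁ A₂ C : Type*}
  [NonUnitalCStarAlgebra A₁] [PartialOrder A₁] [StarOrderedRing A₁]
  [NonUnitalCStarAlgebra A₂] [PartialOrder A₂] [StarOrderedRing A₂]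
  [NonUnitalCStarAlgebra C] [PartialOrder C] [StarOrderedRing C]
  {β : CStarNorm A₁ A₂} {ι : A₁ ⊗[ℂ] A₂ →⋆ₙₐ[ℂ] C}

theorem PedPos.exists_upper_bound {A : Type*} [NonUnitalCStarAlgebra A] [PartialOrder A]
    [StarOrderedRing A] {X : Type*} (f : X → PedPos A) (F : Finset X) :
    ∃ a : PedPos A, ∀ p ∈ F, ((f p).1 : A) ≤ a.1 := by
  classical
  induction F using Finset.induction_on with
  | empty => exact ⟨⟨0, Submodule.zero_mem _⟩, by simp⟩
  | insert p F _ ih =>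
    obtain ⟨a, ha⟩ := ih
    refine ⟨f p + a, fun q hq => ?_⟩
    rcases Finset.mem_insert.1 hq with rfl | hq
    · exact le_add_of_nonneg_right a.1.2
    · exact (ha q hq).trans (le_add_of_nonneg_left (f p).1.2)

/-- If `s` is comparable with every multiple `(j / N) u`, then it is a multiple of `u` up to
`(1 / N) u`. -/
theorem LTC.exists_between_smul {A : Type*} [NonUnitalCStarAlgebra A] [PartialOrder A]
    [StarOrderedRing A] {s u : LTC A} (hsu : s ≤ u) {N : ℕ} (hN : 0 < N)
    (h : ∀ j ≤ N, s ≤ ((j : ℝ≥0) / N) • u ∨ ((j : ℝ≥0) / N) • u ≤ s) :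
    ∃ c : ℝ≥0, c • u ≤ s ∧ s ≤ (c + (N : ℝ≥0)⁻¹) • u := by
  classical
  let P : ℕ → Prop := fun j => ((j : ℝ≥0) / N) • u ≤ s
  have hP0 : P 0 := by
    change ((0 : ℕ) / (N : ℝ≥0)) • u ≤ s
    rw [Nat.cast_zero, zero_div, zero_smul]
    exact zero_le
  have hN' : (N : ℝ≥0) ≠ 0 := by exact_mod_cast hN.ne'
  have hj : P (Nat.findGreatest P N) := Nat.findGreatest_spec (zero_le (a := N)) hP0
  have hjN : Nat.findGreatest P N ≤ N := Nat.findGreatest_le N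
  -- `c = j / N` for the largest `j ≤ N` with `(j / N) u ≤ s`. If `j < N`, comparability forces `s ≤
  -- ((j + 1) / N) u`; if `j = N`, then `s ≤ u` is enough.
  refine ⟨_, hj, ?_⟩
  rcases hjN.eq_or_lt with he | hlt
  · rw [he, div_self hN']
    refine hsu.trans ?_
    rw [add_smul, one_smul]
    exact le_self_add
  · have h1 : ¬ P (Nat.findGreatest P N + 1) :=
      Nat.findGreatest_is_greatest (Nat.lt_succ_self _) hlt
    have h2 := (h _ hlt).resolve_right h1
    rwa [Nat.cast_succ, add_div, one_div] at h2

/-- Both `(t / v) u` and `s` lie between `c u` and `(c + d) u`, an interval of length `d u ≤ d v`.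
If `v = 0`, then `u` and `s` vanish and the convention for `v⁻¹` is harmless. -/
theorem abs_sub_le_of_proportional {s t u v c d : ℝ} (hu : 0 ≤ u) (huv : u ≤ v) (h1 : c * u ≤ s)
    (h2 : s ≤ (c + d) * u) (h3 : c * v ≤ t) (h4 : t ≤ (c + d) * v) (hd : 0 ≤ d) :
    |v⁻¹ * t * u - s| ≤ d * v := by
  rcases (hu.trans huv).eq_or_lt with hv | hv
  · have hu0 : u = 0 := le_antisymm (hv ▸ huv) hu
    subst hu0
    rw [mul_zero] at h1 h2
    have : s = 0 := le_antisymm h2 h1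
    simp [this, ← hv]
  · have h5 : c ≤ v⁻¹ * t := by rw [le_inv_mul_iff₀ hv]; linarith
    have h6 : v⁻¹ * t ≤ c + d := by rw [inv_mul_le_iff₀ hv]; linarith
    have h7 := mul_le_mul_of_nonneg_right h5 hu
    have h8 := mul_le_mul_of_nonneg_right h6 hu
    have h9 := mul_le_mul_of_nonneg_left huv hd
    rw [abs_le]
    constructor <;> nlinarith

/-- A trace on the completion is approximated at finitely many elementary tensors by finite sums
of product traces. -/
theorem exists_algTensor_approx (hι : IsTensorCompletion β ι) (τ : LTC C)
    (F : Finset (PedPos A₁ × PedPos A₂)) {ε : ℝ} (hε : 0 < ε) :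
    ∃ σ ∈ (algTensor A₁ A₂).comap (tensorValues ι), ∀ p ∈ F,
      |(LTC.restrict C σ (PedPos.tmul ι p.1 p.2) : ℝ) -
        LTC.restrict C τ (PedPos.tmul ι p.1 p.2)| ≤ ε := by
  obtain ⟨a', ha'⟩ := PedPos.exists_upper_bound Prod.fst F
  obtain ⟨b', hb'⟩ := PedPos.exists_upper_bound Prod.snd F
  obtain ⟨N, hN⟩ := exists_nat_gt ((LTC.restrict C τ (PedPos.tmul ι a' b') : ℝ) / ε)
  have hN0 : (0 : ℝ) < N := lt_of_le_of_lt (by positivity) hN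
  have hN0' : 0 < N := by exact_mod_cast hN0
  have hΦ := τ.reg_slice ι (A₁ := A₁) (A₂ := A₂)
  set Φ : PedPos A₁ → LTC A₂ := τ.slice ι with hΦdef
  -- The listed pairs compare each `Φ a` from `F` with every multiple `(j / N) Φ a'`; after the
  -- cuts, each piece of `Φ a` is `c u k` up to `u k / N`.
  obtain ⟨n, Q, hQ, hQL⟩ := LTC.exists_partition
    ((F.toList ×ˢ List.range (N + 1)).map fun q => (Φ q.1.1, ((q.2 : ℝ≥0) / N) • Φ a'))
  let u (k : Fin n) : LTC A₂ := Q k (Φ a')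
  have hle (p) (hp : p ∈ F) : Φ p.1 ≤ Φ a' := by
    obtain ⟨c, hc⟩ := PedPos.exists_add_of_le (ha' p hp)
    rw [hc, hΦ.add]
    exact le_self_add
  have hcut (k : Fin n) (p) (hp : p ∈ F) :
      ∃ c : ℝ≥0, c • u k ≤ Q k (Φ p.1) ∧ Q k (Φ p.1) ≤ (c + (N : ℝ≥0)⁻¹) • u k := by
    refine LTC.exists_between_smul (LTC.map_le_map (Q k) (hle p hp)) hN0' fun j hj => ?_
    have := hQL k (Φ p.1, ((j : ℝ≥0) / N) • Φ a') (List.mem_map.2 ⟨(p, j),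
      List.pair_mem_product.2
        ⟨Finset.mem_toList.2 hp, List.mem_range.2 (Nat.lt_succ_of_le hj)⟩, rfl⟩)
    simpa only [map_smul] using this
  -- The coefficient of proportionality is read off at `b'`, which makes it a trace in `a`. If `u k`
  -- vanishes at `b'`, the inverse is zero and so is the trace.
  have hlam (k : Fin n) : ∃ lam : LTC A₁, ∀ a, LTC.restrict A₁ lam a =
      (LTC.restrict A₂ (u k) b')⁻¹ * LTC.restrict A₂ (Q k (Φ a)) b' := by
    obtain ⟨lam, h⟩ := (hΦ.comp ((LTC.restrict A₂ (u k) b')⁻¹ •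
      ((LinearMap.proj b').comp ((LTC.restrict A₂).comp (Q k))))).exists_ltc
    exact ⟨lam, fun a => congrFun h a⟩
  choose lam hlam using hlam
  choose σ hσ using fun k => exists_prod_ltc hι (lam k) (u k)
  refine ⟨∑ k, σ k, Submodule.sum_mem _ fun k _ =>
    Submodule.subset_span ⟨lam k, u k, fun a b => hσ k a.1 b.1⟩, fun p hp => ?_⟩
  have hσ' (k : Fin n) : LTC.restrict C (σ k) (PedPos.tmul ι p.1 p.2) =
      (LTC.restrict A₂ (u k) b')⁻¹ * LTC.restrict A₂ (Q k (Φ p.1)) b' *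
        LTC.restrict A₂ (u k) p.2 := by
    rw [← hlam, ← ENNReal.coe_inj, ENNReal.coe_mul, LTC.coe_restrict, LTC.coe_restrict,
      LTC.coe_restrict]
    exact hσ k p.1.1 p.2.1
  have hsum (a : PedPos A₁) (b : PedPos A₂) : LTC.restrict C τ (PedPos.tmul ι a b) =
      ∑ k, LTC.restrict A₂ (Q k (Φ a)) b := by
    rw [← LTC.restrict_slice, ← hΦdef, ← Finset.sum_apply, ← map_sum, hQ]
  rw [hsum, map_sum, Finset.sum_apply, NNReal.coe_sum, NNReal.coe_sum, ← Finset.sum_sub_distrib]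
  have hterm (k : Fin n) : |(LTC.restrict C (σ k) (PedPos.tmul ι p.1 p.2) : ℝ) -
      LTC.restrict A₂ (Q k (Φ p.1)) p.2| ≤ (N : ℝ)⁻¹ * LTC.restrict A₂ (u k) b' := by
    obtain ⟨c, h1, h2⟩ := hcut k p hp
    have hreal (x : PedPos A₂) : (c : ℝ) * LTC.restrict A₂ (u k) x ≤ LTC.restrict A₂ (Q k (Φ p.1)) x ∧
        (LTC.restrict A₂ (Q k (Φ p.1)) x : ℝ) ≤ (c + (N : ℝ)⁻¹) * LTC.restrict A₂ (u k) x := by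
      have h3 := LTC.le_iff.1 h1 x
      have h4 := LTC.le_iff.1 h2 x
      rw [map_smul, Pi.smul_apply, smul_eq_mul] at h3 h4
      exact ⟨by exact_mod_cast h3, by exact_mod_cast h4⟩
    rw [hσ', NNReal.coe_mul, NNReal.coe_mul, NNReal.coe_inv]
    exact abs_sub_le_of_proportional (NNReal.coe_nonneg _)
      (NNReal.coe_le_coe.2 ((u k).reg_restrict.mono (hb' p hp))) (hreal p.2).1 (hreal p.2).2
      (hreal b').1 (hreal b').2 (by positivity)
  refine (Finset.abs_sum_le_sum_abs _ _).trans ((Finset.sum_le_sum fun k _ => hterm k).trans ?_)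
  -- The errors `u k b' / N` add up to `τ (a' ⊗ b') / N`, which is below `ε` by the choice of `N`.
  rw [← Finset.mul_sum, ← NNReal.coe_sum, ← hsum, inv_mul_le_iff₀ hN0]
  rw [div_lt_iff₀ hε] at hN
  exact hN.le

/-- The sums of product traces are dense. -/
theorem restrict_mem_tensorCone (hι : IsTensorCompletion β ι) (τ : LTC C) :
    LTC.restrict C τ ∈ tensorCone ι := by
  classical
  -- The approximants form a net indexed by a finite set of tensors and a precision; it converges at
  -- each elementary tensor, hence on `K(C)₊`.
  choose σ hσ hσ' using fun i : Finset (PedPos A₁ × PedPos A₂) × ℕ =>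
    exists_algTensor_approx hι τ i.1 (ε := 1 / ((i.2 : ℝ) + 1)) (by positivity)
  have ht (k : PedPos C) := hι.tendsto_restrict (l := atTop) (τ := σ) (σ := τ) (fun a b => by
    rw [← NNReal.tendsto_coe, Metric.tendsto_nhds]
    intro ε hε
    obtain ⟨m, hm⟩ := exists_nat_one_div_lt hε
    filter_upwards [eventually_ge_atTop (({(a, b)} : Finset (PedPos A₁ × PedPos A₂)), m)] with i hi
    rw [Real.dist_eq]
    refine (hσ' i (a, b) (hi.1 (Finset.mem_singleton_self _))).trans_lt (lt_of_le_of_lt ?_ hm)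
    exact one_div_le_one_div_of_le (by positivity) (by
      have : m ≤ i.2 := hi.2
      have : (m : ℝ) ≤ i.2 := by exact_mod_cast this
      linarith)) k
  exact mem_closure_of_tendsto (tendsto_pi_nhds.2 ht)
    (Eventually.of_forall fun i => Submodule.mem_map_of_mem (hσ i))

theorem tensorCone_le_range (ι : A₁ ⊗[ℂ] A₂ →⋆ₙₐ[ℂ] C) {φ : PedPos C → ℝ≥0}
    (hφ : φ ∈ tensorCone ι) : φ ∈ Set.range (LTC.restrict C) := by
  refine closure_minimal ?_ (LTC.isClosed_range_restrict C) hφ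
  rintro _ ⟨τ, -, rfl⟩
  exact ⟨τ, rfl⟩

/-- The extension of the elements of `LTC(A₁) ⊗_β LTC(A₂)` to traces on `C`. -/
def tensorConeEquiv (hι : IsTensorCompletion β ι) : LTC C ≃ₗ[ℝ≥0] tensorCone ι :=
  LinearEquiv.ofBijective ((LTC.restrict C).codRestrict (tensorCone ι) (restrict_mem_tensorCone hι))
    ⟨fun σ τ h => LTC.restrict_injective C (congrArg Subtype.val h), fun φ => by
      obtain ⟨τ, hτ⟩ := tensorCone_le_range ι φ.2
      exact ⟨τ, Subtype.ext hτ⟩⟩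

theorem restrict_tensorConeEquiv_symm (hι : IsTensorCompletion β ι) (φ : tensorCone ι) :
    LTC.restrict C ((tensorConeEquiv hι).symm φ) = φ :=
  congrArg Subtype.val ((tensorConeEquiv hι).apply_symm_apply φ)

theorem existsUnique_tensorValues_eq (hι : IsTensorCompletion β ι)
    {f : PedPos A₁ × PedPos A₂ → ℝ≥0∞} (hf : f ∈ algTensor A₁ A₂) :
    ∃! τ : LTC C, tensorValues ι τ = f := by
  have h : algTensor A₁ A₂ ≤ LinearMap.range (tensorValues ι) := by
    refine Submodule.span_le.2 ?_
    rintro f ⟨τ₁, τ₂, h⟩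
    obtain ⟨τ, hτ⟩ := exists_prod_ltc hι τ₁ τ₂
    exact ⟨τ, funext fun p => (hτ p.1.1 p.2.1).trans (h p.1 p.2).symm⟩
  obtain ⟨τ, rfl⟩ := h hf
  refine ⟨τ, rfl, fun σ hσ => hι.ltc_ext fun a b => ?_⟩
  exact congrArg ENNReal.toNNReal (congrFun hσ (a, b))

end Approximation

end TracialCone

end

/-! ### The main theorem -/

theorem mainTheorem2 {A₁ A₂ C : Type*}
    [NonUnitalCStarAlgebra A₁] [PartialOrder A₁] [StarOrderedRing A₁]
    [NonUnitalCStarAlgebra A₂] [PartialOrder A₂] [StarOrderedRing A₂]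
    [NonUnitalCStarAlgebra C] [PartialOrder C] [StarOrderedRing C]
    (β : TracialCone.CStarNorm A₁ A₂) (ι : A₁ ⊗[ℂ] A₂ →⋆ₙₐ[ℂ] C)
    (hι : TracialCone.IsTensorCompletion β ι) :
    (∀ f ∈ TracialCone.algTensor A₁ A₂,
        ∃! τ : TracialCone.LTC C, TracialCone.tensorValues ι τ = f) ∧
      ∃ 𝒯 : TracialCone.tensorCone ι ≃L[ℝ≥0] TracialCone.LTC C,
        ∀ φ : TracialCone.tensorCone ι, TracialCone.LTC.restrict C (𝒯 φ) = φ := by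
  refine ⟨fun f hf => TracialCone.existsUnique_tensorValues_eq hι hf,
    { (TracialCone.tensorConeEquiv hι).symm with
      -- The topology of `LTC(C)` is induced by restriction, and restricting `𝒯 φ` returns `φ`, so
      -- continuity in both directions is immediate.
      continuous_toFun := continuous_induced_rng.2 ?_
      continuous_invFun := Continuous.subtype_mk continuous_induced_dom _ },
    TracialCone.restrict_tensorConeEquiv_symm hι⟩
  exact continuous_subtype_val.congr fun φ =>
    (TracialCone.restrict_tensorConeEquiv_symm hι φ).symm
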